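/- **Corollary (Lifted Simplex Predicate).** Let $K\subset\mathbb R^d$ be a finite geometric simplicial complex (possibly containing $d$-simplices), with $n_0$ vertices and $n_{d-1}$ simplices of dimension $d-1$. Let $\hat x=(x_1,\dots,x_d,x\cdot x)\in\mathbb R^{d+1}$ be the parabolic lift of $x\in\mathbb R^d$, and let $\hat K\subset\mathbb R^{d+1}$ be the simplicial complex obtained by lifting the vertices of $K$. For a direction $0\neq s\in\mathbb R^{d+1}$, the lifted oracle returns the augmented persistence diagrams (APDs), over a fixed field of coefficients, of the lower-star filtration of $\hat K$ in direction $s$, in time $\Pi$ per query: for an index filtration $\sigma_1,\dots,\sigma_n$ of $\hat K$ compatible with the height $h_s(\tau)=\max_{x\in\tau}s\cdot x$, where $x$ ranges over the vertices of $\tau$, the $i$-dimensional APD consists of the points $(h_s(\sigma_a),h_s(\sigma_b))$, where $(a,b)$ runs through the $i$-dimensional persistence diagram of the index filtration (and $h_s(\sigma_\infty)=\infty$). Diagrams of different dimensions in the same direction count as one diagram. Let $\sigma$ be a $(d-1)$-simplex of $K$, let $v$ be a vertex of $K$ that is not a vertex of $\sigma$, and let $\Sigma$ be the set of the $d$ vertices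 of $\sigma$ together with $v$. Assume that the lifts of the points of $\Sigma$ are affinely independent and that the hyperplane of $\mathbb R^{d+1}$ that they span contains no other lifted vertex of $K$ (for instance, that every set of at most $d+2$ lifted vertices of $K$ is affinely independent). The *tilt* of $s$ toward $s'$ is $(1-\varepsilon)s+\varepsilon s'$ with $\varepsilon=\tfrac12\,\frac{g}{g+w}$, where $g$ is the smallest difference of distinct heights of lifted vertices in direction $s$ ($g=1$ if there are none) and $w$ is the difference of the largest and the smallest height in direction $s'$. The *lifted simplex predicate* is the following program. It knows the vertices of $K$, the vertices of $\sigma$ and the vertex $v$, and has access to the simplices of $K$ only through the lifted oracle. 1. Compute a direction $s_1=s_2$ orthogonal to the affine hull of the lift of $\Sigma$, and the tilt $s_*$ of $s_1$ toward $s_2$. 2. Compute a direction $s_3$ orthogonal to the affine hull of the lift of $\sigma$ such that $\hat v$ is above the lift of $\sigma$ in direction $s_3$. 3. Let $s_L$ be the tilt of $s_*$ toward $s_3$, and let $s_U$ be the negative of the tilt of $-s_*$ toward $s_3$. 4. Return True if $|I_U-I_L|=1$ and False otherwise, where $I_U$ and $I_L$ are the values that the following recursive procedure $I(\tau,s)$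 returns for the lift of $\sigma$ and the directions $s_U$ and $s_L$. The procedure counts the deaths in the $(d-1)$-dimensional and the births in the $d$-dimensional APD in direction $s$ at the height of $\tau$, and subtracts $I(\rho,s_\rho)$ for every nonempty proper face $\rho$ of $\tau$, in the order of increasing dimension. Here $s_\rho$ is the tilt of $s$ toward a direction that is orthogonal to the affine hull of $\rho$ and in which the other vertices of $\tau$ are above $\rho$. Each of the two top-level calls stores the values of faces in a table, so that the value of each face is computed only once. Directions are computed by exact Gram–Schmidt orthogonalization. Time is counted on a real random access machine, with unit cost for arithmetic operations and comparisons of reals and for elementary operations on integers, indices and memory cells. Then the predicate returns True if and only if $\Sigma$ is the vertex set of a $d$-simplex of $K$. It uses at most $2^{d+1}-2$ augmented persistence diagrams, and its running time is $$O\Big(d\,n_0+2^d\big(n_0\,n_{d-1}+n_0\log n_0+d^2+2^{d-1}+\Pi\big)\Big),$$ with an absolute implied constant. -/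

import Mathlib

open scoped Matrix

/-! ### The parabolic lift of a geometric simplicial complex -/

/-- The lifting map on points: `(x₁, …, x_d) ↦ (x₁, …, x_d, x · x)`. -/
noncomputable def liftPoint {d : ℕ} (x : Fin d → ℝ) : Fin (d + 1) → ℝ :=
  Fin.snoc (α := fun _ => ℝ) x (x ⬝ᵥ x)

/-- Forgetting the last coordinate. -/
noncomputable def dropLast (d : ℕ) : (Fin (d + 1) → ℝ) →ₗ[ℝ] (Fin d → ℝ) :=
  LinearMap.funLeft ℝ ℝ Fin.castSucc

theorem dropLast_liftPoint {d : ℕ} (x : Fin d → ℝ) : dropLast d (liftPoint x) = x := by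
  funext i
  simp [dropLast, liftPoint, LinearMap.funLeft_apply]

theorem liftPoint_injective {d : ℕ} :
    Function.Injective (liftPoint : (Fin d → ℝ) → Fin (d + 1) → ℝ) :=
  Function.LeftInverse.injective dropLast_liftPoint

theorem affineIndependent_lift {d : ℕ} {s : Finset (Fin d → ℝ)}
    (hs : AffineIndependent ℝ ((↑) : s → (Fin d → ℝ))) :
    AffineIndependent ℝ ((↑) : s.image liftPoint → (Fin (d + 1) → ℝ)) := by
  have h1 : AffineIndependent ℝ (fun x : s => liftPoint (x : Fin d → ℝ)) := by
    refine AffineIndependent.of_comp (dropLast d).toAffineMap ?_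
    have h0 : (dropLast d).toAffineMap ∘ (fun x : s => liftPoint (x : Fin d → ℝ))
        = ((↑) : s → (Fin d → ℝ)) := funext fun x => dropLast_liftPoint _
    rw [h0]
    exact hs
  have h2 := h1.range
  have h3 : Set.range (fun x : s => liftPoint (x : Fin d → ℝ))
      = ((s.image liftPoint : Finset _) : Set (Fin (d + 1) → ℝ)) := by
    ext y
    simp
  rw [h3] at h2
  exact h2

theorem dropLast_injOn {d : ℕ} {s : Finset (Fin d → ℝ)}
    (hs : AffineIndependent ℝ ((↑) : s → (Fin d → ℝ))) {x y : Fin (d + 1) → ℝ}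
    (hx : x ∈ convexHull ℝ (liftPoint '' (s : Set (Fin d → ℝ))))
    (hy : y ∈ convexHull ℝ (liftPoint '' (s : Set (Fin d → ℝ))))
    (h : dropLast d x = dropLast d y) : x = y := by
  rw [← Finset.coe_image, Finset.mem_convexHull'] at hx hy
  obtain ⟨a, -, ha1, rfl⟩ := hx
  obtain ⟨b, -, hb1, rfl⟩ := hy
  have hinj : Set.InjOn (liftPoint : (Fin d → ℝ) → _) s := liftPoint_injective.injOn
  rw [Finset.sum_image hinj] at ha1 hb1 ⊢
  rw [Finset.sum_image hinj]
  rw [Finset.sum_image hinj, Finset.sum_image hinj] at h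
  simp only [map_sum, map_smul, dropLast_liftPoint] at h
  have key := (affineIndependent_iff.1 hs) Finset.univ
    (fun i => a (liftPoint i) - b (liftPoint i))
    (by
      rw [Finset.sum_sub_distrib]
      rw [Finset.sum_coe_sort s (fun i => a (liftPoint i)),
        Finset.sum_coe_sort s (fun i => b (liftPoint i)), ha1, hb1, sub_self])
    (by
      simp only [sub_smul]
      rw [Finset.sum_sub_distrib]
      rw [Finset.sum_coe_sort s (fun i => a (liftPoint i) • i),
        Finset.sum_coe_sort s (fun i => b (liftPoint i) • i), h, sub_self])
  refine Finset.sum_congr rfl fun i hi => ?_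
  have := key ⟨i, hi⟩ (Finset.mem_univ _)
  rw [sub_eq_zero.1 this]

/-- The lift of a simplicial complex in `ℝ^d`: vertices are lifted to the paraboloid in
`ℝ^(d+1)` and the higher-dimensional simplices follow. -/
noncomputable def liftComplex {d : ℕ} (K : Geometry.SimplicialComplex ℝ (Fin d → ℝ)) :
    Geometry.SimplicialComplex ℝ (Fin (d + 1) → ℝ) where
  faces := (fun s => s.image liftPoint) '' K.faces
  isRelLowerSet_faces := by
    rintro _ ⟨s, hs, rfl⟩
    refine ⟨(K.nonempty_of_mem_faces hs).image _, fun t hts ht => ?_⟩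
    obtain ⟨u, hu, rfl⟩ := Finset.subset_image_iff.1 hts
    exact ⟨u, K.down_closed hs (by simpa using hu) (Finset.image_nonempty.1 ht), rfl⟩
  indep := by
    rintro _ ⟨s, hs, rfl⟩
    exact affineIndependent_lift (K.indep hs)
  inter_subset_convexHull := by
    rintro _ _ ⟨s, hs, rfl⟩ ⟨t, ht, rfl⟩ x ⟨hxs, hxt⟩
    simp only [Finset.coe_image] at hxs hxt ⊢
    have hproj : ∀ u : Set (Fin d → ℝ), (dropLast d) '' (convexHull ℝ (liftPoint '' u))
        = convexHull ℝ u := by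
      intro u
      rw [LinearMap.image_convexHull, Set.image_image]
      simp [dropLast_liftPoint]
    have h1 : dropLast d x ∈ convexHull ℝ ((s : Set (Fin d → ℝ)) ∩ t) :=
      K.inter_subset_convexHull hs ht
        ⟨hproj s ▸ Set.mem_image_of_mem _ hxs, hproj t ▸ Set.mem_image_of_mem _ hxt⟩
    rw [← hproj] at h1
    obtain ⟨y, hy, hyx⟩ := h1
    have hys : y ∈ convexHull ℝ (liftPoint '' (s : Set (Fin d → ℝ))) :=
      convexHull_mono (Set.image_mono Set.inter_subset_left) hy
    have : y = x := dropLast_injOn (K.indep hs) hys hxs hyx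
    subst this
    rwa [← Set.image_inter liftPoint_injective]

/-! ### Simplicial homology and augmented persistence diagrams

A simplex is represented by its vertex set. Homology is the (unreduced) simplicial homology with
coefficients in a field `𝔽`, with vertices ordered by a fixed well-order. -/

/-- Elements of `Z` modulo the elements of `B` (that lie in `Z`). -/
abbrev Subquotient {R M : Type*} [Ring R] [AddCommGroup M] [Module R M] (Z B : Submodule R M) :
    Type _ :=
  Z ⧸ B.comap Z.subtype

/-- The map of subquotients induced by inclusions. -/
noncomputable def subquotientMap {R M : Type*} [Ring R] [AddCommGroup M] [Module R M]
    {Z B Z' B' : Submodule R M} (hZ : Z ≤ Z') (hB : B ≤ B') :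
    Subquotient Z B →ₗ[R] Subquotient Z' B' :=
  Submodule.mapQ _ _ (Submodule.inclusion hZ) fun _ hx => hB hx

section Persistence

variable (𝔽 : Type*) [Field 𝔽] {E : Type*}

open Classical in
/-- The sign with which the facet of `s` opposite to `x` enters the boundary of `s`. -/
noncomputable def facetSign (s : Finset E) (x : E) : 𝔽 :=
  (-1) ^ (s.filter (fun y => WellOrderingRel y x)).card

open Classical in
/-- The simplicial boundary operator; vertices have boundary zero. -/
noncomputable def boundary : (Finset E →₀ 𝔽) →ₗ[𝔽] (Finset E →₀ 𝔽) :=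
  Finsupp.linearCombination 𝔽 fun s =>
    if 2 ≤ s.card then ∑ x ∈ s, Finsupp.single (s.erase x) (facetSign 𝔽 s x) else 0

/-- The `k`-chains of a collection `F` of simplices. -/
noncomputable def chains (F : Set (Finset E)) (k : ℕ) : Submodule 𝔽 (Finset E →₀ 𝔽) :=
  Finsupp.supported 𝔽 𝔽 {s | s ∈ F ∧ s.card = k + 1}

noncomputable def cycles (F : Set (Finset E)) (k : ℕ) : Submodule 𝔽 (Finset E →₀ 𝔽) :=
  chains 𝔽 F k ⊓ LinearMap.ker (boundary 𝔽)

noncomputable def boundaries (F : Set (Finset E)) (k : ℕ) : Submodule 𝔽 (Finset E →₀ 𝔽) :=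
  (chains 𝔽 F (k + 1)).map (boundary 𝔽)

/-- `H_k(F)`, cycles modulo boundaries. -/
abbrev Homology (F : Set (Finset E)) (k : ℕ) : Type _ :=
  Subquotient (cycles 𝔽 F k) (boundaries 𝔽 F k)

theorem chains_mono {F G : Set (Finset E)} (h : F ⊆ G) (k : ℕ) : chains 𝔽 F k ≤ chains 𝔽 G k :=
  Finsupp.supported_mono fun _ hs => ⟨h hs.1, hs.2⟩

theorem cycles_mono {F G : Set (Finset E)} (h : F ⊆ G) (k : ℕ) : cycles 𝔽 F k ≤ cycles 𝔽 G k :=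
  inf_le_inf_right _ (chains_mono 𝔽 h k)

/-- The map `H_k(F) → H_k(G)` induced by an inclusion `F ⊆ G`. -/
noncomputable def homologyMap {F G : Set (Finset E)} (h : F ⊆ G) (k : ℕ) :
    Homology 𝔽 F k →ₗ[𝔽] Homology 𝔽 G k :=
  subquotientMap (cycles_mono 𝔽 h k) (Submodule.map_mono (chains_mono 𝔽 h (k + 1)))

/-- The complex formed by the first `i` simplices of the list `L`. -/
def prefixComplex (L : List (Finset E)) (i : ℕ) : Set (Finset E) := {s | s ∈ L.take i}

theorem prefixComplex_mono (L : List (Finset E)) {i j : ℕ} (h : i ≤ j) :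
    prefixComplex L i ⊆ prefixComplex L j :=
  fun _ hs => (List.take_sublist_take_left h).subset hs

/-- The persistent Betti number `β_k^{i,j}` (for `i ≤ j`): the rank of `H_k(F_i) → H_k(F_j)`,
where `F_i` consists of the first `i` simplices. -/
noncomputable def persistentBetti (L : List (Finset E)) (k i j : ℕ) : ℕ :=
  if h : i ≤ j then
    Module.finrank 𝔽 (LinearMap.range (homologyMap 𝔽 (prefixComplex_mono L h) k))
  else 0

/-- The multiplicity `μ_k^{(i,j)} = β_k^{i,j-1} - β_k^{i,j} - β_k^{i-1,j-1} + β_k^{i-1,j}` of the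
point `(i, j)`, `1 ≤ i < j`. -/
noncomputable def pairMult (L : List (Finset E)) (k i j : ℕ) : ℕ :=
  ((persistentBetti 𝔽 L k i (j - 1) : ℤ) - persistentBetti 𝔽 L k i j
    - persistentBetti 𝔽 L k (i - 1) (j - 1) + persistentBetti 𝔽 L k (i - 1) j).toNat

/-- The multiplicity `μ_k^{(i,∞)} = β_k^{i,n} - β_k^{i-1,n}` of the point `(i, ∞)`, `1 ≤ i`. -/
noncomputable def essentialMult (L : List (Finset E)) (k i : ℕ) : ℕ :=
  ((persistentBetti 𝔽 L k i L.length : ℤ) - persistentBetti 𝔽 L k (i - 1) L.length).toNat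

/-- A diagram point `(birth, death)`; the death may be infinite. -/
abbrev DiagramPoint : Type := ℝ × WithTop ℝ

/-- The `k`-dimensional augmented persistence diagram computed from the index filtration that adds
the simplices in the order of the list `L`: each point `(i, j)` of the persistence diagram of the
index filtration contributes `(f σ_i, f σ_j)`. (Here `σ_{i+1}` is `L.get i`.) -/
noncomputable def indexAPD (L : List (Finset E)) (f : Finset E → ℝ) (k : ℕ) :
    Multiset DiagramPoint :=
  (∑ i : Fin L.length, ∑ j : Fin L.length,
    if i < j then
      Multiset.replicate (pairMult 𝔽 L k (i + 1) (j + 1)) (f (L.get i), (f (L.get j) : WithTop ℝ))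
    else 0)
  + ∑ i : Fin L.length,
      Multiset.replicate (essentialMult 𝔽 L k (i + 1)) (f (L.get i), (⊤ : WithTop ℝ))

/-- The list `L` enumerates the simplices of the complex `F` in the order of an index filtration
compatible with `f`: faces come before cofaces, and `f` is non-decreasing along `L`. -/
structure IsCompatibleOrder (F : Set (Finset E)) (f : Finset E → ℝ) (L : List (Finset E)) :
    Prop where
  nodup : L.Nodup
  mem_iff : ∀ s, s ∈ L ↔ s ∈ F
  faces_first : L.Pairwise fun s t => ¬ t ⊂ s
  monotone : L.Pairwise fun s t => f s ≤ f t

/-- `Δ k`, `k = 0, 1, …`, are the `k`-dimensional augmented persistence diagrams of the filter `f`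
on `F`. (They do not depend on the choice of the compatible index filtration.) -/
def IsAPD (F : Set (Finset E)) (f : Finset E → ℝ) (Δ : ℕ → Multiset DiagramPoint) : Prop :=
  ∃ L : List (Finset E), IsCompatibleOrder F f L ∧ ∀ k, Δ k = indexAPD 𝔽 L f k

end Persistence

/-- The lower-star filter in direction `s`: the height of the highest vertex of a simplex. -/
noncomputable def starHeight {D : ℕ} (s : Fin D → ℝ) (σ : Finset (Fin D → ℝ)) : ℝ :=
  if h : σ.Nonempty then σ.sup' h (fun x => s ⬝ᵥ x) else 0

/-- An oracle takes a direction in `ℝ^D` and a dimension, and returns a finite list of points. -/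
abbrev Oracle (D : ℕ) : Type := (Fin D → ℝ) → ℕ → List DiagramPoint

/-- `O` is a lifted oracle for `K`: for every (nonzero) direction `s ∈ ℝ^(d+1)` and every dimension
`i`, it lists, in some order, the points of the `i`-dimensional augmented persistence diagram of
the lower-star filtration of the lift of `K` in direction `s`. -/
def IsLiftedOracle (𝔽 : Type*) [Field 𝔽] {d : ℕ} (K : Geometry.SimplicialComplex ℝ (Fin d → ℝ))
    (O : Oracle (d + 1)) : Prop :=
  ∀ s : Fin (d + 1) → ℝ, s ≠ 0 →
    IsAPD 𝔽 (liftComplex K).faces (starHeight s) fun i => (O s i : Multiset DiagramPoint)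

/-! ### Programs of a real random access machine with a diagram oracle -/

inductive ArithOp : Type
  | add | sub | mul | div

noncomputable def ArithOp.eval : ArithOp → ℝ → ℝ → ℝ
  | .add, x, y => x + y
  | .sub, x, y => x - y
  | .mul, x, y => x * y
  | .div, x, y => x / y

/-- Programs with results in `α`. The instructions are: an arithmetic operation on two reals, a
comparison of two reals, an oracle query, and `step`, which accounts for one elementary operation
on integers, indices, pointers or memory cells. -/
inductive Prog (D : ℕ) (α : Type) : Type
  | ret (a : α)
  | step (p : Prog D α)
  | arith (o : ArithOp) (x y : ℝ) (k : ℝ → Prog D α)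
  | comp (x y : ℝ) (k : Ordering → Prog D α)
  | query (s : Fin D → ℝ) (i : ℕ) (k : List DiagramPoint → Prog D α)

namespace Prog

variable {D : ℕ} {α β : Type}

/-- Sequential composition. -/
def bind : Prog D α → (α → Prog D β) → Prog D β
  | ret a, f => f a
  | step p, f => step (bind p f)
  | arith o x y k, f => arith o x y fun z => bind (k z) f
  | comp x y k, f => comp x y fun z => bind (k z) f
  | query s i k, f => query s i fun z => bind (k z) f

instance : Monad (Prog D) where
  pure := ret
  bind := bind

/-- The result of running a program with the oracle `O`. -/
noncomputable def result (O : Oracle D) : Prog D α → α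
  | ret a => a
  | step p => result O p
  | arith o x y k => result O (k (o.eval x y))
  | comp x y k => result O (k (cmp x y))
  | query s i k => result O (k (O s i))

/-- The running time with the oracle `O` if each query takes time `Q`: all other instructions take
unit time. -/
noncomputable def time (O : Oracle D) (Q : ℕ) : Prog D α → ℕ
  | ret _ => 0
  | step p => time O Q p + 1
  | arith o x y k => time O Q (k (o.eval x y)) + 1
  | comp x y k => time O Q (k (cmp x y)) + 1
  | query s i k => time O Q (k (O s i)) + (Q + 1)

/-- The set of directions that are queried. -/
noncomputable def directions (O : Oracle D) : Prog D α → Set (Fin D → ℝ)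
  | ret _ => ∅
  | step p => directions O p
  | arith o x y k => directions O (k (o.eval x y))
  | comp x y k => directions O (k (cmp x y))
  | query s i k => insert s (directions O (k (O s i)))

/-- The number of diagrams used. All dimensions of the diagram in one direction together count as
one diagram. -/
noncomputable def diagrams (O : Oracle D) (p : Prog D α) : ℕ := (p.directions O).ncard

/-! #### Basic operations -/

def add (x y : ℝ) : Prog D ℝ := arith .add x y ret
def sub (x y : ℝ) : Prog D ℝ := arith .sub x y ret
def mul (x y : ℝ) : Prog D ℝ := arith .mul x y ret
def div (x y : ℝ) : Prog D ℝ := arith .div x y ret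
def compare (x y : ℝ) : Prog D Ordering := comp x y ret
def ask (s : Fin D → ℝ) (i : ℕ) : Prog D (List DiagramPoint) := query s i ret

/-- `n` elementary steps. -/
def steps : ℕ → Prog D Unit
  | 0 => ret ()
  | n + 1 => step (steps n)

/-- Fill an array of length `n`. -/
def array : (n : ℕ) → (Fin n → Prog D α) → Prog D (Fin n → α)
  | 0, _ => ret Fin.elim0
  | n + 1, f => do
      steps 1
      let x ← f 0
      let xs ← array n (fun i => f i.succ)
      return Fin.cons (α := fun _ => α) x xs

/-- Sum the values of `n` computations. -/
def total : (n : ℕ) → (Fin n → Prog D ℝ) → Prog D ℝ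
  | 0, _ => ret 0
  | n + 1, f => do
      steps 1
      let x ← f 0
      let y ← total n (fun i => f i.succ)
      add x y

/-- A loop over a list that collects results. -/
def mapList (f : α → Prog D β) : List α → Prog D (List β)
  | [] => ret []
  | a :: l => do
      steps 1
      let b ← f a
      let bs ← mapList f l
      return b :: bs

/-- A loop over a list that updates a state. -/
def foldList (f : β → α → Prog D β) : β → List α → Prog D β
  | b, [] => ret b
  | b, a :: l => do
      steps 1
      let b' ← f b a
      foldList f b' l

def dot {n : ℕ} (x y : Fin n → ℝ) : Prog D ℝ := total n fun i => mul (x i) (y i)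
def vsub {n : ℕ} (x y : Fin n → ℝ) : Prog D (Fin n → ℝ) := array n fun i => sub (x i) (y i)
def vadd {n : ℕ} (x y : Fin n → ℝ) : Prog D (Fin n → ℝ) := array n fun i => add (x i) (y i)
def vneg {n : ℕ} (x : Fin n → ℝ) : Prog D (Fin n → ℝ) := array n fun i => sub 0 (x i)

/-- `a x + b y`. -/
def vcomb {n : ℕ} (a : ℝ) (x : Fin n → ℝ) (b : ℝ) (y : Fin n → ℝ) : Prog D (Fin n → ℝ) :=
  array n fun i => do
    let p ← mul a (x i)
    let q ← mul b (y i)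
    add p q

/-- Compute the lift of a point. -/
def lift {n : ℕ} (x : Fin n → ℝ) : Prog D (Fin (n + 1) → ℝ) := do
  let q ← dot x x
  steps (n + 1)
  return Fin.snoc (α := fun _ => ℝ) x q

/-! #### Orthogonalization -/

/-- Subtract from `x` its projections to the vectors of the orthogonal list `B`. -/
def reject {n : ℕ} (B : List (Fin n → ℝ)) (x : Fin n → ℝ) : Prog D (Fin n → ℝ) :=
  foldList (fun y b => do
    let p ← dot y b
    let q ← dot b b
    let t ← div p q
    array n fun i => do
      let z ← mul t (b i)
      sub (y i) z) x B

/-- Gram–Schmidt orthogonalization, without normalization. -/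
def gramSchmidt {n : ℕ} (L : List (Fin n → ℝ)) : Prog D (List (Fin n → ℝ)) :=
  foldList (fun B x => do
    let r ← reject B x
    return B ++ [r]) [] L

/-- Search the given standard basis vectors for one outside the span of the orthogonal list `B`,
and return its component orthogonal to that span. -/
def orthogonalTo {n : ℕ} (B : List (Fin n → ℝ)) : List (Fin n) → Prog D (Fin n → ℝ)
  | [] => ret 0
  | i :: is => do
      steps n
      let r ← reject B (Pi.single i 1)
      let q ← dot r r
      match ← compare 0 q with
      | .lt => return r
      | _ => orthogonalTo B is

/-- A direction orthogonal to the affine hull of the points `P i` and the point `v`. -/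
def normalDirection {m n : ℕ} (P : Fin m → Fin n → ℝ) (v : Fin n → ℝ) :
    Prog D (Fin n → ℝ) := do
  let L ← mapList (fun i => vsub (P i) v) (List.finRange m)
  let B ← gramSchmidt L
  orthogonalTo B (List.finRange n)

/-- For affinely independent points `P i`, `i ∈ U`, and a nonempty `W ⊆ U`: a direction orthogonal
to the affine hull of the points with index in `W`, and such that the points with index in `U \ W`
are above them. With a base point `P i₀`, `i₀ ∈ W`, it is the sum over `j ∈ U \ W` of the component
of `P j - P i₀` orthogonal to the vectors `P i - P i₀`, `i ∈ U`, `i ≠ i₀, j`. -/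
noncomputable def secondDirection {m n : ℕ} (P : Fin m → Fin n → ℝ) (U W : Finset (Fin m)) :
    Prog D (Fin n → ℝ) := do
  steps (m + n)
  match W.toList with
  | [] => return 0
  | i₀ :: _ =>
      foldList (fun s j => do
        steps m
        let L ← mapList (fun i => vsub (P i) (P i₀)) ((U.erase i₀).erase j).toList
        let B ← gramSchmidt L
        let x ← vsub (P j) (P i₀)
        let r ← reject B x
        vadd s r) 0 (U \ W).toList

/-! #### Sorting and tilting -/

/-- Merge two sorted lists. -/
def merge : List ℝ → List ℝ → Prog D (List ℝ)
  | [], ys => do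
      steps 1
      return ys
  | x :: xs, [] => do
      steps 1
      return x :: xs
  | x :: xs, y :: ys => do
      steps 1
      match ← compare x y with
      | .gt => do
          let l ← merge (x :: xs) ys
          return y :: l
      | _ => do
          let l ← merge xs (y :: ys)
          return x :: l
termination_by xs ys => xs.length + ys.length

/-- Merge sort with recursion depth at most the first argument. -/
def mergeSortAux : ℕ → List ℝ → Prog D (List ℝ)
  | 0, l => ret l
  | depth + 1, l => do
      steps (l.length + 1)
      if l.length ≤ 1 then return l
      else do
        let a ← mergeSortAux depth (l.take (l.length / 2))
        let b ← mergeSortAux depth (l.drop (l.length / 2))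
        merge a b

def sort (l : List ℝ) : Prog D (List ℝ) := mergeSortAux l.length l

/-- The smallest positive difference of two consecutive entries of a list, if there is one. -/
def minGap : List ℝ → Prog D (Option ℝ)
  | [] => ret none
  | [_] => ret none
  | x :: y :: l => do
      steps 1
      let r ← minGap (y :: l)
      let δ ← sub y x
      match ← compare 0 δ with
      | .lt =>
          match r with
          | none => return some δ
          | some g => do
              match ← compare δ g with
              | .lt => return some δ
              | _ => return some g
      | _ => return r

def maxList : List ℝ → Prog D ℝ
  | [] => ret 0
  | x :: l => foldList (fun m y => do
      match ← compare m y with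
      | .lt => return y
      | _ => return m) x l

def minList : List ℝ → Prog D ℝ
  | [] => ret 0
  | x :: l => foldList (fun m y => do
      match ← compare m y with
      | .gt => return y
      | _ => return m) x l

/-- The list of heights of the points of `V` in direction `s`. -/
def heights {n : ℕ} (V : List (Fin n → ℝ)) (s : Fin n → ℝ) : Prog D (List ℝ) :=
  mapList (fun x => dot s x) V

/-- The tilt `(1 - ε) s + ε s'` of `s` toward `s'`, where `H` and `H'` list the heights of the
vertices in these directions. Let `g` be the smallest difference of distinct heights in `H` and let
`M`, `m` be the largest and smallest height in `H'`. The segments from `(0, h + g)` to `(1, m)` and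
from `(0, h)` to `(1, M)` cross at first coordinate `g / (g + (M - m))`, and `ε` is half of that.
(If all heights in `H` are equal, nothing has to be preserved and `g = 1` is taken.) -/
noncomputable def tilt {n : ℕ} (s s' : Fin n → ℝ) (H H' : List ℝ) : Prog D (Fin n → ℝ) := do
  let H₁ ← sort H
  let gap ← minGap H₁
  let g := gap.getD 1
  let M ← maxList H'
  let m ← minList H'
  let w ← sub M m
  let q ← add g w
  let p ← div g q
  let ε ← div p 2
  let a ← sub 1 ε
  vcomb a s ε s'

/-! #### The `k`-indegree and the simplex predicate -/

def countBirths (c : ℝ) (Δ : List DiagramPoint) : Prog D ℤ :=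
  foldList (fun n p => do
    match ← compare p.1 c with
    | .eq => return n + 1
    | _ => return n) 0 Δ

def countDeaths (c : ℝ) (Δ : List DiagramPoint) : Prog D ℤ :=
  foldList (fun n p =>
    match p.2 with
    | none => return n
    | some b => do
        match ← compare b c with
        | .eq => return n + 1
        | _ => return n) 0 Δ

/-- The height in direction `s` of the first point with index in `U`. -/
noncomputable def heightOf {m n : ℕ} (P : Fin m → Fin n → ℝ) (U : Finset (Fin m))
    (s : Fin n → ℝ) : Prog D ℝ := do
  steps m
  match U.toList with
  | [] => return 0
  | i :: _ => dot s (P i)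

/-- The nonempty proper subsets of `U`, in the order of increasing cardinality. -/
noncomputable def properFaces {m : ℕ} (U : Finset (Fin m)) : List (Finset (Fin m)) :=
  (List.range' 1 (U.card - 1)).flatMap fun j => (U.powersetCard j).toList

/-- A table with an entry, possibly not computed yet, for every subset of `Fin m`. -/
abbrev Table (m : ℕ) : Type := Finset (Fin m) → Option ℤ

/-- The `k`-indegree, in direction `s`, of the simplex with vertices `P i`, `i ∈ U`, where `V` lists
all vertices of the complex. The program returns the indegree and the updated table. The first
argument bounds the recursion depth. In the loop over the proper faces `W`, which are represented
by their characteristic vectors, it takes `m + 1` steps to produce the next face. -/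
noncomputable def indegree {m : ℕ} (V : List (Fin D → ℝ)) (P : Fin m → Fin D → ℝ) (k : ℕ) :
    ℕ → Finset (Fin m) → (Fin D → ℝ) → Table m → Prog D (ℤ × Table m)
  | 0, _, _, T => ret (0, T)
  | depth + 1, U, s, T => do
      let low ← ask s (k - 1)
      let high ← ask s k
      let c ← heightOf P U s
      let numDeaths ← countDeaths c low
      let numBirths ← countBirths c high
      let (doubleCounts, T) ← foldList (fun (acc : ℤ × Table m) W => do
        steps (m + 1)
        match acc.2 W with
        | some t => return (acc.1 + t, acc.2)
        | none => do
            let s' ← secondDirection P U W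
            let H ← heights V s
            let H' ← heights V s'
            let s_t ← tilt s s' H H'
            let (t, T') ← indegree V P k depth W s_t acc.2
            steps 1
            return (acc.1 + t, Function.update T' W (some t))) (0, T) (properFaces U)
      steps 2
      return (numDeaths + numBirths - doubleCounts, T)

/-- The simplex predicate for the `(k-1)`-simplex with vertices `P i`, `i ∈ Fin k`, and the vertex
`v` of a complex in `ℝ^D` with vertex list `V`, where `D = k + 1`.
As the points `P i` and `v` span a hyperplane of `ℝ^D`, the direction `s₂` orthogonal to their affine
hull for which no other vertex is at the same height as these points can be taken to be `s₁`. -/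
noncomputable def isSimplex {k : ℕ} (V : List (Fin D → ℝ)) (P : Fin k → Fin D → ℝ)
    (v : Fin D → ℝ) : Prog D Bool := do
  let s₁ ← normalDirection P v
  let s₂ := s₁
  let H₁ ← heights V s₁
  let H₂ ← heights V s₂
  let sStar ← tilt s₁ s₂ H₁ H₂
  steps (k + 1)
  let s₃ ← secondDirection (Fin.snoc (α := fun _ => Fin D → ℝ) P v) Finset.univ
    (Finset.univ.erase (Fin.last k))
  let HStar ← heights V sStar
  let H₃ ← heights V s₃
  let sL ← tilt sStar s₃ HStar H₃
  let negStar ← vneg sStar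
  let HNeg ← heights V negStar
  let u ← tilt negStar s₃ HNeg H₃
  let sU ← vneg u
  steps (2 ^ k)
  let (indegU, _) ← indegree V P k k Finset.univ sU (fun _ => none)
  steps (2 ^ k)
  let (indegL, _) ← indegree V P k k Finset.univ sL (fun _ => none)
  steps 3
  return decide (|indegU - indegL| = 1)

/-- The lifted simplex predicate for the `(d-1)`-simplex with vertices `P i`, `i ∈ Fin d`, and the
vertex `v` of a complex in `ℝ^d` with vertex list `V`: the simplex predicate is run on the lifted
vertices. (All queries of the resulting program are queries in directions of `ℝ^(d+1)`.) -/
noncomputable def isLiftedSimplex {d : ℕ} (V : List (Fin d → ℝ)) (P : Fin d → Fin d → ℝ)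
    (v : Fin d → ℝ) : Prog (d + 1) Bool := do
  let V' ← mapList lift V
  let P' ← array d fun i => lift (P i)
  let v' ← lift v
  isSimplex V' P' v'

end Prog

/-! ### Ranks of subquotients, chains and cycles. -/

section PersistenceRanks

variable {𝔽 : Type*} [Field 𝔽] {E : Type*}

/-! Homology enters only through a count. By rank-nullity for the boundary operator, a simplex of
dimension k+1 that is added to a filtration either creates one class in dimension k+1 or destroys
one in dimension k. The persistent Betti number β(i,j) is dim Z_i − dim (Z_i ∩ B_j), and the sum of
the multiplicities of all points with a given birth or a given death telescopes. Hence the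
k-dimensional deaths and the (k+1)-dimensional births at height c together number the
(k+1)-simplices whose highest vertex has height c, whichever index filtration produced the diagram
(`IsAPD.countP_death_add_birth`).

Let the points P i all have height c in direction s, and let no other vertex have this height. For a
set W of indices, let M(W) be the number of d-simplices that contain exactly the P i with i in W and
whose other vertices lie below c (`traceCount`). Tilt s so that the points of W stay level and drop
below the remaining P i, while every other vertex stays on its side. The d-simplices at the height
of W are then those counted by M(W') for the nonempty W' ⊆ W (`IsLevel.ncard_starHeight_eq`), so
subtracting M over the proper faces leaves M(W). As M refers to s and c and not to the tilt, a table
entry is valid for every caller. Faces are processed by increasing cardinality, so a nested call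
finds all its proper faces in the table; a top-level call thus queries at most one direction per
nonempty face, at most 2^d − 1 in all (`Prog.spec_indegree`).

For the full index set, M counts the cofacets of σ whose extra vertex is below σ. No further lifted
vertex lies on the hyperplane spanned by the lift of Σ. The directions s_U and s_L perturb its
normal so that v is below, respectively above, the lift of σ, and no other vertex changes sides. The
two counts differ by one if Σ spans a simplex and agree otherwise (`traceCount_eq_add`).

Running times are bounded by composing specifications `Prog.Spec`. Scanning a diagram costs no more
than a simplex count, and a d-simplex is determined by a facet and a vertex. The table lookups of a
top-level call add up to at most 3^d. The terms d^4 and d·n₀ inside the factor 2^d, and the term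
d·3^d, are finally absorbed into the terms of the stated bound. -/

theorem finrank_range_subquotientMap {M : Type*} [AddCommGroup M] [Module 𝔽 M]
    {Z B Z' B' : Submodule 𝔽 M} (hZ : Z ≤ Z') (hB : B ≤ B') [FiniteDimensional 𝔽 Z] :
    Module.finrank 𝔽 (LinearMap.range (subquotientMap hZ hB))
      + Module.finrank 𝔽 (Z ⊓ B' : Submodule 𝔽 M) = Module.finrank 𝔽 Z := by
  have h := LinearMap.finrank_range_add_finrank_ker
    ((B'.comap Z'.subtype).mkQ.comp (Submodule.inclusion hZ))
  have hr : LinearMap.range ((B'.comap Z'.subtype).mkQ.comp (Submodule.inclusion hZ))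
      = LinearMap.range (subquotientMap hZ hB) := by
    rw [subquotientMap, Submodule.range_mapQ, LinearMap.range_comp]
  -- The induced map and this composite have the same range, but the composite starts from Z itself,
  -- so rank-nullity applies and its kernel is Z ∩ B'.
  have hk : LinearMap.ker ((B'.comap Z'.subtype).mkQ.comp (Submodule.inclusion hZ))
      = B'.comap Z.subtype := by
    rw [LinearMap.ker_comp, Submodule.ker_mkQ]
    rfl
  rw [hr, hk, ← Submodule.finrank_map_subtype_eq, Submodule.map_comap_subtype] at h
  exact h

theorem finrank_map_add_finrank_inf_ker {M N : Type*} [AddCommGroup M] [Module 𝔽 M]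
    [AddCommGroup N] [Module 𝔽 N] (f : M →ₗ[𝔽] N) (C : Submodule 𝔽 M) [FiniteDimensional 𝔽 C] :
    Module.finrank 𝔽 (C.map f) + Module.finrank 𝔽 (C ⊓ LinearMap.ker f : Submodule 𝔽 M)
      = Module.finrank 𝔽 C := by
  have h := LinearMap.finrank_range_add_finrank_ker (f.domRestrict C)
  rw [LinearMap.range_domRestrict, LinearMap.ker_domRestrict,
    ← Submodule.finrank_map_subtype_eq, Submodule.map_comap_subtype] at h
  exact h

theorem finiteDimensional_chains {F : Set (Finset E)} (hF : F.Finite) (k : ℕ) :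
    FiniteDimensional 𝔽 (chains 𝔽 F k) := by
  have : Finite {s | s ∈ F ∧ s.card = k + 1} := (hF.subset fun s hs => hs.1).to_subtype
  exact Module.Finite.equiv (Finsupp.supportedEquivFinsupp _).symm

theorem finrank_chains {F : Set (Finset E)} (hF : F.Finite) (k : ℕ) :
    Module.finrank 𝔽 (chains 𝔽 F k) = {s ∈ F | s.card = k + 1}.ncard := by
  have : Finite {s | s ∈ F ∧ s.card = k + 1} := (hF.subset fun s hs => hs.1).to_subtype
  have := Fintype.ofFinite {s | s ∈ F ∧ s.card = k + 1}
  rw [chains, (Finsupp.supportedEquivFinsupp _).finrank_eq, Module.finrank_finsupp_self,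
    ← Nat.card_eq_fintype_card]
  rfl

theorem chains_insert_of_card_ne {F : Set (Finset E)} {σ : Finset E} {k : ℕ}
    (h : σ.card ≠ k + 1) : chains 𝔽 (insert σ F) k = chains 𝔽 F k := by
  unfold chains
  congr 1
  ext s
  simp only [Set.mem_insert_iff, Set.mem_ofPred_eq]
  constructor
  · rintro ⟨rfl | hs, hc⟩
    · exact absurd hc h
    · exact ⟨hs, hc⟩
  · exact fun hs => ⟨Or.inr hs.1, hs.2⟩

theorem cycles_insert_of_card_ne {F : Set (Finset E)} {σ : Finset E} {k : ℕ}
    (h : σ.card ≠ k + 1) : cycles 𝔽 (insert σ F) k = cycles 𝔽 F k := by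
  rw [cycles, chains_insert_of_card_ne h, cycles]

theorem boundaries_insert_of_card_ne {F : Set (Finset E)} {σ : Finset E} {k : ℕ}
    (h : σ.card ≠ k + 2) : boundaries 𝔽 (insert σ F) k = boundaries 𝔽 F k := by
  rw [boundaries, chains_insert_of_card_ne h, boundaries]

theorem finrank_chains_insert {F : Set (Finset E)} (hF : F.Finite) {σ : Finset E} (hσ : σ ∉ F)
    {k : ℕ} (h : σ.card = k + 1) :
    Module.finrank 𝔽 (chains 𝔽 (insert σ F) k) = Module.finrank 𝔽 (chains 𝔽 F k) + 1 := by
  rw [finrank_chains hF, finrank_chains (hF.insert σ)]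
  have : {s ∈ insert σ F | s.card = k + 1} = insert σ {s ∈ F | s.card = k + 1} := by
    ext s
    simp only [Set.mem_insert_iff, Set.mem_ofPred_eq]
    constructor
    · rintro ⟨rfl | hs, hc⟩
      · exact Or.inl rfl
      · exact Or.inr ⟨hs, hc⟩
    · rintro (rfl | hs)
      · exact ⟨Or.inl rfl, h⟩
      · exact ⟨Or.inr hs.1, hs.2⟩
  rw [this, Set.ncard_insert_of_notMem (fun h => hσ h.1) (hF.subset fun s hs => hs.1)]

/-! ### The boundary operator squares to zero. -/

open Classical in
theorem boundary_single (s : Finset E) (hs : 2 ≤ s.card) :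
    boundary 𝔽 (Finsupp.single s 1)
      = ∑ x ∈ s, Finsupp.single (s.erase x) (facetSign 𝔽 s x) := by
  simp [boundary, hs]

theorem boundary_single_of_card_lt (s : Finset E) (hs : s.card < 2) (a : 𝔽) :
    boundary 𝔽 (Finsupp.single s a) = 0 := by
  simp [boundary, Nat.not_le.2 hs]

-- Erasing the earlier vertex x moves y one place forward, whereas erasing y does not change the
-- place of x. The two orders of removal therefore carry opposite signs.
open Classical in
theorem facetSign_mul_add_of_rel {s : Finset E} {x y : E} (hx : x ∈ s)
    (hxy : WellOrderingRel x y) :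
    facetSign 𝔽 s x * facetSign 𝔽 (s.erase x) y
      + facetSign 𝔽 s y * facetSign 𝔽 (s.erase y) x = 0 := by
  have h1 : (s.erase y).filter (fun z => WellOrderingRel z x)
      = s.filter (fun z => WellOrderingRel z x) := by
    rw [Finset.filter_erase, Finset.erase_eq_of_notMem]
    intro h
    exact asymm_of WellOrderingRel (Finset.mem_filter.1 h).2 hxy
  have h2 : (s.filter (fun z => WellOrderingRel z y)).card
      = ((s.erase x).filter (fun z => WellOrderingRel z y)).card + 1 := by
    rw [Finset.filter_erase]
    exact (Finset.card_erase_add_one (Finset.mem_filter.2 ⟨hx, hxy⟩)).symm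
  unfold facetSign
  rw [h1, h2, pow_succ]
  ring

open Classical in
theorem facetSign_mul_add {s : Finset E} {x y : E} (hx : x ∈ s) (hy : y ∈ s) (hxy : x ≠ y) :
    facetSign 𝔽 s x * facetSign 𝔽 (s.erase x) y
      + facetSign 𝔽 s y * facetSign 𝔽 (s.erase y) x = 0 := by
  rcases trichotomous_of WellOrderingRel x y with h | h | h
  · exact facetSign_mul_add_of_rel hx h
  · exact absurd h hxy
  · rw [add_comm]
    exact facetSign_mul_add_of_rel hy h

open Classical in
theorem boundary_boundary (c : Finset E →₀ 𝔽) : boundary 𝔽 (boundary 𝔽 c) = 0 := by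
  suffices h : (boundary 𝔽).comp (boundary 𝔽) = (0 : (Finset E →₀ 𝔽) →ₗ[𝔽] _) from
    LinearMap.congr_fun h c
  refine Finsupp.lhom_ext' fun s => LinearMap.ext_ring ?_
  simp only [LinearMap.comp_apply, Finsupp.lsingle_apply, LinearMap.zero_apply]
  rcases Nat.lt_or_ge s.card 2 with hs | hs
  · rw [boundary_single_of_card_lt s hs, map_zero]
  rw [boundary_single s hs, map_sum]
  -- Edges are separate: homology is unreduced, so their facets have boundary zero by definition and
  -- not by cancellation.
  rcases hs.eq_or_lt with hs | hs
  · refine Finset.sum_eq_zero fun x hx => boundary_single_of_card_lt _ ?_ _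
    rw [Finset.card_erase_of_mem hx]
    omega
  have key : ∀ x ∈ s, boundary 𝔽 (Finsupp.single (s.erase x) (facetSign 𝔽 s x))
      = ∑ y ∈ s.erase x, Finsupp.single ((s.erase x).erase y)
          (facetSign 𝔽 s x * facetSign 𝔽 (s.erase x) y) := by
    intro x hx
    have h2 : 2 ≤ (s.erase x).card := by
      rw [Finset.card_erase_of_mem hx]
      omega
    rw [← mul_one (facetSign 𝔽 s x), ← smul_eq_mul, ← Finsupp.smul_single, map_smul,
      boundary_single _ h2, Finset.smul_sum]
    simp [Finsupp.smul_single]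
  rw [Finset.sum_congr rfl key, Finset.sum_sigma']
  -- The terms that remove x and y in either order cancel in pairs.
  refine Finset.sum_involution (fun p _ => ⟨p.2, p.1⟩) ?_ ?_ ?_ ?_
  · rintro ⟨x, y⟩ h
    obtain ⟨hx, hy⟩ := Finset.mem_sigma.1 h
    obtain ⟨hyx, hy⟩ := Finset.mem_erase.1 hy
    simp only at hx hy hyx ⊢
    rw [Finset.erase_right_comm (a := y), ← Finsupp.single_add,
      facetSign_mul_add hx hy (Ne.symm hyx), Finsupp.single_zero]
  · rintro ⟨x, y⟩ h - he
    have := (Finset.mem_erase.1 (Finset.mem_sigma.1 h).2).1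
    simp only [Sigma.mk.injEq] at he
    exact this he.1
  · rintro ⟨x, y⟩ h
    obtain ⟨hx, hy⟩ := Finset.mem_sigma.1 h
    obtain ⟨hyx, hy⟩ := Finset.mem_erase.1 hy
    exact Finset.mem_sigma.2 ⟨hy, Finset.mem_erase.2 ⟨Ne.symm hyx, hx⟩⟩
  · rintro ⟨x, y⟩ _
    rfl

open Classical in
/-- Facets of members with at least two vertices are members. -/
def FacetClosed (F : Set (Finset E)) : Prop :=
  ∀ s ∈ F, ∀ x ∈ s, 2 ≤ s.card → s.erase x ∈ F

open Classical in
theorem boundaries_le_chains {F : Set (Finset E)} (hF : FacetClosed F) (k : ℕ) :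
    boundaries 𝔽 F k ≤ chains 𝔽 F k := by
  rw [boundaries, chains, Finsupp.supported_eq_span_single, Submodule.map_span,
    Submodule.span_le]
  rintro _ ⟨_, ⟨s, ⟨hs, hc⟩, rfl⟩, rfl⟩
  change boundary 𝔽 (Finsupp.single s 1) ∈ chains 𝔽 F k
  rw [boundary_single s (by omega)]
  refine Submodule.sum_mem _ fun x hx => Finsupp.single_mem_supported 𝔽 _ ⟨?_, ?_⟩
  · exact hF s hs x hx (by omega)
  · rw [Finset.card_erase_of_mem hx]
    omega

theorem boundaries_le_cycles {F : Set (Finset E)} (hF : FacetClosed F) (k : ℕ) :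
    boundaries 𝔽 F k ≤ cycles 𝔽 F k := by
  refine le_inf (boundaries_le_chains hF k) ?_
  rintro _ ⟨c, -, rfl⟩
  exact boundary_boundary c

/-- Rank-nullity for the boundary operator on the (k+1)-chains. A new (k+1)-simplex raises the right
side by one, hence exactly one of the two terms on the left. -/
theorem finrank_cycles_add {F : Set (Finset E)} (hF : F.Finite) (k : ℕ) :
    Module.finrank 𝔽 (boundaries 𝔽 F k) + Module.finrank 𝔽 (cycles 𝔽 F (k + 1))
      = Module.finrank 𝔽 (chains 𝔽 F (k + 1)) :=
  haveI := finiteDimensional_chains (𝔽 := 𝔽) hF (k + 1)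
  finrank_map_add_finrank_inf_ker _ _

theorem finiteDimensional_cycles {F : Set (Finset E)} (hF : F.Finite) (k : ℕ) :
    FiniteDimensional 𝔽 (cycles 𝔽 F k) :=
  haveI := finiteDimensional_chains (𝔽 := 𝔽) hF k
  Submodule.finiteDimensional_of_le inf_le_left

end PersistenceRanks

/-! ### Persistent Betti numbers of an index filtration. -/

section IndexDiagrams

variable {𝔽 : Type*} [Field 𝔽] {E : Type*}

theorem finite_prefixComplex (L : List (Finset E)) (i : ℕ) : (prefixComplex L i).Finite :=
  List.finite_toSet _

theorem prefixComplex_succ (L : List (Finset E)) {i : ℕ} (hi : i < L.length) :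
    prefixComplex L (i + 1) = insert L[i] (prefixComplex L i) := by
  ext s
  simp only [prefixComplex, List.take_add_one, List.getElem?_eq_getElem hi, Set.mem_ofPred_eq,
    List.mem_append, Option.toList_some, List.mem_singleton, Set.mem_insert_iff]
  exact or_comm

theorem getElem_notMem_prefixComplex {L : List (Finset E)} (hL : L.Nodup) {i : ℕ}
    (hi : i < L.length) : L[i] ∉ prefixComplex L i := by
  intro h
  obtain ⟨j, hj, hji⟩ := List.mem_take_iff_getElem.1 h
  have := (hL.getElem_inj_iff).1 hji
  omega

/-- The image of H_k(F_i) in H_k(F_j) is Z_i / (Z_i ∩ B_j). All later statements on persistent Betti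
numbers are reduced to dimensions of such intersections. -/
theorem persistentBetti_add (L : List (Finset E)) (k : ℕ) {i j : ℕ} (hij : i ≤ j) :
    persistentBetti 𝔽 L k i j + Module.finrank 𝔽
      (cycles 𝔽 (prefixComplex L i) k ⊓ boundaries 𝔽 (prefixComplex L j) k :
        Submodule 𝔽 (Finset E →₀ 𝔽)) = Module.finrank 𝔽 (cycles 𝔽 (prefixComplex L i) k) := by
  have := finiteDimensional_cycles (𝔽 := 𝔽) (finite_prefixComplex L i) k
  rw [persistentBetti, dif_pos hij]
  exact finrank_range_subquotientMap _ _

theorem persistentBetti_zero_left (L : List (Finset E)) (k j : ℕ) :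
    persistentBetti 𝔽 L k 0 j = 0 := by
  have h := persistentBetti_add (𝔽 := 𝔽) L k (Nat.zero_le j)
  have h0 : chains 𝔽 (prefixComplex L 0) k = ⊥ := by
    simp [chains, prefixComplex]
  have : Module.finrank 𝔽 (cycles 𝔽 (prefixComplex L 0) k) = 0 := by
    rw [cycles, h0, bot_inf_eq, finrank_bot]
  omega

/-- The multiplicity of a point of an index diagram is nonnegative before truncation. -/
theorem persistentBetti_add_le (L : List (Finset E)) (k : ℕ) {i j : ℕ} (hij : i + 1 ≤ j) :
    persistentBetti 𝔽 L k (i + 1) (j + 1) + persistentBetti 𝔽 L k i j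
      ≤ persistentBetti 𝔽 L k (i + 1) j + persistentBetti 𝔽 L k i (j + 1) := by
  have h1 := persistentBetti_add (𝔽 := 𝔽) L k (i := i + 1) (j := j + 1) (by omega)
  have h2 := persistentBetti_add (𝔽 := 𝔽) L k (i := i) (j := j) (by omega)
  have h3 := persistentBetti_add (𝔽 := 𝔽) L k (i := i + 1) (j := j) (by omega)
  have h4 := persistentBetti_add (𝔽 := 𝔽) L k (i := i) (j := j + 1) (by omega)
  have hZ : cycles 𝔽 (prefixComplex L i) k ≤ cycles 𝔽 (prefixComplex L (i + 1)) k :=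
    cycles_mono 𝔽 (prefixComplex_mono L (by omega)) k
  have hB : boundaries 𝔽 (prefixComplex L j) k ≤ boundaries 𝔽 (prefixComplex L (j + 1)) k :=
    Submodule.map_mono (chains_mono 𝔽 (prefixComplex_mono L (by omega)) (k + 1))
  have := finiteDimensional_cycles (𝔽 := 𝔽) (finite_prefixComplex L (i + 1)) k
  generalize cycles 𝔽 (prefixComplex L (i + 1)) k = Z' at *
  generalize cycles 𝔽 (prefixComplex L i) k = Z at *
  generalize boundaries 𝔽 (prefixComplex L (j + 1)) k = B' at *
  generalize boundaries 𝔽 (prefixComplex L j) k = B at *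
  have f1 : FiniteDimensional 𝔽 (Z' ⊓ B' : Submodule 𝔽 (Finset E →₀ 𝔽)) :=
    Submodule.finiteDimensional_of_le inf_le_left
  have f2 : FiniteDimensional 𝔽 (Z ⊓ B' : Submodule 𝔽 (Finset E →₀ 𝔽)) :=
    Submodule.finiteDimensional_of_le (inf_le_left.trans hZ)
  have f3 : FiniteDimensional 𝔽 (Z' ⊓ B : Submodule 𝔽 (Finset E →₀ 𝔽)) :=
    Submodule.finiteDimensional_of_le inf_le_left
  -- Z ∩ B' and Z' ∩ B both lie in Z' ∩ B' and meet in Z ∩ B; the dimension formula for them is the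
  -- claimed inequality.
  have e := Submodule.finrank_sup_add_finrank_inf_eq (Z ⊓ B') (Z' ⊓ B)
  have hle : Module.finrank 𝔽 ((Z ⊓ B') ⊔ (Z' ⊓ B) : Submodule 𝔽 (Finset E →₀ 𝔽))
      ≤ Module.finrank 𝔽 (Z' ⊓ B' : Submodule 𝔽 (Finset E →₀ 𝔽)) :=
    Submodule.finrank_mono (sup_le (inf_le_inf_right _ hZ) (inf_le_inf_left _ hB))
  have heq : (Z ⊓ B') ⊓ (Z' ⊓ B) = Z ⊓ B := by
    rw [inf_inf_inf_comm, inf_eq_left.2 hZ, inf_eq_right.2 hB]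
  rw [heq] at e
  omega

/-- The map Z/(Z ∩ B) → Z'/(Z' ∩ B) is injective. This makes the multiplicities of the essential
points nonnegative before truncation. -/
theorem persistentBetti_mono_left (L : List (Finset E)) (k : ℕ) {i j : ℕ} (hij : i + 1 ≤ j) :
    persistentBetti 𝔽 L k i j ≤ persistentBetti 𝔽 L k (i + 1) j := by
  have h1 := persistentBetti_add (𝔽 := 𝔽) L k hij
  have h2 := persistentBetti_add (𝔽 := 𝔽) L k (i := i) (j := j) (by omega)
  have hZ : cycles 𝔽 (prefixComplex L i) k ≤ cycles 𝔽 (prefixComplex L (i + 1)) k :=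
    cycles_mono 𝔽 (prefixComplex_mono L (by omega)) k
  have := finiteDimensional_cycles (𝔽 := 𝔽) (finite_prefixComplex L (i + 1)) k
  generalize cycles 𝔽 (prefixComplex L (i + 1)) k = Z' at *
  generalize cycles 𝔽 (prefixComplex L i) k = Z at *
  generalize boundaries 𝔽 (prefixComplex L j) k = B at *
  have f1 : FiniteDimensional 𝔽 Z := Submodule.finiteDimensional_of_le hZ
  have f3 : FiniteDimensional 𝔽 (Z' ⊓ B : Submodule 𝔽 (Finset E →₀ 𝔽)) :=
    Submodule.finiteDimensional_of_le inf_le_left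
  have e := Submodule.finrank_sup_add_finrank_inf_eq Z (Z' ⊓ B)
  have hle : Module.finrank 𝔽 (Z ⊔ (Z' ⊓ B) : Submodule 𝔽 (Finset E →₀ 𝔽))
      ≤ Module.finrank 𝔽 Z' := Submodule.finrank_mono (sup_le hZ inf_le_left)
  have heq : Z ⊓ (Z' ⊓ B) = Z ⊓ B := by rw [← inf_assoc, inf_eq_left.2 hZ]
  rw [heq] at e
  omega

/-- The number of `k`-dimensional classes born when the simplex with index `i` is added. -/
theorem persistentBetti_birth {L : List (Finset E)} (hL : ∀ i, FacetClosed (prefixComplex L i))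
    (k : ℕ) {i : ℕ} (hi : i < L.length) :
    persistentBetti 𝔽 L k (i + 1) (i + 1) + Module.finrank 𝔽 (cycles 𝔽 (prefixComplex L i) k)
      = persistentBetti 𝔽 L k i (i + 1)
        + Module.finrank 𝔽 (cycles 𝔽 (prefixComplex L (i + 1)) k) := by
  have h1 := persistentBetti_add (𝔽 := 𝔽) L k (le_refl (i + 1))
  have h2 := persistentBetti_add (𝔽 := 𝔽) L k (Nat.le_succ i)
  -- The new simplex has a single dimension. If it is a k-simplex, the k-boundaries are unchanged
  -- and lie in both cycle spaces; otherwise the k-cycles are unchanged.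
  have : cycles 𝔽 (prefixComplex L (i + 1)) k ⊓ boundaries 𝔽 (prefixComplex L (i + 1)) k
      = cycles 𝔽 (prefixComplex L i) k ⊓ boundaries 𝔽 (prefixComplex L (i + 1)) k := by
    rw [prefixComplex_succ L hi]
    by_cases h : L[i].card = k + 1
    · rw [boundaries_insert_of_card_ne (by omega)]
      have hB := boundaries_le_cycles (𝔽 := 𝔽) (hL i) k
      rw [inf_eq_right.2 hB, inf_eq_right.2 (hB.trans (cycles_mono 𝔽 (Set.subset_insert _ _) k))]
    · rw [cycles_insert_of_card_ne h]
  rw [this] at h1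
  simp only [Nat.succ_eq_add_one] at h2
  omega

/-- The number of `k`-dimensional classes that die when the simplex with index `i` is added. -/
theorem persistentBetti_death {L : List (Finset E)} (hL : ∀ i, FacetClosed (prefixComplex L i))
    (k : ℕ) {i : ℕ} (hi : i < L.length) :
    persistentBetti 𝔽 L k i i + Module.finrank 𝔽 (boundaries 𝔽 (prefixComplex L i) k)
      = persistentBetti 𝔽 L k i (i + 1)
        + Module.finrank 𝔽 (boundaries 𝔽 (prefixComplex L (i + 1)) k) := by
  have h1 := persistentBetti_add (𝔽 := 𝔽) L k (le_refl i)
  have h2 := persistentBetti_add (𝔽 := 𝔽) L k (Nat.le_succ i)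
  simp only [Nat.succ_eq_add_one] at h2
  rw [inf_eq_right.2 (boundaries_le_cycles (𝔽 := 𝔽) (hL i) k)] at h1
  by_cases h : L[i].card = k + 2
  · have hB := boundaries_le_cycles (𝔽 := 𝔽) (hL (i + 1)) k
    have hZ : cycles 𝔽 (prefixComplex L (i + 1)) k = cycles 𝔽 (prefixComplex L i) k := by
      rw [prefixComplex_succ L hi, cycles_insert_of_card_ne (by omega)]
    rw [hZ] at hB
    rw [inf_eq_right.2 hB] at h2
    omega
  · have hB : boundaries 𝔽 (prefixComplex L (i + 1)) k = boundaries 𝔽 (prefixComplex L i) k := by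
      rw [prefixComplex_succ L hi, boundaries_insert_of_card_ne h]
    rw [hB, inf_eq_right.2 (boundaries_le_cycles (𝔽 := 𝔽) (hL i) k)] at h2
    rw [hB]
    omega

/-- The chains gain one dimension and the boundaries one degree lower cannot shrink, so the cycles
gain at most one dimension. -/
theorem finrank_cycles_succ_le {L : List (Finset E)} (hL : L.Nodup) (k : ℕ) {i : ℕ}
    (hi : i < L.length) :
    Module.finrank 𝔽 (cycles 𝔽 (prefixComplex L (i + 1)) k)
      ≤ Module.finrank 𝔽 (cycles 𝔽 (prefixComplex L i) k)
        + if L[i].card = k + 1 then 1 else 0 := by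
  have hfin := finite_prefixComplex L i
  rw [prefixComplex_succ L hi]
  split_ifs with h
  · cases k with
    | zero =>
      -- Rank-nullity in the form `finrank_cycles_add` starts at degree one; in degree zero every
      -- chain is a cycle.
      have h0 : ∀ F : Set (Finset E), cycles 𝔽 F 0 = chains 𝔽 F 0 := by
        intro F
        refine inf_eq_left.2 ?_
        rw [chains, Finsupp.supported_eq_span_single, Submodule.span_le]
        rintro _ ⟨s, ⟨-, hs⟩, rfl⟩
        exact boundary_single_of_card_lt s (by omega) 1
      rw [h0, h0, finrank_chains_insert hfin (getElem_notMem_prefixComplex hL hi) h]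
    | succ k =>
      have h1 := finrank_cycles_add (𝔽 := 𝔽) hfin k
      have h2 := finrank_cycles_add (𝔽 := 𝔽) (hfin.insert L[i]) k
      have h3 := finrank_chains_insert (𝔽 := 𝔽) hfin (getElem_notMem_prefixComplex hL hi) h
      have h4 : boundaries 𝔽 (prefixComplex L i) k
          ≤ boundaries 𝔽 (insert L[i] (prefixComplex L i)) k :=
        Submodule.map_mono (chains_mono 𝔽 (Set.subset_insert _ _) (k + 1))
      have := finiteDimensional_chains (𝔽 := 𝔽) (hfin.insert L[i]) (k + 1)
      have : FiniteDimensional 𝔽 (boundaries 𝔽 (insert L[i] (prefixComplex L i)) k) :=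
        Module.Finite.map _ _
      have h5 := Submodule.finrank_mono h4
      omega
  · rw [cycles_insert_of_card_ne h, add_zero]

/-- The simplex with index `i` either creates a class in its dimension or destroys one in the
dimension below. -/
theorem persistentBetti_birth_add_death {L : List (Finset E)} (hn : L.Nodup)
    (hL : ∀ i, FacetClosed (prefixComplex L i)) (k : ℕ) {i : ℕ} (hi : i < L.length) :
    persistentBetti 𝔽 L (k + 1) (i + 1) (i + 1) + persistentBetti 𝔽 L k i i
      = persistentBetti 𝔽 L (k + 1) i (i + 1) + persistentBetti 𝔽 L k i (i + 1)
        + if L[i].card = k + 2 then 1 else 0 := by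
  have h1 := persistentBetti_birth (𝔽 := 𝔽) hL (k + 1) hi
  have h2 := persistentBetti_death (𝔽 := 𝔽) hL k hi
  have hfin := finite_prefixComplex L i
  have h3 := finrank_cycles_add (𝔽 := 𝔽) hfin k
  have h4 := finrank_cycles_add (𝔽 := 𝔽) (finite_prefixComplex L (i + 1)) k
  have h5 : Module.finrank 𝔽 (chains 𝔽 (prefixComplex L (i + 1)) (k + 1))
      = Module.finrank 𝔽 (chains 𝔽 (prefixComplex L i) (k + 1))
        + if L[i].card = k + 2 then 1 else 0 := by
    rw [prefixComplex_succ L hi]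
    split_ifs with h
    · exact finrank_chains_insert hfin (getElem_notMem_prefixComplex hn hi) h
    · rw [chains_insert_of_card_ne h, add_zero]
  omega

/-! ### Births and deaths by telescoping multiplicities. -/

theorem cast_pairMult (L : List (Finset E)) (k : ℕ) {i j : ℕ} (hij : i < j) :
    (pairMult 𝔽 L k (i + 1) (j + 1) : ℤ) = (persistentBetti 𝔽 L k (i + 1) j : ℤ)
      - persistentBetti 𝔽 L k (i + 1) (j + 1) - persistentBetti 𝔽 L k i j
      + persistentBetti 𝔽 L k i (j + 1) := by
  have := persistentBetti_add_le (𝔽 := 𝔽) L k (i := i) (j := j) hij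
  rw [pairMult, Nat.add_sub_cancel, Nat.add_sub_cancel, Int.toNat_of_nonneg]
  omega

theorem cast_essentialMult (L : List (Finset E)) (k : ℕ) {i : ℕ} (hi : i < L.length) :
    (essentialMult 𝔽 L k (i + 1) : ℤ) = (persistentBetti 𝔽 L k (i + 1) L.length : ℤ)
      - persistentBetti 𝔽 L k i L.length := by
  have := persistentBetti_mono_left (𝔽 := 𝔽) L k (i := i) (j := L.length) hi
  rw [essentialMult, Nat.add_sub_cancel, Int.toNat_of_nonneg]
  omega

/-- The sum over death indices telescopes. Its end at the last index is cancelled by the essential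
multiplicity, so only the Betti numbers at the birth index remain. -/
theorem sum_pairMult_birth (L : List (Finset E)) (k : ℕ) (i : Fin L.length) :
    ((∑ j : Fin L.length, if i < j then pairMult 𝔽 L k (i + 1) (j + 1) else 0)
      + essentialMult 𝔽 L k (i + 1) : ℕ) + persistentBetti 𝔽 L k i (i + 1)
      = persistentBetti 𝔽 L k (i + 1) (i + 1) := by
  zify
  rw [cast_essentialMult L k i.2]
  have h1 : (∑ j : Fin L.length, if i < j then (pairMult 𝔽 L k (i + 1) (j + 1) : ℤ) else 0)
      = ∑ j ∈ Finset.range L.length, if (i : ℕ) < j then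
        (pairMult 𝔽 L k (i + 1) (j + 1) : ℤ) else 0 :=
    Fin.sum_univ_eq_sum_range
      (fun j => if (i : ℕ) < j then (pairMult 𝔽 L k (i + 1) (j + 1) : ℤ) else 0) L.length
  have h2 : (Finset.range L.length).filter (fun j => (i : ℕ) < j)
      = Finset.Ico (i + 1 : ℕ) L.length := by
    ext j
    simp only [Finset.mem_filter, Finset.mem_range, Finset.mem_Ico]
    omega
  have h3 := Finset.sum_Ico_sub (fun j => (persistentBetti 𝔽 L k i j : ℤ)
    - persistentBetti 𝔽 L k (i + 1) j) (m := i + 1) (n := L.length) i.2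
  rw [h1, ← Finset.sum_filter, h2, Finset.sum_congr rfl (g := fun j : ℕ =>
    ((persistentBetti 𝔽 L k i (j + 1) : ℤ) - persistentBetti 𝔽 L k (i + 1) (j + 1))
      - ((persistentBetti 𝔽 L k i j : ℤ) - persistentBetti 𝔽 L k (i + 1) j)), h3]
  · ring
  · intro j hj
    rw [cast_pairMult L k (Finset.mem_Ico.1 hj).1]
    ring

/-- The sum over birth indices telescopes down to the empty complex, whose persistent Betti numbers
vanish. No essential term is involved. -/
theorem sum_pairMult_death (L : List (Finset E)) (k : ℕ) (j : Fin L.length) :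
    (∑ i : Fin L.length, if i < j then pairMult 𝔽 L k (i + 1) (j + 1) else 0)
      + persistentBetti 𝔽 L k j (j + 1) = persistentBetti 𝔽 L k j j := by
  zify
  have h1 : (∑ i : Fin L.length, if i < j then (pairMult 𝔽 L k (i + 1) (j + 1) : ℤ) else 0)
      = ∑ i ∈ Finset.range L.length, if i < (j : ℕ) then
        (pairMult 𝔽 L k (i + 1) (j + 1) : ℤ) else 0 :=
    Fin.sum_univ_eq_sum_range
      (fun i => if i < (j : ℕ) then (pairMult 𝔽 L k (i + 1) (j + 1) : ℤ) else 0) L.length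
  have h2 : (Finset.range L.length).filter (fun i => i < (j : ℕ)) = Finset.range j := by
    ext i
    simp only [Finset.mem_filter, Finset.mem_range]
    omega
  have h3 := Finset.sum_range_sub (fun i => (persistentBetti 𝔽 L k i j : ℤ)
    - persistentBetti 𝔽 L k i (j + 1)) j
  rw [h1, ← Finset.sum_filter, h2, Finset.sum_congr rfl (g := fun i : ℕ =>
    ((persistentBetti 𝔽 L k (i + 1) j : ℤ) - persistentBetti 𝔽 L k (i + 1) (j + 1))
      - ((persistentBetti 𝔽 L k i j : ℤ) - persistentBetti 𝔽 L k i (j + 1))), h3]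
  · simp [persistentBetti_zero_left]
  · intro i hi
    rw [cast_pairMult L k (Finset.mem_range.1 hi)]
    ring

theorem countP_replicate_eq {α : Type*} (p : α → Prop) [DecidablePred p] (n : ℕ) (a : α) :
    (Multiset.replicate n a).countP p = if p a then n else 0 := by
  rw [← Multiset.coe_replicate, Multiset.coe_countP, List.countP_replicate]
  simp

theorem countP_indexAPD (L : List (Finset E)) (f : Finset E → ℝ) (k : ℕ)
    (p : DiagramPoint → Prop) [DecidablePred p] :
    (indexAPD 𝔽 L f k).countP p
      = (∑ i : Fin L.length, ∑ j : Fin L.length, if i < j then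
          (if p (f (L.get i), (f (L.get j) : WithTop ℝ)) then pairMult 𝔽 L k (i + 1) (j + 1)
            else 0) else 0)
        + ∑ i : Fin L.length,
          if p (f (L.get i), (⊤ : WithTop ℝ)) then essentialMult 𝔽 L k (i + 1) else 0 := by
  rw [indexAPD, Multiset.countP_add]
  congr 1
  · rw [← Multiset.coe_countPAddMonoidHom, map_sum]
    refine Finset.sum_congr rfl fun i _ => ?_
    rw [map_sum]
    refine Finset.sum_congr rfl fun j _ => ?_
    split_ifs <;> simp_all [countP_replicate_eq]
  · rw [← Multiset.coe_countPAddMonoidHom, map_sum]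
    refine Finset.sum_congr rfl fun i _ => ?_
    rw [Multiset.coe_countPAddMonoidHom, countP_replicate_eq]

/-- The condition q is left general because it is used twice: equality with a given height counts
births there, and the trivial condition counts all points of the diagram, each of which has exactly
one birth. -/
theorem countP_birth (L : List (Finset E)) (f : Finset E → ℝ) (k : ℕ) (q : ℝ → Prop)
    [DecidablePred q] :
    (indexAPD 𝔽 L f k).countP (fun p => q p.1)
      = ∑ i : Fin L.length, if q (f (L.get i)) then
          persistentBetti 𝔽 L k (i + 1) (i + 1) - persistentBetti 𝔽 L k i (i + 1) else 0 := by
  rw [countP_indexAPD, ← Finset.sum_add_distrib]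
  refine Finset.sum_congr rfl fun i _ => ?_
  have := sum_pairMult_birth (𝔽 := 𝔽) L k i
  by_cases h : q (f (L.get i))
  · simp only [h, if_true]
    omega
  · simp only [h, if_false, ite_self, Finset.sum_const_zero, add_zero]

theorem countP_death (L : List (Finset E)) (f : Finset E → ℝ) (k : ℕ) (c : ℝ) :
    (indexAPD 𝔽 L f k).countP (fun p => p.2 = (c : WithTop ℝ))
      = ∑ j : Fin L.length, if f (L.get j) = c then
          persistentBetti 𝔽 L k j j - persistentBetti 𝔽 L k j (j + 1) else 0 := by
  rw [countP_indexAPD, Finset.sum_comm]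
  have : ∑ i : Fin L.length, (if ((f (L.get i), (⊤ : WithTop ℝ)) : DiagramPoint).2
      = (c : WithTop ℝ) then essentialMult 𝔽 L k (i + 1) else 0) = 0 :=
    Finset.sum_eq_zero fun i _ => by simp
  rw [this, add_zero]
  refine Finset.sum_congr rfl fun j _ => ?_
  have := sum_pairMult_death (𝔽 := 𝔽) L k j
  by_cases h : f (L.get j) = c
  · simp only [h, if_true]
    omega
  · simp only [WithTop.coe_inj, h, if_false, ite_self, Finset.sum_const_zero]

-- A facet precedes its simplex in a compatible order, so every prefix is again closed under facets
-- and boundaries in it are cycles.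
open Classical in
theorem facetClosed_prefixComplex {F : Set (Finset E)} {f : Finset E → ℝ} {L : List (Finset E)}
    (hF : FacetClosed F) (hL : IsCompatibleOrder F f L) (i : ℕ) :
    FacetClosed (prefixComplex L i) := by
  intro s hs x hx hc
  have hsL : s ∈ L := List.mem_of_mem_take hs
  have ht : s.erase x ∈ L := (hL.mem_iff _).2 (hF s ((hL.mem_iff _).1 hsL) x hx hc)
  obtain ⟨a, ha, rfl⟩ := List.mem_take_iff_getElem.1 hs
  obtain ⟨b, hb, hbt⟩ := List.getElem_of_mem ht
  have hss : L[b] ⊂ L[a] := hbt ▸ Finset.erase_ssubset hx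
  have hba : b < a := by
    rcases lt_trichotomy b a with h | h | h
    · exact h
    · subst h
      exact absurd hss (ssubset_irrefl _)
    · exact absurd hss (List.pairwise_iff_getElem.1 hL.faces_first a b _ hb h)
  exact List.mem_take_iff_getElem.2 ⟨b, by omega, hbt⟩

theorem sum_get_eq_ncard {F : Set (Finset E)} {f : Finset E → ℝ} {L : List (Finset E)}
    (hL : IsCompatibleOrder F f L) (p : Finset E → Prop) [DecidablePred p] :
    (∑ i : Fin L.length, if p (L.get i) then 1 else 0) = {s ∈ F | p s}.ncard := by
  rw [Finset.sum_boole, Nat.cast_id, ← Set.ncard_coe_finset]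
  have hinj : Function.Injective L.get := List.nodup_iff_injective_get.1 hL.nodup
  rw [← Set.ncard_image_of_injective _ hinj]
  congr 1
  ext s
  simp only [Finset.coe_filter, Finset.mem_univ, true_and, Set.mem_image, Set.mem_ofPred_eq]
  constructor
  · rintro ⟨i, hi, rfl⟩
    exact ⟨(hL.mem_iff _).1 (List.get_mem _ _), hi⟩
  · rintro ⟨hs, hp⟩
    obtain ⟨i, rfl⟩ := List.get_of_mem ((hL.mem_iff _).2 hs)
    exact ⟨i, hp, rfl⟩

/-- The `k`-dimensional deaths and `(k+1)`-dimensional births at height `c` count the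
`(k+1)`-simplices at that height. -/
theorem IsAPD.countP_death_add_birth {F : Set (Finset E)} (hF : FacetClosed F)
    {f : Finset E → ℝ} {Δ : ℕ → Multiset DiagramPoint} (h : IsAPD 𝔽 F f Δ) (k : ℕ) (c : ℝ) :
    (Δ k).countP (fun p => p.2 = (c : WithTop ℝ)) + (Δ (k + 1)).countP (fun p => p.1 = c)
      = {s ∈ F | s.card = k + 2 ∧ f s = c}.ncard := by
  obtain ⟨L, hL, hΔ⟩ := h
  rw [hΔ, hΔ, countP_birth L f (k + 1) (fun x => x = c), countP_death, ← Finset.sum_add_distrib,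
    ← sum_get_eq_ncard hL]
  refine Finset.sum_congr rfl fun i _ => ?_
  have h1 := persistentBetti_birth_add_death (𝔽 := 𝔽) hL.nodup
    (facetClosed_prefixComplex hF hL) k i.2
  have h2 := sum_pairMult_birth (𝔽 := 𝔽) L (k + 1) i
  have h3 := sum_pairMult_death (𝔽 := 𝔽) L k i
  by_cases hc : f (L.get i) = c
  · by_cases hk : (L.get i).card = k + 2
    · simp only [hc, hk, if_true, and_self]
      rw [List.get_eq_getElem] at hk
      rw [if_pos hk] at h1
      omega
    · simp only [hc, hk, if_true, false_and, if_false]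
      rw [List.get_eq_getElem] at hk
      rw [if_neg hk] at h1
      omega
  · simp only [hc, if_false, and_false]

/-- Each simplex gives birth to at most one class, and only in its own dimension. This bounds the
time for scanning a diagram. -/
theorem IsAPD.card_le {F : Set (Finset E)} (hF : FacetClosed F) {f : Finset E → ℝ}
    {Δ : ℕ → Multiset DiagramPoint} (h : IsAPD 𝔽 F f Δ) (k : ℕ) :
    (Δ k).card ≤ {s ∈ F | s.card = k + 1}.ncard := by
  obtain ⟨L, hL, hΔ⟩ := h
  have h0 := countP_birth (𝔽 := 𝔽) L f k (fun _ => True)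
  simp only [Multiset.countP_True, if_true] at h0
  rw [hΔ, h0, ← sum_get_eq_ncard hL]
  refine Finset.sum_le_sum fun i _ => ?_
  have h1 := persistentBetti_birth (𝔽 := 𝔽) (facetClosed_prefixComplex hF hL) k i.2
  have h2 := finrank_cycles_succ_le (𝔽 := 𝔽) hL.nodup k i.2
  rw [List.get_eq_getElem]
  omega

end IndexDiagrams

/-! ### A program logic for results, running times and queried directions. -/

namespace Prog

variable {D : ℕ} {α β : Type} {O : Oracle D} {Q : ℕ}

theorem result_bind (O : Oracle D) (p : Prog D α) (f : α → Prog D β) :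
    (p >>= f).result O = (f (p.result O)).result O := by
  change (p.bind f).result O = _
  induction p with
  | ret a => rfl
  | step p ih => simpa [bind, result] using ih
  | arith o x y k ih => simpa [bind, result] using ih _
  | comp x y k ih => simpa [bind, result] using ih _
  | query s i k ih => simpa [bind, result] using ih _

theorem time_bind (O : Oracle D) (Q : ℕ) (p : Prog D α) (f : α → Prog D β) :
    (p >>= f).time O Q = p.time O Q + (f (p.result O)).time O Q := by
  change (p.bind f).time O Q = _
  induction p with
  | ret a => simp [bind, result, time]
  | step p ih => simp only [bind, result, time, ih]; ring
  | arith o x y k ih => simp only [bind, result, time, ih]; ring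
  | comp x y k ih => simp only [bind, result, time, ih]; ring
  | query s i k ih => simp only [bind, result, time, ih]; ring

theorem directions_bind (O : Oracle D) (p : Prog D α) (f : α → Prog D β) :
    (p >>= f).directions O = p.directions O ∪ (f (p.result O)).directions O := by
  change (p.bind f).directions O = _
  induction p with
  | ret a => simp [bind, result, directions]
  | step p ih => simp only [bind, result, directions, ih]
  | arith o x y k ih => simp only [bind, result, directions, ih]
  | comp x y k ih => simp only [bind, result, directions, ih]
  | query s i k ih => simp only [bind, result, directions, ih, Set.insert_union]

/-- With the oracle `O`, the program `p` has a result with property `post`, takes time at most `t`,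
and queries at most `n` directions. -/
structure Spec (O : Oracle D) (Q : ℕ) (p : Prog D α) (t n : ℕ) (post : α → Prop) : Prop where
  result : post (p.result O)
  time : p.time O Q ≤ t
  directions : (p.directions O).encard ≤ n

theorem Spec.mono {p : Prog D α} {t t' n n' : ℕ} {post post' : α → Prop}
    (h : Spec O Q p t n post) (ht : t ≤ t') (hn : n ≤ n') (hp : ∀ a, post a → post' a) :
    Spec O Q p t' n' post' :=
  ⟨hp _ h.result, h.time.trans ht, h.directions.trans (by exact_mod_cast hn)⟩

theorem Spec.time_le {p : Prog D α} {t t' n : ℕ} {post : α → Prop}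
    (h : Spec O Q p t n post) (ht : t ≤ t') : Spec O Q p t' n post :=
  h.mono ht le_rfl fun _ => id

theorem Spec.imp {p : Prog D α} {t n : ℕ} {post post' : α → Prop}
    (h : Spec O Q p t n post) (hp : ∀ a, post a → post' a) : Spec O Q p t n post' :=
  h.mono le_rfl le_rfl hp

/-- The sets of directions are united, so adding their sizes may overcount; `Spec.ask_ask` gives the
sharper count for two queries in one direction. -/
theorem Spec.bind' {p : Prog D α} {f : α → Prog D β} {t t' n n' : ℕ} {post : α → Prop}
    {post' : β → Prop} (hp : Spec O Q p t n post)
    (hf : ∀ a, post a → Spec O Q (f a) t' n' post') :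
    Spec O Q (p >>= f) (t + t') (n + n') post' := by
  have h := hf _ hp.result
  refine ⟨?_, ?_, ?_⟩
  · rw [result_bind]
    exact h.result
  · rw [time_bind]
    exact add_le_add hp.time h.time
  · rw [directions_bind]
    refine (Set.encard_union_le _ _).trans ?_
    push_cast
    exact add_le_add hp.directions h.directions

/-- Sequential composition after a program without queries. -/
theorem Spec.bind {p : Prog D α} {f : α → Prog D β} {t t' n : ℕ} {post : α → Prop}
    {post' : β → Prop} (hp : Spec O Q p t 0 post)
    (hf : ∀ a, post a → Spec O Q (f a) t' n post') :
    Spec O Q (p >>= f) (t + t') n post' := by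
  simpa using hp.bind' hf

theorem spec_pure {a : α} {post : α → Prop} (h : post a) :
    Spec O Q (pure a : Prog D α) 0 0 post :=
  ⟨h, le_rfl, by simp [directions, pure]⟩

theorem spec_ret {a : α} {post : α → Prop} (h : post a) : Spec O Q (ret a : Prog D α) 0 0 post :=
  spec_pure h

theorem spec_arith (o : ArithOp) (x y : ℝ) :
    Spec O Q (arith o x y ret) 1 0 fun z => z = o.eval x y :=
  ⟨rfl, le_rfl, by simp [directions]⟩

theorem spec_add (x y : ℝ) : Spec O Q (add x y) 1 0 fun z => z = x + y := spec_arith _ _ _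
theorem spec_sub (x y : ℝ) : Spec O Q (sub x y) 1 0 fun z => z = x - y := spec_arith _ _ _
theorem spec_mul (x y : ℝ) : Spec O Q (mul x y) 1 0 fun z => z = x * y := spec_arith _ _ _
theorem spec_div (x y : ℝ) : Spec O Q (div x y) 1 0 fun z => z = x / y := spec_arith _ _ _

theorem spec_compare (x y : ℝ) : Spec O Q (compare x y) 1 0 fun z => z = cmp x y :=
  ⟨rfl, le_rfl, by simp [directions, compare]⟩

theorem spec_steps (n : ℕ) : Spec O Q (steps n) n 0 fun _ => True := by
  induction n with
  | zero => exact spec_ret trivial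
  | succ n ih =>
    refine ⟨trivial, ?_, ?_⟩
    · simp only [steps, time]
      exact Nat.succ_le_succ ih.time
    · simp only [steps, directions]
      exact ih.directions

theorem spec_array {n t : ℕ} {f : Fin n → Prog D α} {post : Fin n → α → Prop}
    (h : ∀ i, Spec O Q (f i) t 0 (post i)) :
    Spec O Q (array n f) (n * (1 + t)) 0 fun x => ∀ i, post i (x i) := by
  induction n with
  | zero => exact (spec_ret fun i => i.elim0).time_le (Nat.zero_le _)
  | succ n ih =>
    unfold array
    refine ((spec_steps 1).bind fun _ _ => (h 0).bind fun x hx =>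
      (ih fun i => h i.succ).bind fun xs hxs => spec_pure
        (post := fun x : Fin (n + 1) → α => ∀ i, post i (x i)) ?_).time_le (by lia)
    intro i
    cases i using Fin.cases with
    | zero => exact hx
    | succ i => exact hxs i

theorem spec_total {n t : ℕ} {f : Fin n → Prog D ℝ} {g : Fin n → ℝ}
    (h : ∀ i, Spec O Q (f i) t 0 fun x => x = g i) :
    Spec O Q (total n f) (n * (2 + t)) 0 fun x => x = ∑ i, g i := by
  induction n with
  | zero => exact (spec_ret (by simp)).time_le (Nat.zero_le _)
  | succ n ih =>
    unfold total
    refine ((spec_steps 1).bind fun _ _ => (h 0).bind fun x hx =>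
      (ih fun i => h i.succ).bind fun y hy => (spec_add x y).imp
        (post' := fun x => x = ∑ i, g i) fun z hz => ?_).time_le (by lia)
    rw [hz, hx, hy, Fin.sum_univ_succ]

theorem spec_mapList {t : ℕ} {f : α → Prog D β} {post : α → β → Prop} (l : List α)
    (h : ∀ a ∈ l, Spec O Q (f a) t 0 (post a)) :
    Spec O Q (mapList f l) (l.length * (1 + t)) 0 fun r => List.Forall₂ post l r := by
  induction l with
  | nil => exact (spec_ret List.Forall₂.nil).time_le (Nat.zero_le _)
  | cons a l ih =>
    unfold mapList
    exact ((spec_steps 1).bind fun _ _ => (h a (by simp)).bind fun x hx =>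
      (ih fun b hb => h b (by simp [hb])).bind fun y hy => spec_pure
        (List.Forall₂.cons hx hy)).time_le (by simp only [List.length_cons]; lia)

theorem spec_mapList_eq {t : ℕ} {f : α → Prog D β} {g : α → β} (l : List α)
    (h : ∀ a ∈ l, Spec O Q (f a) t 0 fun x => x = g a) :
    Spec O Q (mapList f l) (l.length * (1 + t)) 0 fun r => r = l.map g :=
  (spec_mapList l h).imp fun r hr => by
    rw [eq_comm, ← List.forall₂_eq_eq_eq, List.forall₂_map_left_iff]
    exact hr.imp fun _ _ h => h.symm

/-- A loop with an invariant that may depend on the processed part of the list. -/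
theorem spec_foldList_aux {f : β → α → Prog D β} {n : ℕ} {t : α → ℕ} (inv : List α → β → Prop)
    (l₂ : List α) : ∀ (l₁ : List α) (b : β), inv l₁ b →
    (∀ l₁' a l₂' b, l₁ ++ l₂ = l₁' ++ a :: l₂' → inv l₁' b →
      Spec O Q (f b a) (t a) n (inv (l₁' ++ [a]))) →
    Spec O Q (foldList f b l₂) (l₂.map fun a => 1 + t a).sum (l₂.length * n) (inv (l₁ ++ l₂)) := by
  induction l₂ with
  | nil =>
    intro l₁ b hb _
    exact (spec_ret (by simpa using hb)).mono (Nat.zero_le _) (Nat.zero_le _) fun _ => id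
  | cons a l₂ ih =>
    intro l₁ b hb h
    unfold foldList
    refine ((spec_steps 1).bind' fun _ _ => (h l₁ a l₂ b rfl hb).bind' fun b' hb' =>
      (ih (l₁ ++ [a]) b' hb' fun l₁' a' l₂' b h' => h l₁' a' l₂' b (by simpa using h'))).mono
        ?_ ?_ ?_
    · simp only [List.map_cons, List.sum_cons]
      lia
    · simp only [List.length_cons]
      lia
    · intro x hx
      simpa using hx

/-- The invariant sees the processed prefix and the time may depend on the element. The loop over
faces needs both: its table holds exactly the processed faces, and larger faces take more lookups.
-/
theorem spec_foldList {f : β → α → Prog D β} {n : ℕ} {t : α → ℕ} (inv : List α → β → Prop)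
    {l : List α} {b : β} (hb : inv [] b)
    (h : ∀ l₁ a l₂ b, l = l₁ ++ a :: l₂ → inv l₁ b → Spec O Q (f b a) (t a) n (inv (l₁ ++ [a]))) :
    Spec O Q (foldList f b l) (l.map fun a => 1 + t a).sum (l.length * n) (inv l) :=
  spec_foldList_aux inv l [] b hb h

theorem spec_foldList_const {f : β → α → Prog D β} {t : ℕ} (inv : List α → β → Prop)
    {l : List α} {b : β} (hb : inv [] b)
    (h : ∀ l₁ a l₂ b, l = l₁ ++ a :: l₂ → inv l₁ b → Spec O Q (f b a) t 0 (inv (l₁ ++ [a]))) :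
    Spec O Q (foldList f b l) (l.length * (1 + t)) 0 (inv l) := by
  have := spec_foldList inv hb h
  simpa using this

theorem spec_dot {n : ℕ} (x y : Fin n → ℝ) : Spec O Q (dot x y) (n * 3) 0 fun z => z = x ⬝ᵥ y :=
  spec_total fun i => spec_mul (x i) (y i)

theorem spec_array_eq {n t : ℕ} {f : Fin n → Prog D ℝ} {g : Fin n → ℝ}
    (h : ∀ i, Spec O Q (f i) t 0 fun x => x = g i) :
    Spec O Q (array n f) (n * (1 + t)) 0 fun x => x = g :=
  (spec_array h).imp fun _ hx => funext hx

theorem spec_vsub {n : ℕ} (x y : Fin n → ℝ) : Spec O Q (vsub x y) (n * 2) 0 fun z => z = x - y :=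
  spec_array_eq fun i => spec_sub (x i) (y i)

theorem spec_vadd {n : ℕ} (x y : Fin n → ℝ) : Spec O Q (vadd x y) (n * 2) 0 fun z => z = x + y :=
  spec_array_eq fun i => spec_add (x i) (y i)

theorem spec_vneg {n : ℕ} (x : Fin n → ℝ) : Spec O Q (vneg x) (n * 2) 0 fun z => z = -x :=
  spec_array_eq fun i => (spec_sub 0 (x i)).imp fun z hz => by rw [hz]; simp

theorem spec_vcomb {n : ℕ} (a : ℝ) (x : Fin n → ℝ) (b : ℝ) (y : Fin n → ℝ) :
    Spec O Q (vcomb a x b y) (n * 4) 0 fun z => z = a • x + b • y :=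
  spec_array_eq fun i => (spec_mul a (x i)).bind fun p hp => (spec_mul b (y i)).bind fun q hq =>
    (spec_add p q).imp fun z hz => by rw [hz, hp, hq]; rfl

theorem spec_lift {n : ℕ} (x : Fin n → ℝ) :
    Spec O Q (lift x) (4 * n + 1) 0 fun z => z = liftPoint x :=
  ((spec_dot x x).bind fun q hq => (spec_steps (n + 1)).bind fun _ _ => spec_pure
    (post := fun z => z = liftPoint x) (by rw [hq]; rfl)).time_le (by lia)

theorem spec_heights {n : ℕ} (V : List (Fin n → ℝ)) (s : Fin n → ℝ) :
    Spec O Q (heights V s) (V.length * (1 + n * 3)) 0 fun H => H = V.map fun x => s ⬝ᵥ x :=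
  spec_mapList_eq V fun x _ => spec_dot s x

/-! #### Orthogonalization -/

/-- The vectors in the list `B` are pairwise orthogonal. -/
def OrthoList {n : ℕ} (B : List (Fin n → ℝ)) : Prop := B.Pairwise fun x y => x ⬝ᵥ y = 0

/-- Since the vectors of B are pairwise orthogonal, subtracting a multiple of one of them does not
spoil orthogonality to the earlier ones, and a single pass suffices. -/
theorem spec_reject {n : ℕ} {B : List (Fin n → ℝ)} (hB : OrthoList B) (x : Fin n → ℝ) :
    Spec O Q (reject B x) (B.length * (9 * n + 2)) 0 fun r =>
      (∀ b ∈ B, r ⬝ᵥ b = 0) ∧ x - r ∈ Submodule.span ℝ {b | b ∈ B} := by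
  refine (spec_foldList_const (t := 9 * n + 1) (fun l r => (∀ b ∈ l, r ⬝ᵥ b = 0) ∧
    x - r ∈ Submodule.span ℝ {b | b ∈ B}) ⟨by simp, by simp⟩ ?_).time_le (by lia)
  rintro l₁ b l₂ y rfl ⟨hy, hx⟩
  refine ((spec_dot y b).bind fun p hp => (spec_dot b b).bind fun q hq => (spec_div p q).bind
    fun t ht => (spec_array_eq (t := 2) (g := y - t • b) fun i => (spec_mul t (b i)).bind
      fun z hz => (spec_sub (y i) z).imp fun w hw => by rw [hw, hz]; rfl).imp
        (post' := fun r => (∀ b' ∈ l₁ ++ [b], r ⬝ᵥ b' = 0) ∧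
          x - r ∈ Submodule.span ℝ {b' | b' ∈ l₁ ++ b :: l₂}) fun r hr => ?_).time_le (by lia)
  subst hr hp hq
  constructor
  · intro c hc
    rcases List.mem_append.1 hc with hc | hc
    · have : b ⬝ᵥ c = 0 := by
        rw [dotProduct_comm]
        exact (List.pairwise_append.1 hB).2.2 c hc b (by simp)
      rw [sub_dotProduct, smul_dotProduct, hy c hc, this]
      simp
    · rw [List.mem_singleton.1 hc, sub_dotProduct, smul_dotProduct, ht, smul_eq_mul]
      -- Zero vectors may occur in B, since dependent input is not discarded. Then b = 0 and the
      -- value of the quotient does not matter.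
      by_cases h0 : b ⬝ᵥ b = 0
      · rw [h0, dotProduct_self_eq_zero.1 h0]
        simp
      · rw [div_mul_cancel₀ _ h0, sub_self]
  · have : x - (y - t • b) = (x - y) + t • b := by abel
    rw [this]
    exact Submodule.add_mem _ hx (Submodule.smul_mem _ _ (Submodule.subset_span (by simp)))

theorem spec_gramSchmidt {n : ℕ} (L : List (Fin n → ℝ)) :
    Spec O Q (gramSchmidt L) (L.length * (1 + L.length * (9 * n + 2))) 0 fun B =>
      OrthoList B ∧ B.length = L.length ∧
        Submodule.span ℝ {b | b ∈ B} = Submodule.span ℝ {b | b ∈ L} := by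
  refine spec_foldList_const (fun l B => OrthoList B ∧ B.length = l.length ∧
    Submodule.span ℝ {b | b ∈ B} = Submodule.span ℝ {b | b ∈ l})
    ⟨List.Pairwise.nil, rfl, rfl⟩ ?_
  rintro l₁ x l₂ B rfl ⟨hB, hl, hs⟩
  refine ((spec_reject hB x).bind fun r hr => spec_pure (post := fun B => OrthoList B ∧
    B.length = (l₁ ++ [x]).length ∧ Submodule.span ℝ {b | b ∈ B}
      = Submodule.span ℝ {b | b ∈ l₁ ++ [x]}) ?_).time_le ?_
  · refine ⟨?_, by simp [hl], ?_⟩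
    · refine List.pairwise_append.2 ⟨hB, List.pairwise_singleton _ _, fun b hb c hc => ?_⟩
      rw [List.mem_singleton.1 hc, dotProduct_comm]
      exact hr.1 b hb
    · have hset : ∀ (l : List (Fin n → ℝ)) (y : Fin n → ℝ),
          {b | b ∈ l ++ [y]} = {b | b ∈ l} ∪ {y} := by
        intro l y
        ext b
        simp [or_comm]
      rw [hset, hset, Submodule.span_union, Submodule.span_union, hs]
      have hxr := hr.2
      rw [hs] at hxr
      refine le_antisymm (sup_le le_sup_left ?_) (sup_le le_sup_left ?_)
      · rw [Submodule.span_singleton_le_iff_mem]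
        have : r = x - (x - r) := by abel
        rw [this]
        exact Submodule.sub_mem _ (Submodule.mem_sup_right (Submodule.mem_span_singleton_self x))
          (Submodule.mem_sup_left hxr)
      · rw [Submodule.span_singleton_le_iff_mem]
        have : x = (x - r) + r := by abel
        rw [this]
        exact Submodule.add_mem _ (Submodule.mem_sup_left hxr)
          (Submodule.mem_sup_right (Submodule.mem_span_singleton_self r))
  · rw [add_zero]
    refine Nat.mul_le_mul_right _ ?_
    rw [hl]
    simp

theorem dotProduct_eq_zero_of_mem_span {n : ℕ} {S : Set (Fin n → ℝ)} {r x : Fin n → ℝ}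
    (h : ∀ b ∈ S, r ⬝ᵥ b = 0) (hx : x ∈ Submodule.span ℝ S) : r ⬝ᵥ x = 0 := by
  induction hx using Submodule.span_induction with
  | mem b hb => exact h b hb
  | zero => simp
  | add x y _ _ hx hy => rw [dotProduct_add, hx, hy, add_zero]
  | smul a x _ hx => rw [dotProduct_smul, hx, smul_zero]

/-- A zero rejection means that the tested basis vector lies in the span of B. Failure of the whole
search therefore puts every listed basis vector into that span. -/
theorem spec_orthogonalTo {n : ℕ} {B : List (Fin n → ℝ)} (hB : OrthoList B) (l : List (Fin n)) :
    Spec O Q (orthogonalTo B l) (l.length * (4 * n + 1 + B.length * (9 * n + 2))) 0 fun r =>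
      (∀ b ∈ B, r ⬝ᵥ b = 0) ∧
        (r = 0 → ∀ i ∈ l, (Pi.single i 1 : Fin n → ℝ) ∈ Submodule.span ℝ {b | b ∈ B}) := by
  induction l with
  | nil => exact (spec_ret (by simp)).time_le (by simp)
  | cons i l ih =>
    unfold orthogonalTo
    refine ((spec_steps n).bind fun _ _ => (spec_reject hB _).bind fun r hr =>
      (spec_dot r r).bind fun q hq => (spec_compare 0 q).bind fun o ho =>
        (?_ : Spec O Q _ (l.length * (4 * n + 1 + B.length * (9 * n + 2))) 0 fun r =>
      (∀ b ∈ B, r ⬝ᵥ b = 0) ∧ (r = 0 → ∀ j ∈ i :: l,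
        (Pi.single j 1 : Fin n → ℝ) ∈ Submodule.span ℝ {b | b ∈ B}))).time_le ?_
    · have hcase : r = 0 → ∀ r' : Fin n → ℝ, ((∀ b ∈ B, r' ⬝ᵥ b = 0) ∧
          (r' = 0 → ∀ i ∈ l, (Pi.single i 1 : Fin n → ℝ) ∈ Submodule.span ℝ {b | b ∈ B})) →
          ((∀ b ∈ B, r' ⬝ᵥ b = 0) ∧ (r' = 0 → ∀ j ∈ i :: l,
            (Pi.single j 1 : Fin n → ℝ) ∈ Submodule.span ℝ {b | b ∈ B})) := by
        rintro rfl r' ⟨h1, h2⟩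
        refine ⟨h1, fun h j hj => ?_⟩
        rcases List.mem_cons.1 hj with rfl | hj
        · simpa using hr.2
        · exact h2 h j hj
      have hnonneg : 0 ≤ r ⬝ᵥ r := Finset.sum_nonneg fun i _ => mul_self_nonneg _
      subst hq
      match o, ho with
      | .lt, ho =>
        refine (spec_pure ?_).time_le (Nat.zero_le _)
        refine ⟨hr.1, fun h => ?_⟩
        have := (cmp_eq_lt_iff _ _).1 ho.symm
        rw [h] at this
        simp at this
      | .eq, ho =>
        exact ih.imp (hcase (dotProduct_self_eq_zero.1 ((cmp_eq_eq_iff _ _).1 ho.symm).symm))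
      | .gt, ho =>
        exact absurd ((cmp_eq_gt_iff _ _).1 ho.symm) (not_lt.2 hnonneg)
    · simp only [List.length_cons]
      lia

/-! #### Sorting and tilting -/

theorem spec_merge (xs ys : List ℝ) (hx : xs.Pairwise (· ≤ ·)) (hy : ys.Pairwise (· ≤ ·)) :
    Spec O Q (merge xs ys) (2 * (xs.length + ys.length) + 1) 0 fun l =>
      l.Perm (xs ++ ys) ∧ l.Pairwise (· ≤ ·) := by
  induction h : xs.length + ys.length generalizing xs ys with
  | zero =>
    obtain rfl : xs = [] := List.length_eq_zero_iff.1 (by omega)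
    rw [merge]
    exact (spec_steps 1).bind fun _ _ => spec_pure ⟨by simp, hy⟩
  | succ n ih =>
    match xs, ys with
    | [], ys =>
      rw [merge]
      exact ((spec_steps 1).bind fun _ _ => spec_pure ⟨by simp, hy⟩).time_le (by lia)
    | x :: xs, [] =>
      rw [merge]
      exact ((spec_steps 1).bind fun _ _ => spec_pure ⟨by simp, hx⟩).time_le (by lia)
    | x :: xs, y :: ys =>
      rw [merge]
      have hx' := List.pairwise_cons.1 hx
      have hy' := List.pairwise_cons.1 hy
      simp only [List.length_cons] at h
      have hle : x ≤ y → Spec O Q (merge xs (y :: ys) >>= fun l => return x :: l) (2 * n + 1) 0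
          fun l => l.Perm (x :: xs ++ y :: ys) ∧ l.Pairwise (· ≤ ·) := by
        intro hxy
        refine (ih xs (y :: ys) hx'.2 hy (by simp only [List.length_cons]; omega)).bind
          (t' := 0) fun l hl => spec_pure ⟨hl.1.cons x, List.pairwise_cons.2 ⟨fun z hz => ?_, hl.2⟩⟩
        rcases List.mem_append.1 (hl.1.mem_iff.1 hz) with hz | hz
        · exact hx'.1 z hz
        · rcases List.mem_cons.1 hz with rfl | hz
          · exact hxy
          · exact hxy.trans (hy'.1 z hz)
      refine ((spec_steps 1).bind fun _ _ => (spec_compare x y).bind fun o ho =>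
        (?_ : Spec O Q _ (2 * n + 1) 0 fun l : List ℝ => l.Perm (x :: xs ++ y :: ys) ∧
          l.Pairwise (· ≤ ·))).time_le (by lia)
      match o, ho with
      | .lt, ho => exact hle ((cmp_eq_lt_iff _ _).1 ho.symm).le
      | .eq, ho => exact hle ((cmp_eq_eq_iff _ _).1 ho.symm).le
      | .gt, ho =>
        have hyx := (cmp_eq_gt_iff _ _).1 ho.symm
        refine (ih (x :: xs) ys hx hy'.2 (by simp only [List.length_cons]; omega)).bind
          (t' := 0) fun l hl => spec_pure ⟨?_, List.pairwise_cons.2 ⟨fun z hz => ?_, hl.2⟩⟩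
        · exact (hl.1.cons y).trans List.perm_middle.symm
        rcases List.mem_append.1 (hl.1.mem_iff.1 hz) with hz | hz
        · rcases List.mem_cons.1 hz with rfl | hz
          · exact hyx.le
          · exact hyx.le.trans (hx'.1 z hz)
        · exact hy'.1 z hz

/-- With c the binary logarithm, rounded up, of the larger half, n entries have logarithm c + 1.
Splitting, merging and the additive constants of the halves cost at most 3n + 6, which is at most
the increment 6n plus the constant 2 as n ≥ 2. -/
theorem spec_mergeSortAux (depth : ℕ) (l : List ℝ) (hl : l.length ≤ depth) (h0 : l ≠ []) :
    Spec O Q (mergeSortAux depth l) (6 * l.length * Nat.clog 2 l.length + 2) 0 fun r =>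
      r.Perm l ∧ r.Pairwise (· ≤ ·) := by
  induction depth generalizing l with
  | zero => exact absurd (List.length_eq_zero_iff.1 (by omega)) h0
  | succ depth ih =>
    have hpos := List.length_pos_iff.2 h0
    unfold mergeSortAux
    split_ifs with h1
    · refine ((spec_steps _).bind fun _ _ => spec_pure ⟨List.Perm.refl _, ?_⟩).time_le (by lia)
      obtain ⟨a, rfl⟩ := List.length_eq_one_iff.1 (show l.length = 1 by omega)
      exact List.pairwise_singleton _ _
    · have ht : (l.take (l.length / 2)).length = l.length / 2 := by
        rw [List.length_take]
        omega
      have hd : (l.drop (l.length / 2)).length = l.length - l.length / 2 := List.length_drop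
      have c0 : Nat.clog 2 l.length = Nat.clog 2 ((l.length + 1) / 2) + 1 :=
        Nat.clog_of_two_le (by norm_num) (by omega)
      refine ((spec_steps _).bind fun _ _ => (ih (l.take (l.length / 2)) (by omega) ?_).bind
        fun a ha => (ih (l.drop (l.length / 2)) (by omega) ?_).bind fun b hb =>
          (?_ : Spec O Q (merge a b) (2 * l.length + 1) 0 fun r =>
            r.Perm l ∧ r.Pairwise (· ≤ ·))).time_le ?_
      · exact List.length_pos_iff.1 (by omega)
      · exact List.length_pos_iff.1 (by omega)
      · have hp : (a ++ b).Perm l := by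
          refine (ha.1.append hb.1).trans ?_
          rw [List.take_append_drop]
        refine (spec_merge a b ha.2 hb.2).mono ?_ le_rfl fun r hr => ⟨hr.1.trans hp, hr.2⟩
        rw [← hp.length_eq, List.length_append]
      · rw [ht, hd, c0]
        have c1 : Nat.clog 2 (l.length / 2) ≤ Nat.clog 2 ((l.length + 1) / 2) :=
          Nat.clog_mono_right 2 (by omega)
        have c2 : Nat.clog 2 (l.length - l.length / 2) ≤ Nat.clog 2 ((l.length + 1) / 2) :=
          Nat.clog_mono_right 2 (by omega)
        generalize Nat.clog 2 ((l.length + 1) / 2) = c at *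
        have e1 := Nat.mul_le_mul_left (6 * (l.length / 2)) c1
        have e2 := Nat.mul_le_mul_left (6 * (l.length - l.length / 2)) c2
        have e3 : 6 * (l.length / 2) * c + 6 * (l.length - l.length / 2) * c
            = 6 * l.length * c := by
          rw [← add_mul]
          congr 1
          omega
        have e4 : 6 * l.length * (c + 1) = 6 * l.length * c + 6 * l.length := by ring
        omega

/-- In a sorted list any two distinct entries are separated by some positive consecutive gap that is
at most their difference. The result may be `none` only if all entries are equal. -/
theorem spec_minGap (l : List ℝ) (hl : l.Pairwise (· ≤ ·)) :
    Spec O Q (minGap l) (4 * l.length) 0 fun r => (∀ g, r = some g → 0 < g) ∧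
      ∀ x ∈ l, ∀ y ∈ l, x < y → ∃ g, r = some g ∧ g ≤ y - x := by
  induction l with
  | nil => exact (spec_ret (by simp)).time_le (Nat.zero_le _)
  | cons x l ih =>
    match l with
    | [] =>
      refine (spec_ret ⟨by simp, fun a ha b hb hab => ?_⟩).time_le (Nat.zero_le _)
      rw [List.mem_singleton.1 ha, List.mem_singleton.1 hb] at hab
      exact absurd hab (lt_irrefl _)
    | y :: l =>
      unfold minGap
      have hl' := List.pairwise_cons.1 hl
      have hxy : x ≤ y := hl'.1 y (by simp)
      refine ((spec_steps 1).bind fun _ _ => (ih hl'.2).bind fun r hr =>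
        (spec_sub y x).bind fun δ hδ => (spec_compare 0 δ).bind fun o ho =>
          (?_ : Spec O Q _ 1 0 fun r => (∀ g, r = some g → 0 < g) ∧
            ∀ a ∈ x :: y :: l, ∀ b ∈ x :: y :: l, a < b →
              ∃ g, r = some g ∧ g ≤ b - a)).time_le (by simp only [List.length_cons]; lia)
      -- It suffices that the new value is at most the first gap, if that is positive, and at most
      -- the value found in the tail.
      have hred : ∀ r' : Option ℝ, (0 < δ → ∃ g, r' = some g ∧ g ≤ δ) →
          (∀ g, r = some g → ∃ g', r' = some g' ∧ g' ≤ g) →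
          ∀ a ∈ x :: y :: l, ∀ b ∈ x :: y :: l, a < b → ∃ g, r' = some g ∧ g ≤ b - a := by
        intro r' h1 h2 a ha b hb hab
        rcases List.mem_cons.1 hb with rfl | hb'
        · rcases List.mem_cons.1 ha with rfl | ha
          · exact absurd hab (lt_irrefl _)
          · exact absurd hab (not_lt.2 (hl'.1 a ha))
        have htail : ∀ c ∈ y :: l, c < b → ∃ g, r' = some g ∧ g ≤ b - c := by
          intro c hc hcb
          obtain ⟨g, hg, hgb⟩ := hr.2 c hc b hb' hcb
          obtain ⟨g', hg', hle⟩ := h2 g hg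
          exact ⟨g', hg', hle.trans hgb⟩
        rcases List.mem_cons.1 ha with rfl | ha
        · rcases hxy.eq_or_lt with heq | hlt
          · rw [heq]
            exact htail y (by simp) (heq ▸ hab)
          · obtain ⟨g, hg, hle⟩ := h1 (by rw [hδ]; linarith)
            refine ⟨g, hg, ?_⟩
            have : y ≤ b := (List.mem_cons.1 hb').elim (fun h => h.ge)
              ((List.pairwise_cons.1 hl'.2).1 b)
            linarith
        · exact htail a ha hab
      have hnot : ¬ 0 < δ → Spec O Q (pure r) 1 0 fun r => (∀ g, r = some g → 0 < g) ∧
            ∀ a ∈ x :: y :: l, ∀ b ∈ x :: y :: l, a < b → ∃ g, r = some g ∧ g ≤ b - a :=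
        fun h => (spec_pure ⟨hr.1, hred r (fun h' => absurd h' h)
          fun g hg => ⟨g, hg, le_rfl⟩⟩).time_le (Nat.zero_le _)
      match o, ho with
      | .eq, ho => exact hnot ((cmp_eq_eq_iff _ _).1 ho.symm).not_lt
      | .gt, ho => exact hnot ((cmp_eq_gt_iff _ _).1 ho.symm).not_gt
      | .lt, ho =>
        have hpos := (cmp_eq_lt_iff _ _).1 ho.symm
        have hδ' : ∀ g, (some δ : Option ℝ) = some g → 0 < g := by
          rintro g hg
          rwa [← Option.some.inj hg]
        match r, hr, hred with
        | none, hr, hred =>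
          exact (spec_pure ⟨hδ', hred _ (fun _ => ⟨δ, rfl, le_rfl⟩)
            fun g hg => absurd hg (by simp)⟩).time_le (Nat.zero_le _)
        | some g, hr, hred =>
          refine ((spec_compare δ g).bind fun o ho => (?_ : Spec O Q _ 0 0 _))
          have hge : g ≤ δ → Spec O Q (pure (some g)) 0 0 fun r => (∀ g, r = some g → 0 < g) ∧
              ∀ a ∈ x :: y :: l, ∀ b ∈ x :: y :: l, a < b → ∃ g, r = some g ∧ g ≤ b - a :=
            fun h => spec_pure ⟨hr.1, hred _ (fun _ => ⟨g, rfl, h⟩)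
              fun g' hg' => ⟨g', hg', le_rfl⟩⟩
          match o, ho with
          | .lt, ho =>
            refine spec_pure ⟨hδ', hred _ (fun _ => ⟨δ, rfl, le_rfl⟩) fun g' hg' => ⟨δ, rfl, ?_⟩⟩
            rw [← Option.some.inj hg']
            exact ((cmp_eq_lt_iff _ _).1 ho.symm).le
          | .eq, ho => exact hge ((cmp_eq_eq_iff _ _).1 ho.symm).ge
          | .gt, ho => exact hge ((cmp_eq_gt_iff _ _).1 ho.symm).le

/-- Only the bound is recorded, not that it is attained: a tilt preserves the order for any upper
bound on the width of the heights. -/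
theorem spec_maxList (l : List ℝ) :
    Spec O Q (maxList l) (l.length * 2) 0 fun M => ∀ x ∈ l, x ≤ M := by
  match l with
  | [] => exact (spec_ret (by simp)).time_le (Nat.zero_le _)
  | x :: l =>
    unfold maxList
    refine (spec_foldList_const (t := 1) (fun l' M => ∀ y ∈ x :: l', y ≤ M) (by simp) ?_).mono
      (by simp only [List.length_cons]; lia) le_rfl fun _ => id
    rintro l₁ y l₂ M - hM
    refine (spec_compare M y).bind (t' := 0) fun o ho => ?_
    have hmem : ∀ M', M ≤ M' → y ≤ M' → ∀ z ∈ x :: (l₁ ++ [y]), z ≤ M' := by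
      intro M' h1 h2 z hz
      rw [← List.cons_append] at hz
      rcases List.mem_append.1 hz with hz | hz
      · exact (hM z hz).trans h1
      · rwa [List.mem_singleton.1 hz]
    match o, ho with
    | .lt, ho => exact spec_pure (hmem _ ((cmp_eq_lt_iff _ _).1 ho.symm).le le_rfl)
    | .eq, ho => exact spec_pure (hmem _ le_rfl ((cmp_eq_eq_iff _ _).1 ho.symm).ge)
    | .gt, ho => exact spec_pure (hmem _ le_rfl ((cmp_eq_gt_iff _ _).1 ho.symm).le)

theorem spec_minList (l : List ℝ) :
    Spec O Q (minList l) (l.length * 2) 0 fun m => ∀ x ∈ l, m ≤ x := by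
  match l with
  | [] => exact (spec_ret (by simp)).time_le (Nat.zero_le _)
  | x :: l =>
    unfold minList
    refine (spec_foldList_const (t := 1) (fun l' m => ∀ y ∈ x :: l', m ≤ y) (by simp) ?_).mono
      (by simp only [List.length_cons]; lia) le_rfl fun _ => id
    rintro l₁ y l₂ m - hm
    refine (spec_compare m y).bind (t' := 0) fun o ho => ?_
    have hmem : ∀ m', m' ≤ m → m' ≤ y → ∀ z ∈ x :: (l₁ ++ [y]), m' ≤ z := by
      intro m' h1 h2 z hz
      rw [← List.cons_append] at hz
      rcases List.mem_append.1 hz with hz | hz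
      · exact h1.trans (hm z hz)
      · rwa [List.mem_singleton.1 hz]
    match o, ho with
    | .gt, ho => exact spec_pure (hmem _ ((cmp_eq_gt_iff _ _).1 ho.symm).le le_rfl)
    | .eq, ho => exact spec_pure (hmem _ le_rfl ((cmp_eq_eq_iff _ _).1 ho.symm).le)
    | .lt, ho => exact spec_pure (hmem _ le_rfl ((cmp_eq_lt_iff _ _).1 ho.symm).le)

/-- The direction `t` orders the points in `V` lexicographically by the heights in the directions
`s` and `s'`. -/
structure IsTilt {n : ℕ} (V : List (Fin n → ℝ)) (s s' t : Fin n → ℝ) : Prop where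
  lt_of_lt : ∀ x ∈ V, ∀ y ∈ V, s ⬝ᵥ x < s ⬝ᵥ y → t ⬝ᵥ x < t ⬝ᵥ y
  lt_of_eq : ∀ x ∈ V, ∀ y ∈ V, s ⬝ᵥ x = s ⬝ᵥ y → s' ⬝ᵥ x < s' ⬝ᵥ y → t ⬝ᵥ x < t ⬝ᵥ y
  eq_of_eq : ∀ x ∈ V, ∀ y ∈ V, s ⬝ᵥ x = s ⬝ᵥ y → s' ⬝ᵥ x = s' ⬝ᵥ y → t ⬝ᵥ x = t ⬝ᵥ y

/-- The choice of ε gives ε(g + w) = g/2. If the heights in direction s differ, by at least g, the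
new heights differ by at least (1 − ε)g − εw = g/2 > 0 in the same order. -/
theorem isTilt_of_gap {n : ℕ} {V : List (Fin n → ℝ)} {s s' : Fin n → ℝ} {g w : ℝ} (hg : 0 < g)
    (hw : 0 ≤ w) (hgap : ∀ x ∈ V, ∀ y ∈ V, s ⬝ᵥ x < s ⬝ᵥ y → g ≤ s ⬝ᵥ y - s ⬝ᵥ x)
    (hwidth : ∀ x ∈ V, ∀ y ∈ V, s' ⬝ᵥ x - s' ⬝ᵥ y ≤ w) :
    IsTilt V s s' ((1 - g / (g + w) / 2) • s + (g / (g + w) / 2) • s') := by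
  have hgw : 0 < g + w := by linarith
  set ε := g / (g + w) / 2 with hε
  have hε0 : 0 < ε := by positivity
  have hε1 : ε * (g + w) = g / 2 := by
    rw [hε]
    field_simp
  have hε2 : ε ≤ 1 / 2 := by
    rw [hε]
    have : g / (g + w) ≤ 1 := (div_le_one hgw).2 (by linarith)
    linarith
  have hdot : ∀ x, ((1 - ε) • s + ε • s') ⬝ᵥ x = (1 - ε) * (s ⬝ᵥ x) + ε * (s' ⬝ᵥ x) := by
    intro x
    rw [add_dotProduct, smul_dotProduct, smul_dotProduct, smul_eq_mul, smul_eq_mul]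
  constructor
  · intro x hx y hy h
    rw [hdot, hdot]
    have h1 := mul_le_mul_of_nonneg_left (hgap x hx y hy h) (show 0 ≤ 1 - ε by linarith)
    have h2 := mul_le_mul_of_nonneg_left (hwidth x hx y hy) hε0.le
    nlinarith
  · intro x hx y hy h h'
    rw [hdot, hdot, h]
    have := mul_lt_mul_of_pos_left h' hε0
    linarith
  · intro x hx y hy h h'
    rw [hdot, hdot, h, h']

theorem spec_tilt {n : ℕ} (V : List (Fin n → ℝ)) (hV : V ≠ []) (s s' : Fin n → ℝ) :
    Spec O Q (tilt s s' (V.map fun x => s ⬝ᵥ x) (V.map fun x => s' ⬝ᵥ x))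
      (6 * V.length * Nat.clog 2 V.length + 8 * V.length + 4 * n + 7) 0 (IsTilt V s s') := by
  unfold tilt
  dsimp only
  refine ((spec_mergeSortAux _ (V.map fun x => s ⬝ᵥ x) le_rfl (by simpa using hV)).bind
    fun H₁ hH₁ => ((spec_minGap H₁ hH₁.2).time_le (t' := 4 * V.length)
      (by rw [hH₁.1.length_eq, List.length_map])).bind fun gap hgap => (spec_maxList _).bind
        fun M hM => (spec_minList _).bind fun m hm => (spec_sub M m).bind fun w hw =>
          (spec_add _ w).bind fun q hq => (spec_div _ q).bind fun p hp => (spec_div p 2).bind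
            fun ε hε => (spec_sub 1 ε).bind fun a ha => (spec_vcomb a s ε s').imp
              fun t ht => ?_).time_le ?_
  · rw [ht, ha, hε, hp, hq]
    have hH : ∀ x ∈ V, s ⬝ᵥ x ∈ H₁ := fun x hx =>
      hH₁.1.mem_iff.2 (List.mem_map_of_mem hx)
    simp only [List.mem_map, forall_exists_index, and_imp, forall_apply_eq_imp_iff₂] at hM hm
    refine isTilt_of_gap ?_ ?_ ?_ ?_
    · cases hg : gap with
      | none => exact one_pos
      | some g => exact hgap.1 g hg
    · obtain ⟨x, hx⟩ := List.exists_mem_of_ne_nil V hV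
      rw [hw]
      linarith [hM x hx, hm x hx]
    · intro x hx y hy h
      obtain ⟨g, hg, hle⟩ := hgap.2 _ (hH x hx) _ (hH y hy) h
      rw [hg]
      exact hle
    · intro x hx y hy
      rw [hw]
      linarith [hM x hx, hm y hy]
  · simp only [List.length_map]
    lia

/-! ### Directions orthogonal to affine hulls. -/

theorem spec_normalDirection {m n : ℕ} (hmn : m < n) (P : Fin m → Fin n → ℝ) (v : Fin n → ℝ) :
    Spec O Q (normalDirection P v)
      (m * (1 + n * 2) + m * (1 + m * (9 * n + 2)) + n * (4 * n + 1 + m * (9 * n + 2))) 0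
      fun r => r ≠ 0 ∧ ∀ i, r ⬝ᵥ P i = r ⬝ᵥ v := by
  unfold normalDirection
  refine ((spec_mapList_eq _ fun i _ => spec_vsub (P i) v).bind fun L hL =>
    ((spec_gramSchmidt L).time_le (t' := m * (1 + m * (9 * n + 2)))
      (by rw [hL, List.length_map, List.length_finRange])).bind fun B hB =>
        ((spec_orthogonalTo hB.1 (List.finRange n)).time_le
          (t' := n * (4 * n + 1 + m * (9 * n + 2)))
          (by rw [List.length_finRange, hB.2.1, hL, List.length_map, List.length_finRange])).imp
            (post' := fun r => r ≠ 0 ∧ ∀ i, r ⬝ᵥ P i = r ⬝ᵥ v) fun r hr => ?_).time_le ?_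
  · have hset : {b | b ∈ L} = Set.range fun i => P i - v := by
      ext b
      simp [hL]
    constructor
    · intro h0
      have htop : Submodule.span ℝ {b | b ∈ B} = ⊤ := by
        rw [eq_top_iff, ← (Pi.basisFun ℝ (Fin n)).span_eq, Submodule.span_le]
        rintro _ ⟨i, rfl⟩
        rw [Pi.basisFun_apply]
        exact hr.2 h0 i (List.mem_finRange i)
      rw [hB.2.2, hset] at htop
      -- Were the search to fail, the m differences would span the whole space of dimension n > m.
      have hle := finrank_range_le_card (R := ℝ) (fun i => P i - v)
      rw [Set.finrank, htop, finrank_top, Module.finrank_fin_fun, Fintype.card_fin] at hle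
      omega
    · intro i
      have hmem : P i - v ∈ Submodule.span ℝ {b | b ∈ B} := by
        rw [hB.2.2, hset]
        exact Submodule.subset_span ⟨i, rfl⟩
      have := dotProduct_eq_zero_of_mem_span hr.1 hmem
      rw [dotProduct_sub] at this
      linarith
  · rw [List.length_finRange]
    lia

theorem sub_notMem_span_of_affineIndependent {m n : ℕ} {P : Fin m → Fin n → ℝ}
    (hP : AffineIndependent ℝ P) {i₀ j : Fin m} (hj : j ≠ i₀) {S : Set (Fin m)}
    (hS : ∀ i ∈ S, i ≠ i₀ ∧ i ≠ j) :
    P j - P i₀ ∉ Submodule.span ℝ ((fun i => P i - P i₀) '' S) := by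
  have h := (affineIndependent_iff_linearIndependent_vsub ℝ P i₀).1 hP
  have h' := h.notMem_span_image (s := {i | (i : Fin m) ∈ S}) (x := ⟨j, hj⟩)
    fun hjS => (hS j hjS).2 rfl
  refine fun hmem => h' ?_
  refine Submodule.span_mono ?_ hmem
  rintro _ ⟨i, hi, rfl⟩
  exact ⟨⟨i, (hS i hi).1⟩, hi, rfl⟩

/-- The summand for j is orthogonal to every difference P i − P i₀ with i in U except i = j, where
it is positive. After the loop, the sum is positive precisely on the differences with index outside
W. -/
theorem spec_secondDirection {m n : ℕ} {P : Fin m → Fin n → ℝ} (hP : AffineIndependent ℝ P)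
    (U W : Finset (Fin m)) (hW : W.Nonempty) (hWU : W ⊆ U) :
    Spec O Q (secondDirection P U W)
      ((m + n) + m * (2 + m + m * (1 + n * 2) + m * (1 + m * (9 * n + 2)) + 4 * n
        + m * (9 * n + 2))) 0 fun s =>
      (∀ i ∈ W, ∀ j ∈ W, s ⬝ᵥ P i = s ⬝ᵥ P j) ∧
        ∀ i ∈ W, ∀ j ∈ U, j ∉ W → s ⬝ᵥ P i < s ⬝ᵥ P j := by
  unfold secondDirection
  refine (spec_steps (m + n)).bind fun _ _ => ?_
  obtain ⟨i₀, tl, htl⟩ := List.exists_cons_of_ne_nil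
    (show W.toList ≠ [] by simpa using hW.ne_empty)
  have hi₀ : i₀ ∈ W := by
    rw [← Finset.mem_toList, htl]
    simp
  rw [htl]
  have hnd := Finset.nodup_toList (U \ W)
  have hmem : ∀ i, i ∈ (U \ W).toList → i ∈ U ∧ i ∉ W := fun i hi => by simpa using hi
  have hlen : (U \ W).toList.length ≤ m := by
    rw [Finset.length_toList]
    simpa using Finset.card_le_univ (U \ W)
  refine (spec_foldList_const (t := 1 + m + m * (1 + n * 2) + m * (1 + m * (9 * n + 2)) + 4 * n
    + m * (9 * n + 2)) (fun l s => ∀ i ∈ U, (i ∈ l → 0 < s ⬝ᵥ (P i - P i₀)) ∧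
      (i ∉ l → s ⬝ᵥ (P i - P i₀) = 0)) (by simp) ?_).mono ?_ le_rfl ?_
  · intro l₁ j l₂ s hl hs
    have hjl : j ∉ l₁ := by
      rw [hl] at hnd
      intro h
      exact (List.nodup_append.1 hnd).2.2 j h j (by simp) rfl
    have hj := hmem j (by rw [hl]; simp)
    have hji₀ : j ≠ i₀ := fun h => hj.2 (h ▸ hi₀)
    have hcard : ((U.erase i₀).erase j).toList.length ≤ m := by
      rw [Finset.length_toList]
      simpa using Finset.card_le_univ ((U.erase i₀).erase j)
    refine ((spec_steps m).bind fun _ _ => ((spec_mapList_eq _ fun i _ =>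
      spec_vsub (P i) (P i₀)).time_le (t' := m * (1 + n * 2))
        (Nat.mul_le_mul_right _ hcard)).bind fun L hL =>
      ((spec_gramSchmidt L).time_le (t' := m * (1 + m * (9 * n + 2))) ?_).bind fun B hB =>
      (spec_vsub (P j) (P i₀)).bind fun x hx =>
      ((spec_reject hB.1 x).time_le (t' := m * (9 * n + 2)) ?_).bind fun r hr =>
      (spec_vadd s r).imp (post' := fun s => ∀ i ∈ U, (i ∈ l₁ ++ [j] →
        0 < s ⬝ᵥ (P i - P i₀)) ∧ (i ∉ l₁ ++ [j] → s ⬝ᵥ (P i - P i₀) = 0))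
          fun s' hs' => ?_).time_le ?_
    · rw [hL, List.length_map]
      gcongr
    · rw [hB.2.1, hL, List.length_map]
      gcongr
    · have hset : {b | b ∈ L}
          = (fun i => P i - P i₀) '' ↑((U.erase i₀).erase j) := by
        ext b
        simp only [hL, List.mem_map, Finset.mem_toList, Set.mem_ofPred_eq, Set.mem_image,
          Finset.mem_coe]
      obtain ⟨hr1, hr2⟩ := hr
      rw [hB.2.2, hset] at hr2
      have horth : ∀ y ∈ Submodule.span ℝ ((fun i => P i - P i₀) '' ↑((U.erase i₀).erase j)),
          r ⬝ᵥ y = 0 := by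
        intro y hy
        rw [← hset, ← hB.2.2] at hy
        exact dotProduct_eq_zero_of_mem_span hr1 hy
      -- As r is orthogonal to x − r, the product with x = P j − P i₀ equals r · r; affine
      -- independence excludes r = 0.
      have hrj : 0 < r ⬝ᵥ (P j - P i₀) := by
        have hne : r ≠ 0 := by
          rintro rfl
          rw [sub_zero, hx] at hr2
          refine sub_notMem_span_of_affineIndependent hP hji₀ ?_ hr2
          intro i hi
          simp only [Finset.coe_erase, Set.mem_sdiff, Set.mem_singleton_iff] at hi
          exact ⟨hi.1.2, hi.2⟩
        have h1 := horth _ hr2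
        rw [dotProduct_sub, hx] at h1
        have h2 : 0 ≤ r ⬝ᵥ r := Finset.sum_nonneg fun i _ => mul_self_nonneg _
        have h3 : r ⬝ᵥ r ≠ 0 := fun h => hne (dotProduct_self_eq_zero.1 h)
        have h4 := lt_of_le_of_ne h2 h3.symm
        linarith
      have hri : ∀ i ∈ U, i ≠ j → r ⬝ᵥ (P i - P i₀) = 0 := by
        intro i hi hij
        by_cases h : i = i₀
        · rw [h]
          simp
        · exact horth _ (Submodule.subset_span ⟨i, by simp [hi, hij, h], rfl⟩)
      intro i hi
      rw [hs', add_dotProduct]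
      by_cases hij : i = j
      · subst hij
        refine ⟨fun _ => ?_, fun h => absurd (by simp) h⟩
        rw [(hs i hi).2 hjl, zero_add]
        exact hrj
      · rw [hri i hi hij, add_zero]
        simpa [hij] using hs i hi
    · lia
  · calc _ ≤ m * (1 + (1 + m + m * (1 + n * 2) + m * (1 + m * (9 * n + 2)) + 4 * n
        + m * (9 * n + 2))) := Nat.mul_le_mul_right _ hlen
      _ = _ := by ring
  · intro s hs
    have h1 : ∀ i ∈ W, s ⬝ᵥ P i = s ⬝ᵥ P i₀ := by
      intro i hi
      have := (hs i (hWU hi)).2 fun h => (hmem i h).2 hi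
      rw [dotProduct_sub] at this
      linarith
    refine ⟨fun i hi j hj => (h1 i hi).trans (h1 j hj).symm, fun i hi j hj hjW => ?_⟩
    have := (hs j hj).1 (by simp [hj, hjW])
    rw [dotProduct_sub] at this
    linarith [h1 i hi]

/-! #### Counting points of diagrams -/

theorem spec_countBirths (c : ℝ) (Δ : List DiagramPoint) :
    Spec O Q (countBirths c Δ) (Δ.length * 2) 0 fun n =>
      n = ((Δ : Multiset DiagramPoint).countP fun p => p.1 = c : ℕ) := by
  unfold countBirths
  refine (spec_foldList_const (t := 1) (fun (l : List DiagramPoint) (n : ℤ) =>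
    n = ((l : Multiset DiagramPoint).countP fun p => p.1 = c : ℕ)) (by simp) ?_).time_le (by lia)
  rintro l₁ p l₂ n - rfl
  refine (spec_compare p.1 c).bind (t' := 0) fun o ho => ?_
  have hne : p.1 ≠ c → Spec O Q (pure ((Multiset.countP (fun p => p.1 = c)
      (l₁ : Multiset DiagramPoint) : ℕ) : ℤ)) 0 0 fun n : ℤ => n = (Multiset.countP
        (fun p => p.1 = c) ((l₁ ++ [p] : List DiagramPoint) : Multiset DiagramPoint) : ℕ) :=
    fun h => spec_pure (by simp [List.countP_append, h])
  match o, ho with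
  | .eq, ho => exact spec_pure (by simp [List.countP_append, (cmp_eq_eq_iff _ _).1 ho.symm])
  | .lt, ho => exact hne ((cmp_eq_lt_iff _ _).1 ho.symm).ne
  | .gt, ho => exact hne (ne_of_gt ((cmp_eq_gt_iff _ _).1 ho.symm))

theorem spec_countDeaths (c : ℝ) (Δ : List DiagramPoint) :
    Spec O Q (countDeaths c Δ) (Δ.length * 2) 0 fun n =>
      n = ((Δ : Multiset DiagramPoint).countP fun p => p.2 = (c : WithTop ℝ) : ℕ) := by
  unfold countDeaths
  refine (spec_foldList_const (t := 1) (fun (l : List DiagramPoint) (n : ℤ) =>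
    n = ((l : Multiset DiagramPoint).countP fun p => p.2 = (c : WithTop ℝ) : ℕ)) (by simp) ?_).time_le (by lia)
  rintro l₁ p l₂ n - rfl
  have hne : p.2 ≠ (c : WithTop ℝ) → Spec O Q (pure ((Multiset.countP
      (fun p => p.2 = (c : WithTop ℝ)) (l₁ : Multiset DiagramPoint) : ℕ) : ℤ)) 0 0 fun n : ℤ =>
        n = (Multiset.countP (fun p => p.2 = (c : WithTop ℝ))
          ((l₁ ++ [p] : List DiagramPoint) : Multiset DiagramPoint) : ℕ) :=
    fun h => spec_pure (by simp [List.countP_append, h])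
  obtain ⟨a, b⟩ := p
  match b with
  | none => exact (hne (WithTop.top_ne_coe)).time_le (Nat.zero_le _)
  | some b =>
    have hb : ((some b : WithTop ℝ) = (c : WithTop ℝ)) ↔ b = c := WithTop.coe_inj
    refine (spec_compare b c).bind (t' := 0) fun o ho => ?_
    match o, ho with
    | .eq, ho =>
      have := hb.2 ((cmp_eq_eq_iff _ _).1 ho.symm)
      exact spec_pure (by simp [List.countP_append, this])
    | .lt, ho => exact hne fun h => ((cmp_eq_lt_iff _ _).1 ho.symm).ne (hb.1 h)
    | .gt, ho => exact hne fun h => (ne_of_gt ((cmp_eq_gt_iff _ _).1 ho.symm)) (hb.1 h)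

theorem spec_heightOf {m n : ℕ} (P : Fin m → Fin n → ℝ) {U : Finset (Fin m)} (hU : U.Nonempty)
    (s : Fin n → ℝ) {c : ℝ} (h : ∀ i ∈ U, s ⬝ᵥ P i = c) :
    Spec O Q (heightOf P U s) (m + n * 3) 0 fun x => x = c := by
  unfold heightOf
  refine (spec_steps m).bind fun _ _ => ?_
  obtain ⟨i₀, tl, htl⟩ := List.exists_cons_of_ne_nil
    (show U.toList ≠ [] by simpa using hU.ne_empty)
  have hi₀ : i₀ ∈ U := by
    rw [← Finset.mem_toList, htl]
    simp
  rw [htl]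
  exact (spec_dot s (P i₀)).imp fun x hx => hx.trans (h i₀ hi₀)

/-! #### Faces in the order of increasing dimension -/

theorem mem_properFaces {m : ℕ} {U W : Finset (Fin m)} :
    W ∈ properFaces U ↔ W ⊂ U ∧ W.Nonempty := by
  simp only [properFaces, List.mem_flatMap, List.mem_range'_1, Finset.mem_toList,
    Finset.mem_powersetCard]
  constructor
  · rintro ⟨j, hj, hWU, rfl⟩
    refine ⟨hWU.ssubset_of_ne ?_, Finset.card_pos.1 (by omega)⟩
    rintro rfl
    omega
  · rintro ⟨hWU, hW⟩
    have h1 := Finset.card_lt_card hWU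
    have h2 := Finset.card_pos.2 hW
    exact ⟨W.card, by omega, hWU.subset, rfl⟩

theorem pairwise_properFaces {m : ℕ} (U : Finset (Fin m)) :
    (properFaces U).Pairwise fun W W' => W.card ≤ W'.card := by
  refine List.pairwise_flatMap.2 ⟨fun j _ => ?_, ?_⟩
  · refine List.pairwise_of_forall_mem_list fun W hW W' hW' => ?_
    simp only [Finset.mem_toList, Finset.mem_powersetCard] at hW hW'
    omega
  · refine List.Pairwise.imp ?_ List.pairwise_lt_range'
    intro j j' hj W hW W' hW'
    simp only [Finset.mem_toList, Finset.mem_powersetCard] at hW hW'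
    omega

theorem nodup_properFaces {m : ℕ} (U : Finset (Fin m)) : (properFaces U).Nodup := by
  refine List.nodup_flatMap.2 ⟨fun j _ => Finset.nodup_toList _, ?_⟩
  refine List.Pairwise.imp ?_ List.pairwise_lt_range'
  intro j j' hj W hW hW'
  simp only [Finset.mem_toList, Finset.mem_powersetCard] at hW hW'
  omega

theorem toFinset_properFaces {m : ℕ} (U : Finset (Fin m)) :
    (properFaces U).toFinset = (U.powerset.erase ∅).erase U := by
  ext W
  simp only [List.mem_toFinset, mem_properFaces, Finset.mem_erase, Finset.mem_powerset,
    Finset.ssubset_iff_subset_ne, Finset.nonempty_iff_ne_empty]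
  tauto

theorem length_properFaces {m : ℕ} {U : Finset (Fin m)} (hU : U.Nonempty) :
    (properFaces U).length = 2 ^ U.card - 2 := by
  rw [← List.toFinset_card_of_nodup (nodup_properFaces U), toFinset_properFaces,
    Finset.card_erase_of_mem (by simp [hU.ne_empty]), Finset.card_erase_of_mem (by simp),
    Finset.card_powerset]
  omega

theorem length_properFaces_le {m : ℕ} (U : Finset (Fin m)) :
    (properFaces U).length ≤ 2 ^ U.card := by
  rw [← List.toFinset_card_of_nodup (nodup_properFaces U), toFinset_properFaces,
    ← Finset.card_powerset]
  exact Finset.card_le_card ((Finset.erase_subset _ _).trans (Finset.erase_subset _ _))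

/-- By the binomial theorem the sum of 2^|W| over all subsets W is 3^|U|. This bounds the table
lookups in all nested calls together. -/
theorem sum_length_properFaces_le {m : ℕ} (U : Finset (Fin m)) :
    ((properFaces U).map fun W => (properFaces W).length).sum ≤ 3 ^ U.card := by
  rw [← List.sum_toFinset _ (nodup_properFaces U), toFinset_properFaces]
  have h := Finset.sum_pow_mul_eq_add_pow 2 1 U
  simp only [one_pow, mul_one] at h
  calc _ ≤ ∑ W ∈ (U.powerset.erase ∅).erase U, 2 ^ W.card :=
        Finset.sum_le_sum fun W _ => length_properFaces_le W
    _ ≤ ∑ W ∈ U.powerset, 2 ^ W.card :=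
        Finset.sum_le_sum_of_subset ((Finset.erase_subset _ _).trans (Finset.erase_subset _ _))
    _ = 3 ^ U.card := h

/-- Because the list is ordered by cardinality, all proper faces of W have been processed when W is
reached, and W itself has not. -/
theorem properFaces_split {m : ℕ} {U W : Finset (Fin m)} {l₁ l₂ : List (Finset (Fin m))}
    (h : properFaces U = l₁ ++ W :: l₂) :
    W ∉ l₁ ∧ W ∈ properFaces U ∧ ∀ W' ∈ properFaces W, W' ∈ l₁ := by
  have hW : W ∈ properFaces U := by
    rw [h]
    simp
  refine ⟨fun hmem => ?_, hW, fun W' hW' => ?_⟩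
  · have := nodup_properFaces U
    rw [h] at this
    exact (List.nodup_append.1 this).2.2 W hmem W (by simp) rfl
  · obtain ⟨hss, hne⟩ := mem_properFaces.1 hW'
    have hmem : W' ∈ properFaces U :=
      mem_properFaces.2 ⟨hss.trans (mem_properFaces.1 hW).1, hne⟩
    rw [h] at hmem
    rcases List.mem_append.1 hmem with hmem | hmem
    · exact hmem
    rcases List.mem_cons.1 hmem with rfl | hmem
    · exact absurd hss (ssubset_irrefl _)
    · have hp := pairwise_properFaces U
      rw [h] at hp
      have h1 := (List.pairwise_cons.1 (List.pairwise_append.1 hp).2.1).1 W' hmem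
      have h2 := Finset.card_lt_card hss
      omega

/-! #### Counting simplices below a face -/

/-- The number of `k`-simplices of `F` that contain exactly the points `P i`, `i ∈ W`, among the
points `P i`, and whose other vertices are below `c` in direction `s`. -/
noncomputable def traceCount {m : ℕ} (F : Set (Finset (Fin D → ℝ))) (k : ℕ)
    (P : Fin m → Fin D → ℝ) (s : Fin D → ℝ) (c : ℝ) (W : Finset (Fin m)) : ℕ :=
  {X ∈ F | X.card = k + 1 ∧ (∀ i, P i ∈ X ↔ i ∈ W) ∧
    ∀ x ∈ X, x ∉ Set.range P → s ⬝ᵥ x < c}.ncard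

/-- In direction `t`, the points `P i`, `i ∈ W`, have height `a`, the other points `P i` are above
them, and all other points of `V` are below or above height `a` as they are below or above height
`c` in direction `s`. -/
structure IsLevel {m : ℕ} (V : List (Fin D → ℝ)) (P : Fin m → Fin D → ℝ) (s : Fin D → ℝ) (c : ℝ)
    (W : Finset (Fin m)) (t : Fin D → ℝ) (a : ℝ) : Prop where
  eq : ∀ i ∈ W, t ⬝ᵥ P i = a
  above : ∀ i, i ∉ W → a < t ⬝ᵥ P i
  lt : ∀ x ∈ V, x ∉ Set.range P → s ⬝ᵥ x < c → t ⬝ᵥ x < a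
  gt : ∀ x ∈ V, x ∉ Set.range P → c < s ⬝ᵥ x → a < t ⬝ᵥ x

theorem starHeight_eq_iff {t : Fin D → ℝ} {X : Finset (Fin D → ℝ)} (hX : X.Nonempty) {a : ℝ} :
    starHeight t X = a ↔ (∀ x ∈ X, t ⬝ᵥ x ≤ a) ∧ ∃ x ∈ X, t ⬝ᵥ x = a := by
  rw [starHeight, dif_pos hX]
  constructor
  · rintro rfl
    refine ⟨fun x hx => Finset.le_sup' (fun x => t ⬝ᵥ x) hx, ?_⟩
    obtain ⟨x, hx, h⟩ := Finset.exists_mem_eq_sup' hX fun x => t ⬝ᵥ x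
    exact ⟨x, hx, h.symm⟩
  · rintro ⟨h1, x, hx, h2⟩
    refine le_antisymm (Finset.sup'_le _ _ h1) ?_
    rw [← h2]
    exact Finset.le_sup' (fun x => t ⬝ᵥ x) hx

open Classical in
/-- The simplices at the height of a face `W` are sorted by their faces among the `P i`. -/
theorem IsLevel.ncard_starHeight_eq {m : ℕ} {V : List (Fin D → ℝ)} {P : Fin m → Fin D → ℝ}
    {s : Fin D → ℝ} {c : ℝ} {W : Finset (Fin m)} {t : Fin D → ℝ} {a : ℝ}
    (h : IsLevel V P s c W t a) {F : Set (Finset (Fin D → ℝ))} (hF : F.Finite)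
    (hFV : ∀ X ∈ F, ∀ x ∈ X, x ∈ V) (hs : ∀ x ∈ V, x ∉ Set.range P → s ⬝ᵥ x ≠ c) (k : ℕ) :
    {X ∈ F | X.card = k + 1 ∧ starHeight t X = a}.ncard
      = ∑ W' ∈ W.powerset.erase ∅, traceCount F k P s c W' := by
  have hfin : {X ∈ F | X.card = k + 1 ∧ starHeight t X = a}.Finite := hF.subset fun X hX => hX.1
  -- The simplices at height a are classified by the set of indices i for which they contain P i.
  rw [Set.ncard_eq_toFinset_card _ hfin,
    Finset.card_eq_sum_card_fiberwise (f := fun X => Finset.univ.filter fun i => P i ∈ X)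
      (t := W.powerset.erase ∅)]
  · refine Finset.sum_congr rfl fun W' hW' => ?_
    rw [traceCount, ← Set.ncard_coe_finset]
    congr 1
    ext X
    simp only [Finset.coe_filter, Set.Finite.mem_toFinset, Set.mem_ofPred_eq]
    have htr : (Finset.univ.filter fun i => P i ∈ X) = W' ↔ ∀ i, P i ∈ X ↔ i ∈ W' := by
      simp [Finset.ext_iff]
    rw [htr]
    obtain ⟨hne, hWW⟩ := Finset.mem_erase.1 hW'
    rw [Finset.mem_powerset] at hWW
    constructor
    · rintro ⟨⟨hXF, hc, hst⟩, hX⟩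
      refine ⟨hXF, hc, hX, fun x hx hxP => ?_⟩
      have hxV := hFV X hXF x hx
      have hle := ((starHeight_eq_iff (Finset.card_pos.1 (by omega))).1 hst).1 x hx
      rcases lt_trichotomy (s ⬝ᵥ x) c with h' | h' | h'
      · exact h'
      · exact absurd h' (hs x hxV hxP)
      · exact absurd (h.gt x hxV hxP h') (not_lt.2 hle)
    · rintro ⟨hXF, hc, hX, hlow⟩
      refine ⟨⟨hXF, hc, (starHeight_eq_iff (Finset.card_pos.1 (by omega))).2 ⟨?_, ?_⟩⟩, hX⟩
      · intro x hx
        by_cases hxP : x ∈ Set.range P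
        · obtain ⟨i, rfl⟩ := hxP
          exact (h.eq i (hWW ((hX i).1 hx))).le
        · exact (h.lt x (hFV X hXF x hx) hxP (hlow x hx hxP)).le
      · obtain ⟨i, hi⟩ := Finset.nonempty_iff_ne_empty.2 hne
        exact ⟨P i, (hX i).2 hi, h.eq i (hWW hi)⟩
  · intro X hX
    simp only [Set.Finite.coe_toFinset, Set.mem_ofPred_eq] at hX
    obtain ⟨hXF, hc, hst⟩ := hX
    obtain ⟨h1, x, hx, h2⟩ := (starHeight_eq_iff (Finset.card_pos.1 (by omega))).1 hst
    simp only [Finset.coe_erase, Set.mem_sdiff, Finset.mem_coe, Finset.mem_powerset,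
      Set.mem_singleton_iff]
    constructor
    · intro i hi
      by_contra hiW
      exact absurd (h.above i hiW) (not_lt.2 (h1 _ (Finset.mem_filter.1 hi).2))
    -- That set of indices is nonempty: a highest vertex has height a exactly, and no vertex outside
    -- the range of P does.
    · have hxV := hFV X hXF x hx
      have hxP : x ∈ Set.range P := by
        by_contra hxP
        rcases lt_trichotomy (s ⬝ᵥ x) c with h' | h' | h'
        · exact absurd h2 (h.lt x hxV hxP h').ne
        · exact absurd h' (hs x hxV hxP)
        · exact absurd h2 (ne_of_gt (h.gt x hxV hxP h'))
      obtain ⟨i, rfl⟩ := hxP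
      exact Finset.ne_empty_of_mem (Finset.mem_filter.2 ⟨Finset.mem_univ i, hx⟩)

/-- The oracle `O` yields the numbers of `k`-simplices of `F` at every height, from two lists of at
most `N` points together. -/
structure CountsSimplices (O : Oracle D) (F : Set (Finset (Fin D → ℝ))) (k N : ℕ) : Prop where
  count : ∀ t, t ≠ 0 → ∀ a : ℝ,
    ((O t (k - 1) : Multiset DiagramPoint).countP fun p => p.2 = (a : WithTop ℝ))
      + ((O t k : Multiset DiagramPoint).countP fun p => p.1 = a)
      = {X ∈ F | X.card = k + 1 ∧ starHeight t X = a}.ncard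
  length_le : ∀ t, t ≠ 0 → (O t (k - 1)).length + (O t k).length ≤ N

/-- Two queries in the same direction use one diagram. -/
theorem Spec.ask_ask {β : Type} {s : Fin D → ℝ} {i j t n : ℕ}
    {f : List DiagramPoint → List DiagramPoint → Prog D β} {post : β → Prop}
    (h : Spec O Q (f (O s i) (O s j)) t n post) :
    Spec O Q (ask s i >>= fun low => ask s j >>= fun high => f low high)
      (2 * (Q + 1) + t) (1 + n) post := by
  have hd : ∀ i, (ask s i : Prog D _).directions O = {s} := fun i => by simp [ask, Prog.directions]
  have hr : ∀ i, (ask s i : Prog D _).result O = O s i := fun i => rfl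
  have ht : ∀ i, (ask s i : Prog D _).time O Q = Q + 1 := fun i => by simp [ask, Prog.time]
  refine ⟨?_, ?_, ?_⟩
  · rw [result_bind, result_bind, hr, hr]
    exact h.result
  · rw [time_bind, time_bind, hr, hr, ht, ht]
    have := h.time
    omega
  · rw [directions_bind, directions_bind, hr, hr, hd, hd, ← Set.union_assoc, Set.union_self]
    refine (Set.encard_union_le _ _).trans ?_
    rw [Set.encard_singleton]
    push_cast
    exact add_le_add le_rfl h.directions

/-! ### The indegree program and its table. -/

section Indegree

variable {m : ℕ} {V : List (Fin D → ℝ)} {P : Fin m → Fin D → ℝ} {s : Fin D → ℝ} {c : ℝ}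
  {F : Set (Finset (Fin D → ℝ))} {k N : ℕ}

/-- The sum over the values of the proper faces completes the value of `W` to the number of
simplices at the height of `W`. -/
theorem sum_powerset_erase_empty (M : Finset (Fin m) → ℕ) {W : Finset (Fin m)}
    (hW : W.Nonempty) : ∑ W' ∈ W.powerset.erase ∅, M W'
      = M W + ((properFaces W).map M).sum := by
  rw [← List.sum_toFinset _ (nodup_properFaces W), toFinset_properFaces]
  exact (Finset.add_sum_erase _ _ (by simp [hW.ne_empty])).symm

/-- The part of the indegree program that follows the loop over the faces. -/
theorem spec_indegree_of_loop {W : Finset (Fin m)} (hW : W.Nonempty) {t : Fin D → ℝ} {a : ℝ}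
    (ht : t ≠ 0) (hlev : IsLevel V P s c W t a) (hF : F.Finite)
    (hFV : ∀ X ∈ F, ∀ x ∈ X, x ∈ V) (hs : ∀ x ∈ V, x ∉ Set.range P → s ⬝ᵥ x ≠ c)
    (hO : CountsSimplices O F k N) {T : Table m} {time n : ℕ} {post : Table m → Prop}
    {f : ℤ × Table m → Finset (Fin m) → Prog D (ℤ × Table m)}
    (hloop : Spec O Q (foldList f (0, T) (properFaces W)) time n fun r =>
      r.1 = (((properFaces W).map (traceCount F k P s c)).sum : ℕ) ∧ post r.2) :
    Spec O Q (do
      let low ← ask t (k - 1)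
      let high ← ask t k
      let c ← heightOf P W t
      let numDeaths ← countDeaths c low
      let numBirths ← countBirths c high
      let x ← foldList f (0, T) (properFaces W)
      steps 2
      return (numDeaths + numBirths - x.1, x.2))
      (2 * (Q + 1) + (m + D * 3 + (2 * N + (time + 2)))) (1 + n) fun r =>
        r.1 = traceCount F k P s c W ∧ post r.2 := by
  refine (Spec.ask_ask ((spec_heightOf P hW t hlev.eq).bind fun a' ha' =>
    (spec_countDeaths a' _).bind fun nd hnd => (spec_countBirths a' _).bind fun nb hnb =>
      (hloop.bind' fun x hx => (spec_steps 2).bind (n := 0) fun _ _ => spec_pure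
        (a := (nd + nb - x.1, x.2)) (post := fun r : ℤ × Table m =>
          r.1 = traceCount F k P s c W ∧ post r.2) ⟨?_, hx.2⟩))).time_le ?_
  · subst ha' hnd hnb
    dsimp only
    rw [hx.1]
    have h1 := hO.count t ht a'
    rw [hlev.ncard_starHeight_eq hF hFV hs, sum_powerset_erase_empty _ hW] at h1
    omega
  · have := hO.length_le t ht
    omega

end Indegree

section Indegree

variable {m : ℕ} {V : List (Fin D → ℝ)} {P : Fin m → Fin D → ℝ} {s : Fin D → ℝ} {c : ℝ}
  {F : Set (Finset (Fin D → ℝ))} {k N : ℕ}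

/-- A call for which the values of all proper faces are in the table. -/
theorem spec_indegree_of_table {W : Finset (Fin m)} (hW : W.Nonempty) {t : Fin D → ℝ} {a : ℝ}
    (ht : t ≠ 0) (hlev : IsLevel V P s c W t a) (hF : F.Finite)
    (hFV : ∀ X ∈ F, ∀ x ∈ X, x ∈ V) (hs : ∀ x ∈ V, x ∉ Set.range P → s ⬝ᵥ x ≠ c)
    (hO : CountsSimplices O F k N) {T : Table m}
    (hT : ∀ W' ∈ properFaces W, T W' = some (traceCount F k P s c W' : ℤ)) (depth : ℕ) :
    Spec O Q (indegree V P k (depth + 1) W t T)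
      (2 * (Q + 1) + (m + D * 3 + (2 * N + ((properFaces W).length * (m + 2) + 2)))) 1
      fun r => r = ((traceCount F k P s c W : ℤ), T) := by
  unfold indegree
  dsimp only
  refine (spec_indegree_of_loop (n := 0) (post := fun T' => T' = T) hW ht hlev hF hFV hs hO
    ?_).imp fun r hr => Prod.ext_iff.2 hr
  refine (spec_foldList_const (t := m + 1) (fun l (r : ℤ × Table m) =>
    r.1 = ((l.map (traceCount F k P s c)).sum : ℕ) ∧ r.2 = T) ⟨by simp, rfl⟩ ?_).time_le
      (le_of_eq (by ring))
  rintro l₁ W' l₂ ⟨x, T'⟩ hl ⟨hx, hT'⟩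
  dsimp only at hx hT' ⊢
  subst hx hT'
  refine (spec_steps (m + 1)).bind (t' := 0) fun _ _ => ?_
  rw [hT W' (by rw [hl]; simp)]
  exact spec_pure ⟨by simp, rfl⟩

/-- The P i are level in direction s, so the tilt orders them as s' does. A vertex strictly below or
above c in direction s keeps its side, because a tilt preserves strict inequalities. -/
theorem isLevel_of_isTilt (hPV : ∀ i, P i ∈ V) (hsc : ∀ i, s ⬝ᵥ P i = c) {W : Finset (Fin m)}
    {s' t : Fin D → ℝ} (ht : IsTilt V s s' t) {i₀ : Fin m} (hi₀ : i₀ ∈ W)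
    (hs'eq : ∀ i ∈ W, ∀ j ∈ W, s' ⬝ᵥ P i = s' ⬝ᵥ P j)
    (hs'lt : ∀ i ∈ W, ∀ j ∉ W, s' ⬝ᵥ P i < s' ⬝ᵥ P j) :
    IsLevel V P s c W t (t ⬝ᵥ P i₀) where
  eq i hi := ht.eq_of_eq _ (hPV i) _ (hPV i₀) ((hsc i).trans (hsc i₀).symm) (hs'eq i hi i₀ hi₀)
  above j hj := ht.lt_of_eq _ (hPV i₀) _ (hPV j) ((hsc i₀).trans (hsc j).symm)
    (hs'lt i₀ hi₀ j hj)
  lt x hx _ hxc := ht.lt_of_lt _ hx _ (hPV i₀) (by rwa [hsc i₀])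
  gt x hx _ hxc := ht.lt_of_lt _ (hPV i₀) _ hx (by rwa [hsc i₀])

/-- The time for a new face, apart from the recursive call, is at most `faceTime`. -/
def faceTime (m D n : ℕ) : ℕ :=
  (m + 1) + ((m + D) + m * (2 + m + m * (1 + D * 2) + m * (1 + m * (9 * D + 2)) + 4 * D
    + m * (9 * D + 2))) + 2 * (n * (1 + D * 3))
    + (6 * n * Nat.clog 2 n + 8 * n + 4 * D + 7) + 1

/-- The call of the indegree program for the top simplex, with an empty table. -/
theorem spec_indegree (hm : 0 < m) (hPV : ∀ i, P i ∈ V) (hP : AffineIndependent ℝ P)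
    (hs0 : s ≠ 0) (hsc : ∀ i, s ⬝ᵥ P i = c) (hF : F.Finite)
    (hFV : ∀ X ∈ F, ∀ x ∈ X, x ∈ V) (hs : ∀ x ∈ V, x ∉ Set.range P → s ⬝ᵥ x ≠ c)
    (hO : CountsSimplices O F k N) :
    Spec O Q (indegree V P k m Finset.univ s fun _ => none)
      (2 ^ m * (2 * (Q + 1) + (m + D * 3 + 2 * N + 4) + faceTime m D V.length)
        + 3 ^ m * (m + 2)) (2 ^ m - 1) fun r => r.1 = traceCount F k P s c Finset.univ := by
  suffices key : ∀ depth, m = depth + 1 → Spec O Q (indegree V P k (depth + 1) Finset.univ s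
      fun _ => none) (2 ^ m * (2 * (Q + 1) + (m + D * 3 + 2 * N + 4) + faceTime m D V.length)
        + 3 ^ m * (m + 2)) (2 ^ m - 1) fun r => r.1 = traceCount F k P s c Finset.univ by
    have h := key (m - 1) (by omega)
    rwa [Nat.sub_add_cancel hm] at h
  intro depth hm'
  have huniv : (Finset.univ : Finset (Fin m)).Nonempty := ⟨⟨0, hm⟩, Finset.mem_univ _⟩
  have hlevel : IsLevel V P s c Finset.univ s c :=
    ⟨fun i _ => hsc i, fun i hi => absurd (Finset.mem_univ i) hi, fun _ _ _ => id,
      fun _ _ _ => id⟩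
  have hV : V ≠ [] := List.ne_nil_of_mem (hPV ⟨0, hm⟩)
  -- A bounds the cost of one new face apart from the table lookups of its nested call.
  set A := 2 * (Q + 1) + (m + D * 3 + 2 * N + 2) + faceTime m D V.length with hA
  have hloop : Spec O Q (foldList (fun (acc : ℤ × Table m) W => do
        steps (m + 1)
        match acc.2 W with
        | some t => return (acc.1 + t, acc.2)
        | none => do
            let s' ← secondDirection P Finset.univ W
            let H ← heights V s
            let H' ← heights V s'
            let s_t ← tilt s s' H H'
            let x ← indegree V P k depth W s_t acc.2
            steps 1
            return (acc.1 + x.1, Function.update x.2 W (some x.1))) (0, fun _ => none)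
              (properFaces Finset.univ))
      ((properFaces (Finset.univ : Finset (Fin m))).map fun W =>
        1 + (A + (properFaces W).length * (m + 2))).sum
      ((properFaces (Finset.univ : Finset (Fin m))).length * 1) fun r =>
        r.1 = (((properFaces (Finset.univ : Finset (Fin m))).map
          (traceCount F k P s c)).sum : ℕ) ∧ True := by
    -- Invariant: the table holds the correct values of exactly the processed faces, so the current
    -- face is always missing and its proper faces are always present.
    refine (spec_foldList (t := fun W => A + (properFaces W).length * (m + 2))
      (fun l (r : ℤ × Table m) => r.1 = ((l.map (traceCount F k P s c)).sum : ℕ) ∧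
        ∀ W, r.2 W = if W ∈ l then some (traceCount F k P s c W : ℤ) else none)
        ⟨by simp, by simp⟩ ?_).imp fun r hr => ⟨hr.1, trivial⟩
    rintro l₁ W l₂ ⟨x, T⟩ hl ⟨hx, hT⟩
    dsimp only at hx hT ⊢
    obtain ⟨hWl, hWU, hfaces⟩ := properFaces_split hl
    obtain ⟨hss, hW⟩ := mem_properFaces.1 hWU
    obtain ⟨i₀, hi₀⟩ := hW
    obtain ⟨j₀, -, hj₀⟩ := Finset.exists_of_ssubset hss
    -- A nonempty proper face requires m ≥ 2, so recursion depth is left; a single nested level is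
    -- all that is ever used.
    obtain ⟨depth', rfl⟩ : ∃ depth', depth = depth' + 1 := by
      refine ⟨depth - 1, ?_⟩
      have h1 := Finset.card_lt_card hss
      have h2 := Finset.card_pos.2 ⟨i₀, hi₀⟩
      rw [Finset.card_univ, Fintype.card_fin] at h1
      omega
    refine ((spec_steps (m + 1)).bind fun _ _ => (?_ : Spec O Q _ (A - (m + 1)
      + (properFaces W).length * (m + 2)) 1 _)).time_le ?_
    · rw [hT W, if_neg hWl]
      dsimp only
      refine ((spec_secondDirection hP Finset.univ W ⟨i₀, hi₀⟩ (Finset.subset_univ W)).bind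
        fun s' hs' => (spec_heights V s).bind fun H hH => (spec_heights V s').bind fun H' hH' =>
        (?_ : Spec O Q _ ((6 * V.length * Nat.clog 2 V.length + 8 * V.length + 4 * D + 7)
          + ((2 * (Q + 1) + (m + D * 3 + (2 * N + ((properFaces W).length * (m + 2) + 2))))
            + 1)) 1 _)).time_le ?_
      · subst hH hH'
        refine (spec_tilt V hV s s').bind fun t ht => ?_
        have hlt : ∀ i ∈ W, ∀ j ∉ W, s' ⬝ᵥ P i < s' ⬝ᵥ P j :=
          fun i hi j hj => hs'.2 i hi j (Finset.mem_univ j) hj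
        have hlev := isLevel_of_isTilt hPV hsc ht hi₀ hs'.1 hlt
        -- Some P j outside W is strictly above W in direction t.
        have ht0 : t ≠ 0 := by
          rintro rfl
          have := hlev.above j₀ hj₀
          simp at this
        refine (spec_indegree_of_table ⟨i₀, hi₀⟩ ht0 hlev hF hFV hs hO ?_ depth').bind'
          fun r hr => (spec_steps 1).bind (t' := 0) fun _ _ => spec_pure ⟨?_, ?_⟩
        · intro W' hW'
          rw [hT, if_pos (hfaces W' hW')]
        · rw [hr, hx]
          simp
        · intro W'
          rw [hr]
          by_cases h : W' = W
          · subst h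
            simp
          · simp [hT, h]
      · rw [hA, faceTime]
        omega
    · rw [hA, faceTime]
      omega
  unfold indegree
  dsimp only
  refine (spec_indegree_of_loop (post := fun _ => True) huniv hs0 hlevel hF hFV hs hO
    hloop).mono ?_ ?_ fun r hr => hr.1
  · have h1 := sum_length_properFaces_le (Finset.univ : Finset (Fin m))
    have h2 := length_properFaces huniv
    rw [Finset.card_univ, Fintype.card_fin] at h1 h2
    -- There are 2^m − 2 proper faces, each with cost A + 1; the lookups are summed separately and
    -- bounded by 3^m.
    have h3 : ((properFaces (Finset.univ : Finset (Fin m))).map fun W =>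
        1 + (A + (properFaces W).length * (m + 2))).sum
        = (2 ^ m - 2) * (1 + A) + ((properFaces (Finset.univ : Finset (Fin m))).map fun W =>
          (properFaces W).length).sum * (m + 2) := by
      rw [← h2]
      simp only [← add_assoc, List.sum_map_add, List.sum_map_mul_right, List.map_const',
        List.sum_replicate, smul_eq_mul]
    rw [h3]
    have h4 := Nat.mul_le_mul_right (m + 2) h1
    have h5 : 2 ≤ 2 ^ m := by
      rw [hm', pow_succ]
      have := Nat.one_le_two_pow (n := depth)
      omega
    obtain ⟨b, hb⟩ := Nat.exists_eq_add_of_le h5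
    rw [hb, Nat.add_sub_cancel_left]
    have h6 : 2 * (Q + 1) + (m + D * 3 + 2 * N + 4) + faceTime m D V.length = 2 + A := by
      rw [hA]
      ring
    rw [h6]
    have h7 : 2 * (Q + 1) + (m + D * 3 + 2 * N + 2) ≤ A := by
      rw [hA]
      omega
    nlinarith
  -- One direction for each of the 2^m − 2 proper faces and one for the simplex itself.
  · have h2 := length_properFaces huniv
    rw [Finset.card_univ, Fintype.card_fin] at h2
    rw [h2]
    have h5 : 2 ≤ 2 ^ m := by
      rw [hm', pow_succ]
      have := Nat.one_le_two_pow (n := depth)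
      omega
    omega

end Indegree

/-! ### One vertex crossing the simplex, and the simplex predicate. -/

open Classical in
/-- If the point `v` moves from above to below the simplex with vertices `P i`, and no other point
crosses its height, then the number of cofacets below the simplex grows by one if `v` spans a
cofacet, and does not change otherwise. -/
theorem traceCount_eq_add {k : ℕ} {V : List (Fin D → ℝ)} {P : Fin k → Fin D → ℝ}
    (hP : Function.Injective P) {v : Fin D → ℝ} (hv : v ∉ Set.range P)
    {F : Set (Finset (Fin D → ℝ))} (hF : F.Finite) (hFV : ∀ X ∈ F, ∀ x ∈ X, x ∈ V)
    {s s' : Fin D → ℝ} {c c' : ℝ} (hs : s ⬝ᵥ v < c) (hs' : c' < s' ⬝ᵥ v)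
    (h : ∀ x ∈ V, x ∉ Set.range P → x ≠ v → (s ⬝ᵥ x < c ↔ s' ⬝ᵥ x < c')) :
    traceCount F k P s c Finset.univ = traceCount F k P s' c' Finset.univ
      + if insert v (Finset.univ.image P) ∈ F then 1 else 0 := by
  have hvi : v ∉ Finset.univ.image P := by simpa using hv
  have hcard : (insert v (Finset.univ.image P)).card = k + 1 := by
    rw [Finset.card_insert_of_notMem hvi, Finset.card_image_of_injective _ hP,
      Finset.card_univ, Fintype.card_fin]
  -- A simplex counted here has one vertex besides the P i. It is either v, which determines the
  -- simplex, or a point that lies on the same side in both directions.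
  have hU : {X ∈ F | X.card = k + 1 ∧ (∀ i, P i ∈ X ↔ i ∈ Finset.univ) ∧
      ∀ x ∈ X, x ∉ Set.range P → s ⬝ᵥ x < c}
      = {X ∈ F | X.card = k + 1 ∧ (∀ i, P i ∈ X ↔ i ∈ Finset.univ) ∧
        ∀ x ∈ X, x ∉ Set.range P → s' ⬝ᵥ x < c'}
      ∪ {X ∈ F | X = insert v (Finset.univ.image P)} := by
    ext X
    simp only [Finset.mem_univ, iff_true, Set.mem_union, Set.mem_ofPred_eq]
    constructor
    · rintro ⟨hXF, hc, hX, hlow⟩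
      by_cases hvX : v ∈ X
      · refine Or.inr ⟨hXF, (Finset.eq_of_subset_of_card_le ?_ (by omega)).symm⟩
        refine Finset.insert_subset hvX (Finset.image_subset_iff.2 fun i _ => hX i)
      · refine Or.inl ⟨hXF, hc, hX, fun x hx hxP => ?_⟩
        exact (h x (hFV X hXF x hx) hxP fun he => hvX (he ▸ hx)).1 (hlow x hx hxP)
    · rintro (⟨hXF, hc, hX, hlow⟩ | ⟨hXF, rfl⟩)
      · refine ⟨hXF, hc, hX, fun x hx hxP => ?_⟩
        refine (h x (hFV X hXF x hx) hxP ?_).2 (hlow x hx hxP)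
        rintro rfl
        exact absurd (hlow x hx hxP) (not_lt.2 hs'.le)
      · refine ⟨hXF, hcard, fun i => by simp, fun x hx hxP => ?_⟩
        rcases Finset.mem_insert.1 hx with rfl | hx
        · exact hs
        · exact absurd (by simpa using hx) hxP
  have hdisj : Disjoint {X ∈ F | X.card = k + 1 ∧ (∀ i, P i ∈ X ↔ i ∈ Finset.univ) ∧
        ∀ x ∈ X, x ∉ Set.range P → s' ⬝ᵥ x < c'}
      {X ∈ F | X = insert v (Finset.univ.image P)} := by
    rw [Set.disjoint_left]
    rintro X ⟨-, -, -, hlow⟩ ⟨-, rfl⟩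
    exact absurd (hlow v (by simp) hv) (not_lt.2 hs'.le)
  rw [traceCount, hU, Set.ncard_union_eq hdisj (hF.subset fun X hX => hX.1)
    (hF.subset fun X hX => hX.1), traceCount]
  congr 1
  split_ifs with hmem
  · rw [Set.ncard_eq_one]
    refine ⟨insert v (Finset.univ.image P), ?_⟩
    ext X
    simp only [Set.mem_ofPred_eq, Set.mem_singleton_iff]
    exact ⟨fun h => h.2, fun h => ⟨h ▸ hmem, h⟩⟩
  · have : {X ∈ F | X = insert v (Finset.univ.image P)} = ∅ := by
      ext X
      simp only [Set.mem_ofPred_eq, Set.mem_empty_iff_false, iff_false, not_and]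
      rintro hX rfl
      exact hmem hX
    rw [this, Set.ncard_empty]

/-- A bound for the time of the simplex predicate. -/
def simplexTime (k D n N Q : ℕ) : ℕ :=
  (k * (1 + D * 2) + k * (1 + k * (9 * D + 2)) + D * (4 * D + 1 + k * (9 * D + 2)))
    + 5 * (n * (1 + D * 3)) + 3 * (6 * n * Nat.clog 2 n + 8 * n + 4 * D + 7)
    + (k + 1) + faceTime (k + 1) D n + 4 * D + 2 * 2 ^ k
    + 2 * (2 ^ k * (2 * (Q + 1) + (k + D * 3 + 2 * N + 4) + faceTime k D n) + 3 ^ k * (k + 2))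
    + 3

/-- In direction t the points P i and v share a height that no other vertex has. The direction s₃
only breaks this tie: `sL` places v above the P i, and the double negation in `-u` places it below,
while other vertices keep their sides. The condition `hgen` ranges over all normals because it must
cover whichever one is computed. -/
theorem spec_isSimplex {k N : ℕ} (hk : 0 < k) (hkD : k < D) {V : List (Fin D → ℝ)}
    {P : Fin k → Fin D → ℝ} {v : Fin D → ℝ} (hPV : ∀ i, P i ∈ V) (hvV : v ∈ V)
    (hind : AffineIndependent ℝ (Fin.snoc (α := fun _ => Fin D → ℝ) P v : Fin (k + 1) → _))
    (hgen : ∀ r : Fin D → ℝ, r ≠ 0 → (∀ i, r ⬝ᵥ P i = r ⬝ᵥ v) →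
      ∀ x ∈ V, x ∉ Set.range P → x ≠ v → r ⬝ᵥ x ≠ r ⬝ᵥ v)
    {F : Set (Finset (Fin D → ℝ))} (hF : F.Finite) (hFV : ∀ X ∈ F, ∀ x ∈ X, x ∈ V)
    (hO : CountsSimplices O F k N) :
    Spec O Q (isSimplex V P v) (simplexTime k D V.length N Q) (2 ^ (k + 1) - 2) fun b =>
      b = true ↔ insert v (Finset.univ.image P) ∈ F := by
  have hV : V ≠ [] := List.ne_nil_of_mem hvV
  have hinj : Function.Injective P := by
    intro i j hij
    have := hind.injective (a₁ := i.castSucc) (a₂ := j.castSucc) (by simpa using hij)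
    simpa using this
  have hvP : v ∉ Set.range P := by
    rintro ⟨i, hi⟩
    have := hind.injective (a₁ := i.castSucc) (a₂ := Fin.last k) (by simpa using hi)
    exact absurd this (Fin.castSucc_lt_last i).ne
  have hPind : AffineIndependent ℝ P := by
    have := hind.comp_embedding Fin.castSuccEmb
    convert this using 1
    ext i
    simp
  obtain ⟨i₀⟩ : Nonempty (Fin k) := ⟨⟨0, hk⟩⟩
  have hlast : (Finset.univ.erase (Fin.last k)).Nonempty :=
    ⟨i₀.castSucc, Finset.mem_erase.2 ⟨(Fin.castSucc_lt_last i₀).ne, Finset.mem_univ _⟩⟩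
  unfold isSimplex
  dsimp only
  refine ((spec_normalDirection hkD P v).bind fun s₁ hs₁ => (spec_heights V s₁).bind
    fun H₁ hH₁ => (spec_heights V s₁).bind fun H₂ hH₂ =>
    ((by rw [hH₁, hH₂]; exact spec_tilt V hV s₁ s₁ :
      Spec O Q (tilt s₁ s₁ H₁ H₂) _ 0 (IsTilt V s₁ s₁))).bind fun t ht =>
    (spec_steps (k + 1)).bind fun _ _ =>
    (spec_secondDirection hind Finset.univ _ hlast (Finset.subset_univ _)).bind fun s₃ hs₃ =>
    (spec_heights V t).bind fun HS hHS => (spec_heights V s₃).bind fun H₃ hH₃ =>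
    ((by rw [hHS, hH₃]; exact spec_tilt V hV t s₃ :
      Spec O Q (tilt t s₃ HS H₃) _ 0 (IsTilt V t s₃))).bind fun sL hsL =>
    (spec_vneg t).bind fun t' ht' => (spec_heights V t').bind fun HN hHN =>
    ((by rw [hHN, hH₃]; exact spec_tilt V hV t' s₃ :
      Spec O Q (tilt t' s₃ HN H₃) _ 0 (IsTilt V t' s₃))).bind fun u hu =>
    (spec_vneg u).bind fun sU hsU => (?_ : Spec O Q _ (2 * 2 ^ k
      + 2 * (2 ^ k * (2 * (Q + 1) + (k + D * 3 + 2 * N + 4) + faceTime k D V.length)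
        + 3 ^ k * (k + 2)) + 3) _ _)).time_le ?_
  · subst ht' hsU
    have h₃eq : ∀ i, s₃ ⬝ᵥ P i = s₃ ⬝ᵥ P i₀ := fun i => by
      simpa using hs₃.1 i.castSucc (by simp [(Fin.castSucc_lt_last i).ne]) i₀.castSucc
        (by simp [(Fin.castSucc_lt_last i₀).ne])
    have h₃lt : s₃ ⬝ᵥ P i₀ < s₃ ⬝ᵥ v := by
      simpa using hs₃.2 i₀.castSucc (by simp [(Fin.castSucc_lt_last i₀).ne]) (Fin.last k)
        (Finset.mem_univ _) (by simp)
    -- Tilting a direction toward itself preserves both equalities and strict inequalities of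
    -- heights.
    have hteq : ∀ i, t ⬝ᵥ P i = t ⬝ᵥ v := fun i =>
      ht.eq_of_eq _ (hPV i) _ hvV (hs₁.2 i) (hs₁.2 i)
    have htne : ∀ x ∈ V, x ∉ Set.range P → x ≠ v → t ⬝ᵥ x ≠ t ⬝ᵥ v := by
      intro x hx hxP hxv
      rcases lt_or_gt_of_ne (hgen s₁ hs₁.1 hs₁.2 x hx hxP hxv) with h | h
      · exact (ht.lt_of_lt x hx v hvV h).ne
      · exact (ht.lt_of_lt v hvV x hx h).ne'
    have hPP : ∀ i, t ⬝ᵥ P i = t ⬝ᵥ P i₀ := fun i => (hteq i).trans (hteq i₀).symm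
    have hLeq : ∀ i, sL ⬝ᵥ P i = sL ⬝ᵥ P i₀ := fun i =>
      hsL.eq_of_eq _ (hPV i) _ (hPV i₀) (hPP i) (h₃eq i)
    have hLv : sL ⬝ᵥ P i₀ < sL ⬝ᵥ v := hsL.lt_of_eq _ (hPV i₀) _ hvV (hteq i₀) h₃lt
    have hLlt : ∀ x ∈ V, t ⬝ᵥ x < t ⬝ᵥ v → sL ⬝ᵥ x < sL ⬝ᵥ P i₀ := fun x hx h =>
      hsL.lt_of_lt x hx _ (hPV i₀) (by rwa [hteq i₀])
    have hLgt : ∀ x ∈ V, t ⬝ᵥ v < t ⬝ᵥ x → sL ⬝ᵥ P i₀ < sL ⬝ᵥ x := fun x hx h =>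
      hsL.lt_of_lt _ (hPV i₀) x hx (by rwa [hteq i₀])
    have hUeq : ∀ i, -u ⬝ᵥ P i = -u ⬝ᵥ P i₀ := fun i => by
      rw [neg_dotProduct, neg_dotProduct, hu.eq_of_eq _ (hPV i) _ (hPV i₀)
        (by rw [neg_dotProduct, neg_dotProduct, hPP i]) (h₃eq i)]
    have hUv : -u ⬝ᵥ v < -u ⬝ᵥ P i₀ := by
      rw [neg_dotProduct, neg_dotProduct]
      exact neg_lt_neg (hu.lt_of_eq _ (hPV i₀) _ hvV
        (by rw [neg_dotProduct, neg_dotProduct, hteq i₀]) h₃lt)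
    have hUlt : ∀ x ∈ V, t ⬝ᵥ x < t ⬝ᵥ v → -u ⬝ᵥ x < -u ⬝ᵥ P i₀ := fun x hx h => by
      rw [neg_dotProduct, neg_dotProduct]
      exact neg_lt_neg (hu.lt_of_lt _ (hPV i₀) x hx (by
        rw [neg_dotProduct, neg_dotProduct, hteq i₀]
        exact neg_lt_neg h))
    have hUgt : ∀ x ∈ V, t ⬝ᵥ v < t ⬝ᵥ x → -u ⬝ᵥ P i₀ < -u ⬝ᵥ x := fun x hx h => by
      rw [neg_dotProduct, neg_dotProduct]
      exact neg_lt_neg (hu.lt_of_lt x hx _ (hPV i₀) (by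
        rw [neg_dotProduct, neg_dotProduct, hteq i₀]
        exact neg_lt_neg h))
    have hne : ∀ r : Fin D → ℝ, r ⬝ᵥ P i₀ ≠ r ⬝ᵥ v → r ≠ 0 := by
      rintro r h rfl
      simp at h
    have hLs : ∀ x ∈ V, x ∉ Set.range P → sL ⬝ᵥ x ≠ sL ⬝ᵥ P i₀ := by
      intro x hx hxP
      by_cases hxv : x = v
      · rw [hxv]
        exact hLv.ne'
      · rcases lt_or_gt_of_ne (htne x hx hxP hxv) with h | h
        · exact (hLlt x hx h).ne
        · exact (hLgt x hx h).ne'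
    have hUs : ∀ x ∈ V, x ∉ Set.range P → -u ⬝ᵥ x ≠ -u ⬝ᵥ P i₀ := by
      intro x hx hxP
      by_cases hxv : x = v
      · rw [hxv]
        exact hUv.ne
      · rcases lt_or_gt_of_ne (htne x hx hxP hxv) with h | h
        · exact (hUlt x hx h).ne
        · exact (hUgt x hx h).ne'
    have hdiff := traceCount_eq_add hinj hvP hF hFV hUv hLv fun x hx hxP hxv => by
      rcases lt_or_gt_of_ne (htne x hx hxP hxv) with h | h
      · exact ⟨fun _ => hLlt x hx h, fun _ => hUlt x hx h⟩
      · exact ⟨fun h' => absurd h' (hUgt x hx h).not_gt, fun h' => absurd h' (hLgt x hx h).not_gt⟩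
    refine ((spec_steps (2 ^ k)).bind fun _ _ => (spec_indegree hk hPV hPind
      (hne _ hUv.ne') hUeq hF hFV hUs hO).bind' fun rU hrU => (spec_steps (2 ^ k)).bind fun _ _ =>
      (spec_indegree hk hPV hPind (hne _ hLv.ne) hLeq hF hFV hLs hO).bind' fun rL hrL =>
      (spec_steps 3).bind fun _ _ => spec_pure (post := fun b => b = true ↔
        insert v (Finset.univ.image P) ∈ F) ?_).mono (by lia) ?_ fun _ => id
    -- The two values differ by the indicator of v spanning a cofacet, so their absolute difference
    -- is 1 exactly if that indicator is 1.
    · rw [hrU, hrL, hdiff, decide_eq_true_iff]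
      split_ifs with h <;> simp [h]
    · rw [pow_succ]
      omega
  · have hft : (k + 1 + D) + (k + 1) * (2 + (k + 1) + (k + 1) * (1 + D * 2)
        + (k + 1) * (1 + (k + 1) * (9 * D + 2)) + 4 * D + (k + 1) * (9 * D + 2))
        ≤ faceTime (k + 1) D V.length := by
      unfold faceTime
      omega
    unfold simplexTime
    lia

end Prog

/-- The direction of the span lies in the kernel of y ↦ r · y, and both have dimension k. The span
is therefore the full level set, and general position stated for the span transfers to heights. -/
theorem mem_affineSpan_of_dotProduct_eq {k : ℕ} {R : Fin (k + 1) → Fin (k + 1) → ℝ}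
    (hR : AffineIndependent ℝ R) {r : Fin (k + 1) → ℝ} (hr : r ≠ 0) {c : ℝ}
    (hc : ∀ i, r ⬝ᵥ R i = c) {x : Fin (k + 1) → ℝ} (hx : r ⬝ᵥ x = c) :
    x ∈ affineSpan ℝ (Set.range R) := by
  let φ : (Fin (k + 1) → ℝ) →ₗ[ℝ] ℝ :=
    { toFun := fun y => r ⬝ᵥ y
      map_add' := fun y z => dotProduct_add r y z
      map_smul' := fun a y => dotProduct_smul a r y }
  have hφ : Function.Surjective φ := LinearMap.surjective fun h =>
    hr (dotProduct_self_eq_zero.1 (LinearMap.congr_fun h r))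
  have h1 := LinearMap.finrank_range_add_finrank_ker φ
  rw [LinearMap.range_eq_top.2 hφ, finrank_top, Module.finrank_self, Module.finrank_fin_fun] at h1
  have h2 : Module.finrank ℝ (vectorSpan ℝ (Set.range R)) = k :=
    hR.finrank_vectorSpan (by simp)
  have h3 : vectorSpan ℝ (Set.range R) ≤ LinearMap.ker φ := by
    rw [vectorSpan_def, Submodule.span_le]
    rintro _ ⟨_, ⟨i, rfl⟩, _, ⟨j, rfl⟩, rfl⟩
    change r ⬝ᵥ (R i - R j) = 0
    rw [dotProduct_sub, hc, hc, sub_self]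
  have h4 : vectorSpan ℝ (Set.range R) = LinearMap.ker φ :=
    Submodule.eq_of_le_of_finrank_eq h3 (by omega)
  have h0 : R 0 ∈ affineSpan ℝ (Set.range R) := subset_affineSpan ℝ _ ⟨0, rfl⟩
  rw [← AffineSubspace.vsub_right_mem_direction_iff_mem h0, direction_affineSpan, h4]
  change r ⬝ᵥ (x - R 0) = 0
  rw [dotProduct_sub, hc, hx, sub_self]

/-! ### The running time -/

/-- The power d^4 comes from up to m Gram–Schmidt runs for one direction, each of cubic cost. The
remaining terms are for computing and sorting heights. -/
theorem faceTime_le {m d n : ℕ} (hd : 1 ≤ d) (hm : m ≤ d + 1) :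
    Prog.faceTime m (d + 1) n ≤ 1000 * (d ^ 4 + n * d + n * Nat.clog 2 n) := by
  have h1 : Prog.faceTime m (d + 1) n ≤ Prog.faceTime (d + 1) (d + 1) n := by
    unfold Prog.faceTime
    gcongr
  refine h1.trans ?_
  have e1 : d ≤ d ^ 4 := Nat.le_self_pow (by norm_num) d
  have e2 : d ^ 2 ≤ d ^ 4 := Nat.pow_le_pow_right hd (by norm_num)
  have e3 : d ^ 3 ≤ d ^ 4 := Nat.pow_le_pow_right hd (by norm_num)
  have e4 : n ≤ n * d := Nat.le_mul_of_pos_right n hd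
  unfold Prog.faceTime
  generalize Nat.clog 2 n = L
  linarith [Nat.zero_le (n * L)]

theorem liftedSimplexTime_le {d n N Q : ℕ} (hd : 1 ≤ d) :
    n * (4 * d + 2) + (d * (4 * d + 2) + (4 * d + 1 + Prog.simplexTime d (d + 1) n N Q))
      ≤ 10000 * (2 ^ d * (Q + N + d ^ 4 + n * d + n * Nat.clog 2 n) + 3 ^ d * d) := by
  have f1 := faceTime_le (m := d) (n := n) hd (by omega)
  have f2 := faceTime_le (m := d + 1) (n := n) hd le_rfl
  have e0 : 1 ≤ d ^ 4 := Nat.one_le_pow _ _ hd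
  have e1 : d ≤ d ^ 4 := Nat.le_self_pow (by norm_num) d
  have e2 : d ^ 2 ≤ d ^ 4 := Nat.pow_le_pow_right hd (by norm_num)
  have e3 : d ^ 3 ≤ d ^ 4 := Nat.pow_le_pow_right hd (by norm_num)
  have e4 : n ≤ n * d := Nat.le_mul_of_pos_right n hd
  unfold Prog.simplexTime
  generalize Nat.clog 2 n = L at *
  generalize Prog.faceTime d (d + 1) n = A at *
  generalize Prog.faceTime (d + 1) (d + 1) n = B at *
  have hp : 1 ≤ 2 ^ d := Nat.one_le_two_pow
  generalize 2 ^ d = p at *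
  -- With the bracket named X, everything outside the factor 2^d is at most a multiple of X, hence
  -- of 2^d X, and the estimate becomes linear.
  obtain ⟨X, hX⟩ : ∃ X, X = Q + N + d ^ 4 + n * d + n * L := ⟨_, rfl⟩
  rw [← hX]
  have hXp : X ≤ p * X := Nat.le_mul_of_pos_left X hp
  have hX1 : 1 ≤ X := by omega
  have hp1 : p ≤ p * X := Nat.le_mul_of_pos_right _ hX1
  have g1 : 2 * (Q + 1) + (d + (d + 1) * 3 + 2 * N + 4) + A ≤ 1100 * X := by
    rw [hX]
    linarith [Nat.zero_le (n * L), Nat.zero_le (n * d)]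
  have g2 : p * (2 * (Q + 1) + (d + (d + 1) * 3 + 2 * N + 4) + A) ≤ 1100 * (p * X) :=
    (Nat.mul_le_mul_left _ g1).trans (le_of_eq (by ring))
  have g3 : 3 ^ d * (d + 2) ≤ 3 * (3 ^ d * d) :=
    (Nat.mul_le_mul_left _ (show d + 2 ≤ 3 * d by omega)).trans (le_of_eq (by ring))
  have g4 : n * (4 * d + 2) + (d * (4 * d + 2) + (4 * d + 1
      + ((d * (1 + (d + 1) * 2) + d * (1 + d * (9 * (d + 1) + 2))
        + (d + 1) * (4 * (d + 1) + 1 + d * (9 * (d + 1) + 2)))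
      + 5 * (n * (1 + (d + 1) * 3)) + 3 * (6 * n * L + 8 * n + 4 * (d + 1) + 7)
      + (d + 1) + B + 4 * (d + 1) + 3))) ≤ 2000 * X := by
    rw [hX]
    linarith [Nat.zero_le (n * L), Nat.zero_le (n * d), Nat.zero_le Q, Nat.zero_le N]
  generalize p * (2 * (Q + 1) + (d + (d + 1) * 3 + 2 * N + 4) + A) = Y at *
  generalize 3 ^ d * (d + 2) = Z at *
  linarith

/-- The offset 3 makes the induction work, as 3(d + 4) ≤ 4(d + 3). It puts d·3^d, the cost of table
lookups, within a constant multiple of 2^d · 2^(d−1). -/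
theorem mul_three_pow_le (d : ℕ) : (d + 3) * 3 ^ d ≤ 3 * 4 ^ d := by
  induction d with
  | zero => norm_num
  | succ d ih =>
    rw [pow_succ, pow_succ]
    nlinarith [Nat.zero_le (d * 3 ^ d)]

theorem pow_four_le (d : ℕ) : d ^ 4 ≤ 32 * 2 ^ d := by
  rcases Nat.lt_or_ge d 6 with h | h
  · interval_cases d <;> norm_num
  · induction d, h using Nat.le_induction with
    | base => norm_num
    | succ d hd ih =>
      rw [pow_succ]
      have e1 : 6 * d ^ 3 ≤ d ^ 4 := by
        rw [pow_succ d 3, mul_comm]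
        exact Nat.mul_le_mul_left _ hd
      have e2 : 6 * d ^ 2 ≤ d ^ 3 := by
        rw [pow_succ d 2, mul_comm]
        exact Nat.mul_le_mul_left _ hd
      have e3 : 6 * d ≤ d ^ 2 := by
        rw [sq]
        exact Nat.mul_le_mul_right _ hd
      have e4 : (d + 1) ^ 3 * (d + 1) = d ^ 4 + 4 * d ^ 3 + 6 * d ^ 2 + 4 * d + 1 := by ring
      rw [e4, pow_succ 2 d]
      omega

/-- Rounding up adds less than one to the binary logarithm, which is itself at least one; the
constant is then 2 / log 2 < 3. -/
theorem clog_le_three_mul_log {n : ℕ} (hn : 2 ≤ n) : (Nat.clog 2 n : ℝ) ≤ 3 * Real.log n := by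
  have h1 : 2 ^ (Nat.clog 2 n).pred < n := Nat.pow_pred_clog_lt_self (by norm_num) (by omega)
  have h2 : (2 : ℝ) ^ (Nat.clog 2 n).pred < n := by exact_mod_cast h1
  have h3 := Real.log_lt_log (by positivity) h2
  rw [Real.log_pow] at h3
  have h4 : Real.log 2 ≤ Real.log n := Real.log_le_log (by norm_num) (by exact_mod_cast hn)
  have h5 := Real.log_two_gt_d9
  have h6 : (Nat.clog 2 n : ℝ) ≤ ((Nat.clog 2 n).pred : ℝ) + 1 := by
    exact_mod_cast (show Nat.clog 2 n ≤ (Nat.clog 2 n).pred + 1 by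
      rw [Nat.pred_eq_sub_one]
      omega)
  have h7 : 0 ≤ ((Nat.clog 2 n).pred : ℝ) := Nat.cast_nonneg _
  nlinarith

/-- From 1 + x ≤ exp x at x = d/2 − log n, together with exp(1/2) ≤ 2. It trades the term n·d for
terms of the stated bound. -/
theorem mul_le_mul_log_add_two_pow {n : ℕ} (hn : 1 ≤ n) (d : ℕ) :
    (n * d : ℝ) ≤ 2 * (n * Real.log n) + 2 * 2 ^ d := by
  have hn0 : (0 : ℝ) < n := by exact_mod_cast hn
  have h1 := Real.add_one_le_exp ((d : ℝ) / 2 - Real.log n)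
  rw [Real.exp_sub, Real.exp_log hn0, le_div_iff₀ hn0] at h1
  have h2 : Real.exp ((d : ℝ) / 2) ≤ 2 ^ d := by
    have h3 : Real.exp ((d : ℝ) / 2) = Real.exp (1 / 2) ^ d := by
      rw [← Real.exp_nat_mul]
      congr 1
      ring
    rw [h3]
    refine pow_le_pow_left₀ (Real.exp_pos _).le ?_ d
    have h4 : Real.exp (1 / 2) ^ 2 = Real.exp 1 := by
      rw [← Real.exp_nat_mul]
      norm_num
    have h5 := Real.exp_one_lt_d9
    nlinarith [Real.exp_pos (1 / 2)]
  nlinarith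

theorem liftedSimplexTime_le_real {d n N N' Q : ℕ} (hd : 1 ≤ d) (hn : 2 ≤ n)
    (hN : N ≤ 2 * (n * N')) :
    ((n * (4 * d + 2) + (d * (4 * d + 2) + (4 * d + 1 + Prog.simplexTime d (d + 1) n N Q)) : ℕ) : ℝ)
      ≤ 1000000 * (d * n + 2 ^ d * (n * N' + n * Real.log n + d ^ 2 + 2 ^ (d - 1) + Q)) := by
  obtain ⟨e, rfl⟩ : ∃ e, d = e + 1 := ⟨d - 1, by omega⟩
  rw [Nat.add_sub_cancel]
  have h0 : ((n * (4 * (e + 1) + 2) + ((e + 1) * (4 * (e + 1) + 2) + (4 * (e + 1) + 1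
      + Prog.simplexTime (e + 1) (e + 1 + 1) n N Q)) : ℕ) : ℝ) ≤ _ :=
    Nat.cast_le.2 (liftedSimplexTime_le (n := n) (N := N) (Q := Q) hd)
  refine h0.trans ?_
  have h1 : (((e + 1 : ℕ) : ℝ)) ^ 4 ≤ 64 * 2 ^ e := by
    have := pow_four_le (e + 1)
    rw [pow_succ 2 e] at this
    exact_mod_cast this.trans (le_of_eq (by ring))
  have h2 : (3 : ℝ) ^ (e + 1) * ((e + 1 : ℕ) : ℝ) ≤ 2 ^ (e + 1) * (6 * 2 ^ e) := by
    have h := mul_three_pow_le (e + 1)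
    have h4 : 4 ^ (e + 1) = 2 ^ (e + 1) * (2 * 2 ^ e) := by
      rw [← pow_succ', ← mul_pow]
      norm_num
    have : 3 ^ (e + 1) * (e + 1) ≤ 2 ^ (e + 1) * (6 * 2 ^ e) := by
      calc 3 ^ (e + 1) * (e + 1) ≤ (e + 1 + 3) * 3 ^ (e + 1) := by
            nlinarith [Nat.zero_le (3 ^ (e + 1))]
        _ ≤ 3 * 4 ^ (e + 1) := h
        _ = 2 ^ (e + 1) * (6 * 2 ^ e) := by
          rw [h4]
          ring
    exact_mod_cast this
  have h3 := mul_le_mul_log_add_two_pow (show 1 ≤ n by omega) (e + 1)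
  have h4 := mul_le_mul_of_nonneg_left (clog_le_three_mul_log hn) (Nat.cast_nonneg (α := ℝ) n)
  have h5 : (N : ℝ) ≤ 2 * (n * N') := by exact_mod_cast hN
  have hlog : 0 ≤ Real.log n := Real.log_natCast_nonneg n
  have hnlog : 0 ≤ (n : ℝ) * Real.log n := by positivity
  have hp : (0 : ℝ) < 2 ^ (e + 1) := by positivity
  have hkey : ((Q + N + (e + 1) ^ 4 + n * (e + 1) + n * Nat.clog 2 n : ℕ) : ℝ) + 6 * 2 ^ e
      ≤ 100 * (n * N' + n * Real.log n + ((e + 1 : ℕ) : ℝ) ^ 2 + 2 ^ e + Q) := by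
    push_cast at h1 h3 ⊢
    rw [pow_succ] at h3
    have : (0 : ℝ) ≤ ((e : ℝ) + 1) ^ 2 := by positivity
    have : (0 : ℝ) ≤ (n : ℝ) * N' := by positivity
    have : (0 : ℝ) ≤ (Q : ℝ) := by positivity
    have : (0 : ℝ) ≤ (2 : ℝ) ^ e := by positivity
    nlinarith
  have h6 := mul_le_mul_of_nonneg_left hkey hp.le
  have h7 : (0 : ℝ) ≤ ((e + 1 : ℕ) : ℝ) * n := by positivity
  rw [Nat.cast_mul, Nat.cast_add, Nat.cast_mul, Nat.cast_mul, Nat.cast_pow, Nat.cast_pow]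
  push_cast at h2 h6 h7 ⊢
  nlinarith

/-! ### The lifted simplex predicate -/

open Classical in
theorem facetClosed_faces {E : Type*} [AddCommGroup E] [Module ℝ E]
    (K : Geometry.SimplicialComplex ℝ E) : FacetClosed K.faces := by
  intro s hs x hx hc
  refine K.down_closed hs (Finset.erase_subset x s) (Finset.card_pos.1 ?_)
  rw [Finset.card_erase_of_mem hx]
  omega

theorem ncard_liftComplex_faces {d : ℕ} (K : Geometry.SimplicialComplex ℝ (Fin d → ℝ)) (j : ℕ) :
    {X ∈ (liftComplex K).faces | X.card = j}.ncard = {τ ∈ K.faces | τ.card = j}.ncard := by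
  have hinj : Function.Injective fun s : Finset (Fin d → ℝ) => s.image liftPoint :=
    Finset.image_injective liftPoint_injective
  rw [← Set.ncard_image_of_injective _ hinj]
  congr 1
  ext X
  simp only [Set.mem_ofPred_eq, Set.mem_image, liftComplex]
  constructor
  · rintro ⟨⟨s, hs, rfl⟩, hc⟩
    rw [Finset.card_image_of_injective _ liftPoint_injective] at hc
    exact ⟨s, ⟨hs, hc⟩, rfl⟩
  · rintro ⟨s, ⟨hs, hc⟩, rfl⟩
    exact ⟨⟨s, hs, rfl⟩, by rw [Finset.card_image_of_injective _ liftPoint_injective, hc]⟩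

open Classical in
/-- A simplex is determined by a facet and the opposite vertex. -/
theorem ncard_faces_succ_le {E : Type*} [AddCommGroup E] [Module ℝ E]
    (K : Geometry.SimplicialComplex ℝ E) (hK : K.faces.Finite) (hV : K.vertices.Finite) {j : ℕ}
    (hj : 1 ≤ j) : {τ ∈ K.faces | τ.card = j + 1}.ncard
      ≤ K.vertices.ncard * {τ ∈ K.faces | τ.card = j}.ncard := by
  -- Choosing a vertex of each simplex makes τ ↦ (vertex, opposite facet) an injection.
  have hex : ∀ τ : Finset E, ∃ x, τ.card = j + 1 → x ∈ τ := by
    intro τ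
    by_cases h : τ.card = j + 1
    · obtain ⟨x, hx⟩ := Finset.card_pos.1 (show 0 < τ.card by omega)
      exact ⟨x, fun _ => hx⟩
    · by_cases hE : Nonempty E
      · exact ⟨hE.some, fun h' => absurd h' h⟩
      · exact absurd ⟨0⟩ hE
  choose a ha using hex
  rw [← Set.ncard_prod]
  refine Set.ncard_le_ncard_of_injOn (fun τ => (a τ, τ.erase (a τ))) ?_ ?_
    (hV.prod (hK.subset fun τ hτ => hτ.1))
  · rintro τ ⟨hτ, hc⟩
    have hmem := ha τ hc
    have hcard : (τ.erase (a τ)).card = j := by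
      rw [Finset.card_erase_of_mem hmem, hc, Nat.add_sub_cancel]
    have hne : (τ.erase (a τ)).Nonempty := Finset.card_pos.1 (by omega)
    exact ⟨K.down_closed hτ (Finset.singleton_subset_iff.2 hmem) (Finset.singleton_nonempty _),
      K.down_closed hτ (Finset.erase_subset _ _) hne, hcard⟩
  · rintro τ ⟨-, hc⟩ τ' ⟨-, hc'⟩ h
    obtain ⟨h1, h2⟩ := Prod.mk.inj h
    rw [← Finset.insert_erase (ha τ hc), ← Finset.insert_erase (ha τ' hc'), h2, h1]

/-- The ambient dimension is written d + 1 so that the lower diagram dimension, a truncated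
difference, is the genuine d. -/
theorem countsSimplices_of_isLiftedOracle {𝔽 : Type*} [Field 𝔽] {d : ℕ}
    {K : Geometry.SimplicialComplex ℝ (Fin (d + 1) → ℝ)} {O : Oracle (d + 1 + 1)}
    (hO : IsLiftedOracle 𝔽 K O) :
    Prog.CountsSimplices O (liftComplex K).faces (d + 1)
      ({τ ∈ K.faces | τ.card = d + 1}.ncard + {τ ∈ K.faces | τ.card = d + 1 + 1}.ncard) where
  count t ht a := (hO t ht).countP_death_add_birth (facetClosed_faces _) d a
  length_le t ht := by
    have h1 := (hO t ht).card_le (facetClosed_faces _) d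
    have h2 := (hO t ht).card_le (facetClosed_faces _) (d + 1)
    rw [ncard_liftComplex_faces] at h1 h2
    exact add_le_add h1 h2

theorem range_snoc_eq_image {α β : Type*} [DecidableEq α] {k : ℕ} (g : α → β) (P : Fin k → α)
    (v : α) : Set.range (fun i => g ((Fin.snoc (α := fun _ => α) P v : Fin (k + 1) → α) i))
      = g '' insert v ((Finset.univ.image P : Finset α) : Set α) := by
  have h : insert v ((Finset.univ.image P : Finset α) : Set α)
      = Set.range (Fin.snoc (α := fun _ => α) P v : Fin (k + 1) → α) := by
    rw [Fin.range_snoc, Finset.coe_image, Finset.coe_univ, Set.image_univ]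
  rw [h, ← Set.range_comp]
  rfl

theorem Prog.spec_isLiftedSimplex {d N Q : ℕ} {O : Oracle (d + 1)} (hd : 0 < d)
    {V : List (Fin d → ℝ)} {P : Fin d → Fin d → ℝ} {v : Fin d → ℝ} (hPV : ∀ i, P i ∈ V)
    (hvV : v ∈ V) (hind : AffineIndependent ℝ fun i =>
      liftPoint ((Fin.snoc (α := fun _ => Fin d → ℝ) P v : Fin (d + 1) → _) i))
    (hgen : ∀ x ∈ V, x ∉ Set.range P → x ≠ v →
      liftPoint x ∉ affineSpan ℝ
        (liftPoint '' insert v ((Finset.univ.image P : Finset (Fin d → ℝ)) : Set (Fin d → ℝ))))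
    {F : Set (Finset (Fin (d + 1) → ℝ))} (hF : F.Finite)
    (hFV : ∀ X ∈ F, ∀ x ∈ X, x ∈ V.map liftPoint) (hO : CountsSimplices O F d N) :
    Spec O Q (isLiftedSimplex V P v) (V.length * (4 * d + 2) + (d * (4 * d + 2) + (4 * d + 1
      + simplexTime d (d + 1) V.length N Q))) (2 ^ (d + 1) - 2) fun b =>
        b = true ↔ (insert v (Finset.univ.image P)).image liftPoint ∈ F := by
  have hsnoc : (fun i => liftPoint ((Fin.snoc (α := fun _ => Fin d → ℝ) P v : Fin (d + 1) → _) i))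
      = Fin.snoc (α := fun _ => Fin (d + 1) → ℝ) (fun i => liftPoint (P i)) (liftPoint v) := by
    funext i
    induction i using Fin.lastCases with
    | last => simp
    | cast i => simp
  unfold isLiftedSimplex
  refine ((spec_mapList_eq V fun x _ => spec_lift x).bind fun V' hV' =>
    (spec_array fun i => spec_lift (P i)).bind fun P' hP' => (spec_lift v).bind
      (t' := simplexTime d (d + 1) V.length N Q) (n := 2 ^ (d + 1) - 2)
      (post' := fun b => b = true ↔ (insert v (Finset.univ.image P)).image liftPoint ∈ F)
        fun v' hv' => ?_).time_le (le_of_eq (by ring))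
  obtain rfl : P' = fun i => liftPoint (P i) := funext hP'
  subst hV' hv'
  have h := spec_isSimplex (O := O) (Q := Q) (N := N) hd (Nat.lt_succ_self d)
    (V := V.map liftPoint) (P := fun i => liftPoint (P i)) (v := liftPoint v)
    (fun i => List.mem_map_of_mem (hPV i)) (List.mem_map_of_mem hvV) (hsnoc ▸ hind) ?_ hF hFV hO
  · rw [List.length_map] at h
    refine h.imp fun b hb => hb.trans ?_
    rw [Finset.image_insert, Finset.image_image]
    rfl
  -- A further lifted vertex at the common height would lie in the affine span of the lift of Σ.
  · intro r hr hrP x hx hxP hxv hrx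
    obtain ⟨y, hy, rfl⟩ := List.mem_map.1 hx
    refine hgen y hy ?_ ?_ (range_snoc_eq_image liftPoint P v ▸
      mem_affineSpan_of_dotProduct_eq hind hr (fun i => ?_) hrx)
    · rintro ⟨i, rfl⟩
      exact hxP ⟨i, rfl⟩
    · rintro rfl
      exact hxv rfl
    · induction i using Fin.lastCases with
      | last => simp
      | cast i => simpa using hrP i

theorem mainTheorem10 :
    ∃ C : ℝ, ∀ (𝔽 : Type*) [Field 𝔽] (d : ℕ)
      (K : Geometry.SimplicialComplex ℝ (Fin d → ℝ)) (_hK : K.faces.Finite)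
      (σ : Finset (Fin d → ℝ)) (_hσ : σ ∈ K.faces) (_hσd : σ.card = d)
      (v : Fin d → ℝ) (_hv : v ∈ K.vertices) (_hvσ : v ∉ σ)
      (_hind : AffineIndependent ℝ
        (fun x : (insert v σ : Finset (Fin d → ℝ)) => liftPoint (x : Fin d → ℝ)))
      (_hgen : ∀ q ∈ K.vertices, q ∉ insert v σ →
        liftPoint q ∉ affineSpan ℝ (liftPoint '' (insert v (σ : Set (Fin d → ℝ)))))
      (V : List (Fin d → ℝ)) (_hVnd : V.Nodup) (_hV : ∀ x, x ∈ V ↔ x ∈ K.vertices)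
      (P : Fin d → Fin d → ℝ) (_hP : Finset.univ.image P = σ)
      (O : Oracle (d + 1)) (_hO : IsLiftedOracle 𝔽 K O) (Q : ℕ),
      ((Prog.isLiftedSimplex V P v).result O = true ↔ insert v σ ∈ K.faces) ∧
      (Prog.isLiftedSimplex V P v).diagrams O ≤ 2 ^ (d + 1) - 2 ∧
      ((Prog.isLiftedSimplex V P v).time O Q : ℝ) ≤
        C * (d * K.vertices.ncard + 2 ^ d * (
          K.vertices.ncard * {τ ∈ K.faces | τ.card = d}.ncard +
          K.vertices.ncard * Real.log K.vertices.ncard +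
          d ^ 2 + 2 ^ (d - 1) + Q)) := by
  refine ⟨1000000, ?_⟩
  intro 𝔽 _ d K hK σ hσ hσd v hv hvσ hind hgen V hVnd hV P hP O hO Q
  subst hP
  have hd : 0 < d := by
    rw [← hσd]
    exact Finset.card_pos.2 (K.nonempty_of_mem_faces hσ)
  have hPinj : Function.Injective P := by
    have h : (Finset.univ.image P).card = (Finset.univ : Finset (Fin d)).card := by
      rw [hσd, Finset.card_univ, Fintype.card_fin]
    exact Set.injOn_univ.1 (by simpa using Finset.card_image_iff.1 h)
  have hPσ : ∀ i, P i ∈ Finset.univ.image P := fun i =>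
    Finset.mem_image_of_mem P (Finset.mem_univ i)
  have hvP : v ∉ Set.range P := by simpa using hvσ
  have hPV : ∀ i, P i ∈ V := fun i => (hV _).2 (K.down_closed hσ
    (Finset.singleton_subset_iff.2 (hPσ i)) (Finset.singleton_nonempty _))
  have hvV : v ∈ V := (hV v).2 hv
  have hn : K.vertices.ncard = V.length := by
    have : K.vertices = (V.toFinset : Set (Fin d → ℝ)) := by
      ext x
      simp [hV]
    rw [this, Set.ncard_coe_finset, List.toFinset_card_of_nodup hVnd]
  have hVfin : K.vertices.Finite := by
    refine Set.finite_of_ncard_pos ?_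
    rw [hn]
    exact List.length_pos_of_mem hvV
  -- σ has a vertex and v is another one; for a single vertex log n₀ would vanish and could not
  -- absorb the rounded logarithm.
  have hn2 : 2 ≤ K.vertices.ncard := by
    rw [Nat.succ_le_iff, Set.one_lt_ncard hVfin]
    exact ⟨v, hv, P ⟨0, hd⟩, (hV _).1 (hPV _), fun h => hvP ⟨_, h.symm⟩⟩
  have hsnocmem : ∀ i, (Fin.snoc (α := fun _ => Fin d → ℝ) P v : Fin (d + 1) → _) i
      ∈ insert v (Finset.univ.image P) := by
    intro i
    induction i using Fin.lastCases with
    | last => simp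
    | cast i => simp
  have hsnocinj : Function.Injective
      (Fin.snoc (α := fun _ => Fin d → ℝ) P v : Fin (d + 1) → _) :=
    Fin.snoc_injective_iff.2 ⟨hPinj, hvP⟩
  let f : Fin (d + 1) ↪ (insert v (Finset.univ.image P) : Finset (Fin d → ℝ)) :=
    ⟨fun i => ⟨_, hsnocmem i⟩, fun i j hij => hsnocinj (Subtype.ext_iff.1 hij)⟩
  have hind' : AffineIndependent ℝ fun i =>
      liftPoint ((Fin.snoc (α := fun _ => Fin d → ℝ) P v : Fin (d + 1) → _) i) := by
    have h := hind.comp_embedding f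
    exact h
  obtain ⟨e, rfl⟩ : ∃ e, d = e + 1 := ⟨d - 1, by omega⟩
  have hFfin : (liftComplex K).faces.Finite := hK.image _
  have hFV : ∀ X ∈ (liftComplex K).faces, ∀ x ∈ X, x ∈ V.map liftPoint := by
    rintro _ ⟨τ, hτ, rfl⟩ x hx
    obtain ⟨y, hy, rfl⟩ := Finset.mem_image.1 hx
    exact List.mem_map_of_mem ((hV y).2 (K.down_closed hτ
      (Finset.singleton_subset_iff.2 hy) (Finset.singleton_nonempty _)))
  have hspec := Prog.spec_isLiftedSimplex (Q := Q) hd hPV hvV hind' (fun x hx hxP hxv => by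
    refine hgen x ((hV x).1 hx) fun h => ?_
    rcases Finset.mem_insert.1 h with h | h
    · exact hxv h
    · exact hxP (by simpa using h)) hFfin hFV (countsSimplices_of_isLiftedOracle hO)
  refine ⟨hspec.result.trans ?_, ?_, ?_⟩
  · exact (Finset.image_injective liftPoint_injective).mem_set_image
  · rw [Prog.diagrams, Set.ncard]
    exact ENat.toNat_le_of_le_natCast hspec.directions
  · refine (Nat.cast_le.2 hspec.time).trans ?_
    rw [← hn]
    refine liftedSimplexTime_le_real hd hn2 ?_
    -- The diagrams have at most n_{d−1} + n_d points, and n_d ≤ n₀ n_{d−1} brings this below 2 n₀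
    -- n_{d−1}.
    have h1 := ncard_faces_succ_le K hK hVfin hd
    have h2 : 1 ≤ {τ ∈ K.faces | τ.card = e + 1}.ncard :=
      (Set.ncard_pos (hK.subset fun τ hτ => hτ.1)).2 ⟨_, hσ, hσd⟩
    nlinarith
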